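/- **Theorem (distribution-aware interval coverage of SAOCP).** There is an absolute constant $C>0$ such that the following holds. *Setting.* Let $\alpha\in(0,1)$, $D>0$, $T\ge 2$, and let $g\ge1$ be an integer. Data $(X_t,Y_t)$, $t\in[T]$, arrive sequentially. For each $t$ there is a family of prediction sets $\hat C_t(x,s)$ ($x\in\mathcal X$, $s\in\mathbb R$; possibly random, e.g. built from past data) that is nested: $\hat C_t(x,s)\subseteq\hat C_t(x,s')$ for $s\le s'$. The true radius $S_t=\inf\{s\in\mathbb R: Y_t\in\hat C_t(X_t,s)\}$ is a (finite) random variable. Let $\ell_{1-\alpha}(S,s)=\max\{(1-\alpha)(S-s),\alpha(s-S)\}$ and $\ell^{(t)}=\ell_{1-\alpha}(S_t,\cdot)$. *Algorithm (SAOCP).* Put $\hat s_0=0$ and $L(i)=g\cdot\max\{2^n: 2^n\mid i\}$. In round $t=1,\dots,T$: (1) create expert $t$ with radius $\hat s_{t,t}=\hat s_{t-1}$ and weight $w_{t,t}=0$; let $\mathrm{Active}(t)=\{i: t-L(i)<i\le t\}$; (2) let $\pi_i\propto i^{-2}(1+\lfloor\log_2 i\rfloor)^{-1}$ on $\mathrm{Active}(t)$,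 $\hat p_i=\pi_i[w_{i,t}]_+$, and $p=\hat p/\|\hat p\|_1$ if $\|\hat p\|_1>0$, else $p=\pi$; (3) predict $\hat s_t=\sum_{i\in\mathrm{Active}(t)}p_i\hat s_{i,t}$ (and $\hat s_1=0$), output $\hat C_t(X_t)=\hat C_t(X_t,\hat s_t)$, and observe $S_t$; (4) for each $i\in\mathrm{Active}(t)$, with $\nabla_{i,j}=\alpha-\mathbf 1[\hat s_{i,j}<S_j]$, update $$\hat s_{i,t+1}=\hat s_{i,t}-\frac{D}{\sqrt3}\,\frac{\nabla_{i,t}}{\sqrt{\sum_{j=i}^t\nabla_{i,j}^2}},\qquad w_{i,t+1}=\frac{\sum_{j=i}^t g_{i,j}}{t-i+2}\Bigl(1+\sum_{j=i}^t w_{i,j}g_{i,j}\Bigr),$$ where $g_{i,t}=\frac1D\bigl(\ell^{(t)}(\hat s_t)-\ell^{(t)}(\hat s_{i,t})\bigr)$ if $w_{i,t}>0$, and $g_{i,t}$ is the positive part of this quantity if $w_{i,t}\le0$. *Assumptions.* Let $\mathcal F_t=\sigma(\{X_i,\hat s_i,S_i\}_{i<t},X_t)$ and let $s_t^\star=Q_{1-\alpha}(S_t\mid\mathcal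 F_t)$ be the conditional $(1-\alpha)$-quantile of $S_t$. Let $L>0$, $b>0$, $q\ge2$ and $\Delta_t>0$ ($t\in[T]$) be constants such that, for every $t\in[T]$, almost surely $S_t\mid\mathcal F_t$ has a density $f_t$ that vanishes outside $[0,D]$ and satisfies $f_t(s)\le L/D$ for all $s\in[0,D]$ and $$f_t(s)\ge\frac{2b}{D}\Bigl|\frac{2(s-s_t^\star)}{D}\Bigr|^{q-2}\qquad\text{for all } s\in[s_t^\star-\Delta_t,\,s_t^\star+\Delta_t].$$ *Conclusion.* For every interval $I=[\tau,\tau+k-1]\subseteq[T]$ with $k\ge1$, put $\Delta_I=\min_{t\in I}\Delta_t$ and $$\mathrm{Var}_I=\sum_{t\in I}\mathbb E\Bigl[\Bigl(\frac{s_t^\star}{D}-\frac1{kD}\sum_{i\in I}\mathbb E[s_i^\star\mid\mathcal F_\tau]\Bigr)^2\Bigr].$$ Then $$\frac1{|I|}\sum_{t\in I}\mathbb E\Bigl|\frac{\hat s_t-s_t^\star}{D}\Bigr|\le C\,\frac{1}{b^{1/q}}\frac D{\Delta_I}\Bigl(\frac{\log T}{|I|}\Bigr)^{\frac1{2q}}+C\,\frac{L^{1/q}}{b^{1/q}}\frac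 D{\Delta_I}\Bigl(\frac{\mathrm{Var}_I}{|I|}\Bigr)^{\frac1q}$$ and $$\frac1{|I|}\sum_{t\in I}\bigl|\mathbb P[Y_t\in\hat C_t(X_t)]-(1-\alpha)\bigr|\le C\,\frac{L}{b^{1/q}}\frac D{\Delta_I}\Bigl(\frac{\log T}{|I|}\Bigr)^{\frac1{2q}}+C\,\frac{L^{1+1/q}}{b^{1/q}}\frac D{\Delta_I}\Bigl(\frac{\mathrm{Var}_I}{|I|}\Bigr)^{\frac1q}.$$ -/

import Mathlib

open MeasureTheory ProbabilityTheory

/-- The `(1 - α)`-quantile (pinball) loss `ℓ_{1-α}(S, s)`. -/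
noncomputable def quantileLoss (α S s : ℝ) : ℝ :=
  max ((1 - α) * (S - s)) (α * (s - S))

/-- The subgradient `α - 1[s < S]` of `ℓ_{1-α}(S, ·)` at `s`. -/
noncomputable def quantileGrad (α S s : ℝ) : ℝ :=
  α - if s < S then 1 else 0

namespace SAOCP

/-- The lifetime of expert `i ≥ 1`: `g` times the largest power of two dividing `i`. -/
def lifetime (g i : ℕ) : ℕ := g * 2 ^ padicValNat 2 i

/-- The experts that are active in round `t`: `t - lifetime i < i ≤ t`. -/
def active (g t : ℕ) : Finset ℕ :=
  (Finset.Icc 1 t).filter (fun i => t < i + lifetime g i)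

/-- The memory of the algorithm at a point of round `t`. The fields are indexed by experts. -/
structure State where
  /-- `ŝ_{i,t}`, the current radius of expert `i` -/
  radius : ℕ → ℝ
  /-- the sum of the squared loss gradients seen by expert `i` since its creation -/
  gradSq : ℕ → ℝ
  /-- `∑ j, g_{i,j}` over the past rounds `j ≥ i` -/
  gain : ℕ → ℝ
  /-- `∑ j, w_{i,j} * g_{i,j}` over the past rounds `j ≥ i` -/
  bet : ℕ → ℝ
  /-- `w_{i,t}`, the current weight of expert `i` -/
  weight : ℕ → ℝ
  /-- the radius predicted in the last completed round -/
  last : ℝ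

/-- The memory before the first round. -/
def State.init : State := ⟨0, 0, 0, 0, 0, 0⟩

/-- Start of round `t`: expert `t` is created at the last predicted radius, with weight `0`. -/
def State.spawn (t : ℕ) (σ : State) : State where
  radius := Function.update σ.radius t σ.last
  gradSq := Function.update σ.gradSq t 0
  gain := Function.update σ.gain t 0
  bet := Function.update σ.bet t 0
  weight := Function.update σ.weight t 0
  last := σ.last

/-- The prior weight of expert `i`, before normalization over the active experts. -/
noncomputable def priorMass (i : ℕ) : ℝ :=
  ((i : ℝ) ^ 2)⁻¹ * (1 + (Nat.log 2 i : ℝ))⁻¹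

/-- The prior probability `π_i` of an active expert `i` in round `t`. -/
noncomputable def prior (g t i : ℕ) : ℝ :=
  priorMass i / ∑ j ∈ active g t, priorMass j

/-- The unnormalized probability `π_i [w_{i,t}]_+` of an active expert `i` in round `t`. -/
noncomputable def State.unnormalized (g t : ℕ) (σ : State) (i : ℕ) : ℝ :=
  prior g t i * max (σ.weight i) 0

/-- The aggregation probability of an active expert `i` in round `t`. -/
noncomputable def State.prob (g t : ℕ) (σ : State) (i : ℕ) : ℝ :=
  if 0 < ∑ j ∈ active g t, σ.unnormalized g t j then
    σ.unnormalized g t i / ∑ j ∈ active g t, σ.unnormalized g t j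
  else prior g t i

/-- The radius `ŝ_t` predicted in round `t`, from the memory after expert `t` was created. -/
noncomputable def State.predict (g t : ℕ) (σ : State) : ℝ :=
  if t = 1 then 0 else ∑ i ∈ active g t, σ.prob g t i * σ.radius i

/-- `g_{i,t}`: the normalized loss difference between the prediction and expert `i`,
truncated at `0` from below if the weight of the expert is not positive. -/
noncomputable def State.roundGain (α D : ℝ) (g t : ℕ) (S : ℝ) (σ : State) (i : ℕ) : ℝ :=
  if 0 < σ.weight i then
    (quantileLoss α S (σ.predict g t) - quantileLoss α S (σ.radius i)) / D
  else
    max (quantileLoss α S (σ.predict g t) - quantileLoss α S (σ.radius i)) 0 / D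

/-- End of round `t`, when the true radius `S` is known: every active expert makes a step of
scale-free online gradient descent with learning rate `D / √3`, and its weight is updated by coin
betting: the new weight is the betting fraction (the total gain over one plus the number `t - i + 1`
of rounds played) times the wealth `1 + ∑ j, w_{i,j} g_{i,j}`. -/
noncomputable def State.finish (α D : ℝ) (g t : ℕ) (S : ℝ) (σ : State) : State where
  radius i :=
    if i ∈ active g t then
      σ.radius i - D / √3 * (quantileGrad α S (σ.radius i) /
        √(σ.gradSq i + quantileGrad α S (σ.radius i) ^ 2))
    else σ.radius i
  gradSq i :=
    if i ∈ active g t then σ.gradSq i + quantileGrad α S (σ.radius i) ^ 2 else σ.gradSq i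
  gain i :=
    if i ∈ active g t then σ.gain i + σ.roundGain α D g t S i else σ.gain i
  bet i :=
    if i ∈ active g t then σ.bet i + σ.weight i * σ.roundGain α D g t S i else σ.bet i
  weight i :=
    if i ∈ active g t then
      (σ.gain i + σ.roundGain α D g t S i) / ((t : ℝ) - (i : ℝ) + 2) *
        (1 + (σ.bet i + σ.weight i * σ.roundGain α D g t S i))
    else σ.weight i
  last := σ.predict g t

/-- The memory after rounds `1, …, t`, when the true radii are `S 1, S 2, …`. -/
noncomputable def stateAfter (α D : ℝ) (g : ℕ) (S : ℕ → ℝ) : ℕ → State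
  | 0 => State.init
  | t + 1 => ((stateAfter α D g S t).spawn (t + 1)).finish α D g (t + 1) (S (t + 1))

/-- The radius `ŝ_t` predicted by the algorithm in round `t ≥ 1`, when the true radii are
`S 1, S 2, …`; it depends on `S 1, …, S (t - 1)` only. -/
noncomputable def radius (α D : ℝ) (g : ℕ) (S : ℕ → ℝ) (t : ℕ) : ℝ :=
  ((stateAfter α D g S (t - 1)).spawn t).predict g t

end SAOCP

section Probability

variable {Ω : Type*} [MeasurableSpace Ω] {𝒳 : Type*} [MeasurableSpace 𝒳]

/-- The radius `ŝ_t` predicted by the algorithm, as a random variable. -/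
noncomputable def predictedRadius (α D : ℝ) (g : ℕ) (S : ℕ → Ω → ℝ) (t : ℕ) (ω : Ω) : ℝ :=
  SAOCP.radius α D g (fun i => S i ω) t

/-- `𝓕_t = σ((X_i, ŝ_i, S_i) for 1 ≤ i < t, X_t)`. -/
@[reducible] noncomputable def pastSigma (α D : ℝ) (g : ℕ) (X : ℕ → Ω → 𝒳) (S : ℕ → Ω → ℝ) (t : ℕ) :
    MeasurableSpace Ω :=
  (⨆ i ∈ Set.Ico 1 t,
    MeasurableSpace.comap (X i) inferInstance ⊔
      MeasurableSpace.comap (predictedRadius α D g S i) inferInstance ⊔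
      MeasurableSpace.comap (S i) inferInstance) ⊔
    MeasurableSpace.comap (X t) inferInstance

/-- The regular conditional distribution of the real random variable `Z` given `m`. -/
noncomputable def condLaw (μ : Measure Ω) [IsFiniteMeasure μ] (m : MeasurableSpace Ω)
    (Z : Ω → ℝ) (ω : Ω) : Measure ℝ :=
  @condDistrib Ω Ω ℝ _ _ _ _ m Z id μ _ ω

/-- The `p`-quantile `inf {s | p ≤ ν (-∞, s]}` of a distribution on the line. -/
noncomputable def lawQuantile (p : ℝ) (ν : Measure ℝ) : ℝ :=
  sInf {s : ℝ | p ≤ ν.real (Set.Iic s)}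

/-- The conditional law of `S_t` given `𝓕_t`. -/
noncomputable def radiusLaw (μ : Measure Ω) [IsFiniteMeasure μ] (α D : ℝ) (g : ℕ)
    (X : ℕ → Ω → 𝒳) (S : ℕ → Ω → ℝ) (t : ℕ) (ω : Ω) : Measure ℝ :=
  condLaw μ (pastSigma α D g X S t) (S t) ω

/-- `s_t^⋆`, the conditional `(1 - α)`-quantile of `S_t` given `𝓕_t`. -/
noncomputable def trueQuantile (μ : Measure Ω) [IsFiniteMeasure μ] (α D : ℝ) (g : ℕ)
    (X : ℕ → Ω → 𝒳) (S : ℕ → Ω → ℝ) (t : ℕ) (ω : Ω) : ℝ :=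
  lawQuantile (1 - α) (radiusLaw μ α D g X S t ω)

/-- `f` is a density of `ν` with respect to Lebesgue measure, and `ν` is carried by `[0, D]`. -/
structure IsDensityOn (D : ℝ) (ν : Measure ℝ) (f : ℝ → ℝ) : Prop where
  measurable : Measurable f
  nonneg : ∀ s, 0 ≤ f s
  eq_zero : ∀ s, s ∉ Set.Icc 0 D → f s = 0
  eq_withDensity : ν = volume.withDensity (fun s => ENNReal.ofReal (f s))

/-- For every `t ∈ [T]`, almost surely `S_t` given `𝓕_t` has a density on `[0, D]` that is at most
`L / D`. -/
def DensityUpperBound (μ : Measure Ω) [IsFiniteMeasure μ] (α D : ℝ) (g T : ℕ)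
    (X : ℕ → Ω → 𝒳) (S : ℕ → Ω → ℝ) (L : ℝ) : Prop :=
  ∀ t ∈ Set.Icc 1 T, ∀ᵐ ω ∂μ, ∃ f : ℝ → ℝ, IsDensityOn D (radiusLaw μ α D g X S t ω) f ∧
    ∀ s ∈ Set.Icc 0 D, f s ≤ L / D

/-- For every `t ∈ [T]`, almost surely `S_t` given `𝓕_t` has a density `f` on `[0, D]` with
`f s ≥ (2b/D) |2(s - s_t^⋆)/D|^(q-2)` for all `s` in `[s_t^⋆ - Δ_t, s_t^⋆ + Δ_t]`. -/
def DensityLowerBound (μ : Measure Ω) [IsFiniteMeasure μ] (α D : ℝ) (g T : ℕ)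
    (X : ℕ → Ω → 𝒳) (S : ℕ → Ω → ℝ) (b q : ℝ) (Δ : ℕ → ℝ) : Prop :=
  ∀ t ∈ Set.Icc 1 T, ∀ᵐ ω ∂μ, ∃ f : ℝ → ℝ, IsDensityOn D (radiusLaw μ α D g X S t ω) f ∧
    ∀ s ∈ Set.Icc (trueQuantile μ α D g X S t ω - Δ t) (trueQuantile μ α D g X S t ω + Δ t),
      2 * b / D * |2 * (s - trueQuantile μ α D g X S t ω) / D| ^ (q - 2) ≤ f s

/-- The interval quantile variation `Var_I` of `I = [τ, τ + k - 1]`. -/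
noncomputable def intervalVariation (μ : Measure Ω) [IsFiniteMeasure μ] (α D : ℝ) (g : ℕ)
    (X : ℕ → Ω → 𝒳) (S : ℕ → Ω → ℝ) (τ k : ℕ) : ℝ :=
  ∑ t ∈ Finset.Icc τ (τ + k - 1),
    ∫ ω, (trueQuantile μ α D g X S t ω / D -
      1 / (k * D) * ∑ i ∈ Finset.Icc τ (τ + k - 1),
        (μ[trueQuantile μ α D g X S i | pastSigma α D g X S τ]) ω) ^ 2 ∂μ

/-- `Δ_I = min {Δ_t | t ∈ I}` for `I = [τ, τ + k - 1]`. -/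
noncomputable def intervalMargin (Δ : ℕ → ℝ) (τ k : ℕ) : ℝ :=
  sInf (Δ '' Set.Icc τ (τ + k - 1))

/-- The nested prediction sets `Ĉ_t(x, s)` (random, since they may be built from past data) and the
true radii: almost surely, for all `t ∈ [T]`, `S_t` is the (finite) infimum of the radii `s` for
which `Ĉ_t(X_t, s)` contains the label `Y_t`. -/
structure IsConformalSetting {𝒴 : Type*} (μ : Measure Ω) (T : ℕ)
    (Chat : ℕ → Ω → 𝒳 → ℝ → Set 𝒴) (X : ℕ → Ω → 𝒳) (Y : ℕ → Ω → 𝒴) (S : ℕ → Ω → ℝ) : Prop where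
  nested : ∀ t ω x, Monotone (Chat t ω x)
  measurable_input : ∀ t, Measurable (X t)
  measurable_radius : ∀ t, Measurable (S t)
  isGLB_radius : ∀ t ∈ Set.Icc 1 T, ∀ᵐ ω ∂μ, IsGLB {s : ℝ | Y t ω ∈ Chat t ω (X t ω) s} (S t ω)

end Probability

/-! The statistical half is short. On every interval `I` and for every sequence of radii in `[0,
D]`, the algorithm has regret `O(D √(|I| log T))` against any fixed point of `[0, D]`
(`SAOCP.interval_regret`). This is applied pathwise to `meanQuantile`, which is known at the start
of `I`. The excess quantile risk of the predictions is thus at most this regret plus the excess risk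
of `meanQuantile`. A bounded density makes the latter at most quadratic (`IsDensityOn.excess_le`),
which produces `Var_I`; the lower bound on the density makes the former at least a `q`-th power of
the distance to the true quantile (`IsDensityOn.le_excess`). Jensen then gives the distance bound,
and the Lipschitz property of the distribution functions turns distance into coverage.

The hard half is the regret. Each expert has regret `O(√n)` by scale-free gradient descent, so the
gain of each expert over the algorithm has to be bounded. The bets of a round do not win on average
over the prior (`State.sum_bet_nonpos`); hence, if all wealths stay nonnegative, each is polynomial
in `T` (`expertWealth_le`). It remains to show that wealths stay positive and that a large gain
forces a large wealth. The usual coin betting argument needs gains in `[-1, 1]`. Here radii may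
leave `[0, 1]` (after scaling by `D`) by up to `rate = 1 / √3`, and losses may exceed `1`. By
reflection it is enough to treat `α ≤ 1 / 2`.

Positivity: predictions average experts that have already reacted to the last radius, so a
prediction can be far below `0` only after a small radius, that is, after a cheap round. The
potential `credit` moves this surplus to the next round and keeps the betting fraction at most
`lossCap α < 1`. The losses of an expert are also at most `lossCap α`, except at its first step up;
before that step the expert only moved down, and the accumulated `deficit` keeps its gain small
enough.

Large gain implies large wealth: with `B` the positive part of the betting fraction, the potential
`(n + 1) * betPot B` is compared with the log-wealth. A negative gain costs `betPen` per unit of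
expert loss. Weighted regret against the comparator `1 - α`, whose loss is at most `α (1 - α)`,
replaces these losses by `α (1 - α)`, and `netDrift_ge` says that the drift of the potential pays
for that. For very small `α` the price degenerates near `B = 1`; there the total loss of the expert
is so small that `B` drops below `1 / 3` by itself (`BettingRun.betPot_le_of_small`). -/

namespace SAOCP

/-! ### Scale-free gradient descent of a single expert -/

/-- The normalized learning rate `1 / √3` of the experts. -/
noncomputable def rate : ℝ := 1 / √3

lemma rate_sq : rate ^ 2 = 1 / 3 := by
  unfold rate; rw [div_pow, Real.sq_sqrt (by norm_num)]; norm_num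

lemma rate_pos : 0 < rate := by unfold rate; positivity

lemma rate_gt : 0.57735 < rate := by
  have := rate_sq; have := rate_pos; nlinarith

lemma rate_lt : rate < 0.577351 := by
  have := rate_sq; have := rate_pos; nlinarith

/-- How far an expert that has already moved up can fall below `0`. -/
noncomputable def overshoot (α : ℝ) : ℝ := rate * α / √(α ^ 2 + (1 - α) ^ 2)

/-- A normalized scale-free gradient descent run of length `N` on quantile losses with radii in
`[0, 1]`; ties between the iterate and the radius may be broken in both ways. -/
structure OGDPath (α : ℝ) (N : ℕ) (S r d : ℕ → ℝ) : Prop where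
  radius_mem : ∀ n < N, S n ∈ Set.Icc (0 : ℝ) 1
  start_mem : r 0 ∈ Set.Icc (-rate) (1 + rate)
  grad : ∀ n < N, (d n = α ∧ S n ≤ r n) ∨ (d n = α - 1 ∧ r n ≤ S n)
  step : ∀ n < N, r (n + 1) = r n - rate * (d n / √(∑ k ∈ Finset.range (n + 1), d k ^ 2))

variable {α : ℝ} {N : ℕ} {S r d : ℕ → ℝ}

lemma OGDPath.mono (h : OGDPath α N S r d) {M : ℕ} (hM : M ≤ N) : OGDPath α M S r d :=
  ⟨fun n hn => h.radius_mem n (hn.trans_le hM), h.start_mem,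
    fun n hn => h.grad n (hn.trans_le hM), fun n hn => h.step n (hn.trans_le hM)⟩

/-- The quantile problem is symmetric under `s ↦ 1 - s`, `α ↦ 1 - α`. Ties change sides, which is
why `grad` admits both ways of breaking them. This gives upper bounds from lower ones and later
allows `α ≤ 1 / 2`. -/
lemma OGDPath.reflect (h : OGDPath α N S r d) :
    OGDPath (1 - α) N (fun n => 1 - S n) (fun n => 1 - r n) (fun n => - d n) := by
  refine ⟨fun n hn => ?_, ?_, fun n hn => ?_, fun n hn => ?_⟩
  · have := h.radius_mem n hn
    constructor <;> linarith [this.1, this.2]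
  · have := h.start_mem
    constructor <;> linarith [this.1, this.2]
  · rcases h.grad n hn with ⟨h1, h2⟩ | ⟨h1, h2⟩
    · right; constructor <;> linarith
    · left; constructor <;> linarith
  · have := h.step n hn
    simp only [neg_sq]
    rw [this]; ring

lemma OGDPath.abs_grad_le (hα : 0 < α) (hα1 : α < 1) (h : OGDPath α N S r d) {n : ℕ} (hn : n < N) :
    |d n| ≤ 1 := by
  rcases h.grad n hn with ⟨h1, _⟩ | ⟨h1, _⟩ <;> rw [h1, abs_le] <;> constructor <;> linarith

lemma OGDPath.grad_ne (hα : 0 < α) (hα1 : α < 1) (h : OGDPath α N S r d) {n : ℕ} (hn : n < N) :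
    d n ≠ 0 := by
  rcases h.grad n hn with ⟨h1, _⟩ | ⟨h1, _⟩ <;> rw [h1] <;> linarith

/-- The current gradient is part of its own normalization, so no step is longer than `rate`. -/
lemma abs_div_sqrt_sum_le (d : ℕ → ℝ) (n : ℕ) :
    |d n / √(∑ k ∈ Finset.range (n + 1), d k ^ 2)| ≤ 1 := by
  rw [abs_div, abs_of_nonneg (Real.sqrt_nonneg _)]
  apply div_le_one_of_le₀ _ (Real.sqrt_nonneg _)
  apply Real.le_sqrt_of_sq_le
  rw [sq_abs, Finset.sum_range_succ]
  have : 0 ≤ ∑ k ∈ Finset.range n, d k ^ 2 := Finset.sum_nonneg fun _ _ => sq_nonneg _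
  linarith

lemma OGDPath.down_step (hα : 0 < α) (h : OGDPath α N S r d) {n : ℕ} (hn : n < N)
    (hd : d n = α) : S n ≤ r n ∧ S n - rate ≤ r (n + 1) ∧ r (n + 1) ≤ r n := by
  have hS : S n ≤ r n := by
    rcases h.grad n hn with ⟨_, h2⟩ | ⟨h1, _⟩
    · exact h2
    · linarith
  have h1 := (abs_le.1 (abs_div_sqrt_sum_le d n)).2
  have h2 : 0 ≤ d n / √(∑ k ∈ Finset.range (n + 1), d k ^ 2) := by rw [hd]; positivity
  have hr := rate_pos
  rw [h.step n hn]
  refine ⟨hS, ?_, ?_⟩ <;> nlinarith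

lemma OGDPath.up_step (hα1 : α < 1) (h : OGDPath α N S r d) {n : ℕ} (hn : n < N)
    (hd : d n = α - 1) : r n ≤ S n ∧ r (n + 1) ≤ S n + rate ∧ r n ≤ r (n + 1) := by
  have hS : r n ≤ S n := by
    rcases h.grad n hn with ⟨h1, _⟩ | ⟨_, h2⟩
    · linarith
    · exact h2
  have h1 := (abs_le.1 (abs_div_sqrt_sum_le d n)).1
  have h2 : d n / √(∑ k ∈ Finset.range (n + 1), d k ^ 2) ≤ 0 :=
    div_nonpos_of_nonpos_of_nonneg (by linarith) (Real.sqrt_nonneg _)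
  have hr := rate_pos
  rw [h.step n hn]
  refine ⟨hS, ?_, ?_⟩ <;> nlinarith

/-- A step down starts at or above a radius in `[0, 1]`, a step up at or below one, and both have
length at most `rate`. -/
lemma OGDPath.mem (hα : 0 < α) (hα1 : α < 1) (h : OGDPath α N S r d) :
    ∀ n ≤ N, r n ∈ Set.Icc (-rate) (1 + rate) := by
  intro n
  induction n with
  | zero => intro _; exact h.start_mem
  | succ n ih =>
    intro hn
    have hi := ih (by omega)
    have hS := h.radius_mem n (by omega)
    rcases h.grad n (by omega) with ⟨h1, _⟩ | ⟨h1, _⟩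
    · have := h.down_step hα (n := n) (by omega) h1
      constructor <;> linarith [hi.1, hi.2, hS.1, hS.2]
    · have := h.up_step hα1 (n := n) (by omega) h1
      constructor <;> linarith [hi.1, hi.2, hS.1, hS.2]

/-- As long as an expert has only moved down, its `n`-th step has size `rate / √n`. -/
lemma OGDPath.step_of_down (hα : 0 < α) (h : OGDPath α N S r d) {n : ℕ} (hn : n < N)
    (hd : ∀ k ≤ n, d k = α) : r (n + 1) = r n - rate / √((n : ℝ) + 1) := by
  rw [h.step n hn]
  have : ∑ k ∈ Finset.range (n + 1), d k ^ 2 = ((n : ℝ) + 1) * α ^ 2 := by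
    rw [Finset.sum_congr rfl (g := fun _ => α ^ 2)]
    · simp
    · intro k hk
      rw [hd k (by have := Finset.mem_range.1 hk; omega)]
  rw [this, hd n le_rfl, Real.sqrt_mul (by positivity), Real.sqrt_sq hα.le]
  have : 0 < √((n : ℝ) + 1) := Real.sqrt_pos.2 (by positivity)
  field_simp

lemma overshoot_pos (hα : 0 < α) : 0 < overshoot α := by
  unfold overshoot
  have := rate_pos
  have : 0 < √(α ^ 2 + (1 - α) ^ 2) := Real.sqrt_pos.2 (by positivity)
  positivity

/-- The last steps down before a first step up do not outweigh that step by more than the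
overshoot. -/
lemma inv_sqrt_le_add (hα : 0 < α) (hα1 : α < 1) {n : ℝ} (hn : 1 ≤ n) :
    1 / √n ≤ α / √(α ^ 2 + (1 - α) ^ 2) + (1 - α) / √(n * α ^ 2 + (1 - α) ^ 2) := by
  have hβ : 0 < 1 - α := by linarith
  set β := 1 - α
  have ha : 0 < α ^ 2 + β ^ 2 := by positivity
  have hc : 0 < n * α ^ 2 + β ^ 2 := by positivity
  have h1 : 0 ≤ α / √(α ^ 2 + β ^ 2) := by positivity
  have h2 : 0 ≤ β / √(n * α ^ 2 + β ^ 2) := by positivity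
  apply le_of_sq_le_sq _ (by positivity)
  -- The inequality already holds for the squares, without the cross term of the right-hand side.
  have e : (1 / √n) ^ 2 ≤ (α / √(α ^ 2 + β ^ 2)) ^ 2 + (β / √(n * α ^ 2 + β ^ 2)) ^ 2 := by
    rw [div_pow, div_pow, div_pow, Real.sq_sqrt (by positivity), Real.sq_sqrt ha.le,
      Real.sq_sqrt hc.le, div_add_div _ _ ha.ne' hc.ne', div_le_div_iff₀ (by positivity)
      (by positivity)]
    have : 0 ≤ (n - 1) * (n * α ^ 4 + 1 * (α ^ 2 * β ^ 2) + β ^ 4) := by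
      apply mul_nonneg (by linarith); positivity
    have : 0 ≤ (n - 1) * (α ^ 2 * β ^ 2) := by
      apply mul_nonneg (by linarith); positivity
    nlinarith [mul_nonneg (sub_nonneg.2 hn) (by positivity : 0 ≤ n * α ^ 4),
      mul_nonneg (sub_nonneg.2 hn) (by positivity : 0 ≤ β ^ 4),
      mul_nonneg (sub_nonneg.2 hn) (by positivity : 0 ≤ α ^ 2 * β ^ 2)]
  nlinarith [mul_nonneg h1 h2]

/-- If an expert is above all radii seen after `n ≥ 1` steps down, it is at least `-rate / √n`. -/
lemma OGDPath.ge_of_down (hα : 0 < α) (h : OGDPath α N S r d) {n : ℕ} (hn : n < N)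
    (hd : ∀ k ≤ n, d k = α) : - (rate / √((n : ℝ) + 1)) ≤ r (n + 1) := by
  rw [h.step_of_down hα hn hd]
  have := (h.down_step hα hn (hd n le_rfl)).1
  linarith [(h.radius_mem n hn).1]

/-- Once a step up has put `(1 - α) ^ 2` into the normalization, a step down starts at or above `0`
and has length at most `overshoot α`. The first step up itself starts at `-rate / √n` or higher
after `n ≥ 1` steps down, and `inv_sqrt_le_add` shows that it climbs far enough. -/
lemma OGDPath.ge_neg_overshoot (hα : 0 < α) (hα1 : α < 1) (h : OGDPath α N S r d) :
    ∀ n ≤ N, (∃ k < n, d k = α - 1) → -overshoot α ≤ r n := by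
  intro n
  induction n with
  | zero => rintro _ ⟨k, hk, _⟩; omega
  | succ n ih =>
    rintro hn ⟨k0, hk0, hdk0⟩
    have hn' : n < N := by omega
    have hov := overshoot_pos hα
    have hb := rate_pos
    by_cases hup : ∃ k < n, d k = α - 1
    · rcases h.grad n hn' with ⟨h1, h2⟩ | ⟨h1, h2⟩
      · obtain ⟨k, hk, hdk⟩ := hup
        have hS := (h.radius_mem n hn').1
        have hG : α ^ 2 + (1 - α) ^ 2 ≤ ∑ k ∈ Finset.range (n + 1), d k ^ 2 := by
          rw [Finset.sum_range_succ, h1]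
          have := Finset.single_le_sum (f := fun k => d k ^ 2) (fun _ _ => sq_nonneg _)
            (Finset.mem_range.2 hk)
          simp only [hdk] at this
          nlinarith
        rw [h.step n hn', h1]
        have : α / √(∑ k ∈ Finset.range (n + 1), d k ^ 2) ≤ α / √(α ^ 2 + (1 - α) ^ 2) := by
          gcongr
        have := mul_le_mul_of_nonneg_left this hb.le
        unfold overshoot
        rw [mul_div_assoc]
        linarith
      · linarith [ih hn'.le hup, (h.up_step hα1 hn' h1).2.2]
    · have hall : ∀ k < n, d k = α := by
        intro k hk
        rcases h.grad k (by omega) with ⟨h1, _⟩ | ⟨h1, _⟩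
        · exact h1
        · exact absurd ⟨k, hk, h1⟩ hup
      have hkn : k0 = n := by
        by_contra hne
        exact hup ⟨k0, by omega, hdk0⟩
      subst hkn
      have hG : ∑ k ∈ Finset.range (k0 + 1), d k ^ 2 = (k0 : ℝ) * α ^ 2 + (1 - α) ^ 2 := by
        rw [Finset.sum_range_succ, hdk0, Finset.sum_congr rfl (g := fun _ => α ^ 2)]
        · simp only [Finset.sum_const, Finset.card_range, nsmul_eq_mul]; ring
        · intro k hk
          rw [hall k (Finset.mem_range.1 hk)]
      rw [h.step k0 hn', hG, hdk0]
      -- If the very first step is up, its length is exactly `rate`, which makes up for any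
      -- admissible start.
      rcases k0 with _ | m
      · have : √((1 - α) ^ 2) = 1 - α := Real.sqrt_sq (by linarith)
        simp only [Nat.cast_zero, zero_mul, zero_add, this]
        have : (α - 1) / (1 - α) = -1 := by rw [div_eq_iff (by linarith)]; ring
        rw [this]
        linarith [h.start_mem.1]
      · have h1 := h.ge_of_down hα (n := m) (by omega) (fun k hk => hall k (by omega))
        have h2 := inv_sqrt_le_add hα hα1 (n := (m : ℝ) + 1) (by linarith [m.cast_nonneg (α := ℝ)])
        have h3 := mul_le_mul_of_nonneg_left h2 hb.le
        unfold overshoot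
        push_cast
        have e1 : (α - 1) / √(((m : ℝ) + 1) * α ^ 2 + (1 - α) ^ 2) =
          - ((1 - α) / √(((m : ℝ) + 1) * α ^ 2 + (1 - α) ^ 2)) := by rw [← neg_div]; ring
        rw [e1, mul_div_assoc]
        rw [div_eq_mul_one_div rate] at h1
        linarith

/-- A step down ends within `rate` of the radius just seen; after a step up `ge_neg_overshoot`
applies. So an expert that has played a round is far below `0` only if the last radius was small. -/
lemma OGDPath.low_after_step (hα : 0 < α) (hα1 : α < 1) (h : OGDPath α N S r d) {n : ℕ}
    (hn : n < N) : min (-overshoot α) (S n - rate) ≤ r (n + 1) := by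
  rcases h.grad n hn with ⟨h1, _⟩ | ⟨h1, _⟩
  · exact (min_le_right _ _).trans (h.down_step hα hn h1).2.1
  · exact (min_le_left _ _).trans (h.ge_neg_overshoot hα hα1 (n + 1) hn ⟨n, by omega, h1⟩)

lemma OGDPath.high_after_step (hα : 0 < α) (hα1 : α < 1) (h : OGDPath α N S r d) {n : ℕ}
    (hn : n < N) : r (n + 1) ≤ max (1 + overshoot (1 - α)) (S n + rate) := by
  have := h.reflect.low_after_step (by linarith) (by linarith) hn
  rcases min_le_iff.1 this with h1 | h1
  · exact le_max_of_le_left (by linarith)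
  · exact le_max_of_le_right (by linarith)

/-- The loss of an expert dominates the linearized regret against any `u`. -/
lemma OGDPath.loss_sub_le (h : OGDPath α N S r d) {n : ℕ} (hn : n < N)
    (u : ℝ) : quantileLoss α (S n) (r n) - quantileLoss α (S n) u ≤ d n * (r n - u) := by
  unfold quantileLoss
  rcases h.grad n hn with ⟨h1, h2⟩ | ⟨h1, h2⟩ <;> rw [h1]
  · rw [max_eq_right (by nlinarith)]
    linarith [le_max_right ((1 - α) * (S n - u)) (α * (u - S n))]
  · rw [max_eq_left (by nlinarith)]
    linarith [le_max_left ((1 - α) * (S n - u)) (α * (u - S n))]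

/-- Weighted regret of scale-free gradient descent with slowly varying weights. -/
lemma OGDPath.weighted_regret (hα : 0 < α) (hα1 : α < 1) (h : OGDPath α N S r d) (ν : ℕ → ℝ)
    (hν : ∀ n, 0 ≤ ν n) {u : ℝ} (hu : u ∈ Set.Icc (0 : ℝ) 1) :
    ∑ n ∈ Finset.range N, ν n * (d n * (r n - u)) ≤
      3 * (ν N * √N) + 6 * ∑ n ∈ Finset.range N, |ν (n + 1) - ν n| * √((n : ℝ) + 1) := by
  have hb := rate_pos
  have hb1 := rate_gt
  have hb2 := rate_lt
  have hb3 := rate_sq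
  set s : ℕ → ℝ := fun n => √(∑ k ∈ Finset.range n, d k ^ 2) with hs
  have hs0 : ∀ n, 0 ≤ s n := fun n => Real.sqrt_nonneg _
  have hsle : ∀ n ≤ N, s n ≤ √n := by
    intro n hn
    apply Real.sqrt_le_sqrt
    calc ∑ k ∈ Finset.range n, d k ^ 2 ≤ ∑ k ∈ Finset.range n, 1 := by
          apply Finset.sum_le_sum
          intro k hk
          have := h.abs_grad_le hα hα1 (n := k) (by have := Finset.mem_range.1 hk; omega)
          rw [← sq_abs]
          nlinarith [abs_nonneg (d k)]
      _ = n := by simp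
  -- The usual quadratic potential, scaled by weight and normalization. Growth of `s` costs at most
  -- `2.2 + 0.6 ≤ 3` per unit, and a change of the weight costs `2.2` in the potential and `3` on
  -- the right, together at most `6`.
  have hmain : ∀ M ≤ N, ∑ n ∈ Finset.range M, ν n * (d n * (r n - u)) +
      ν M * s M / (2 * rate) * (r M - u) ^ 2 ≤
      3 * (ν M * s M) + 6 * ∑ n ∈ Finset.range M, |ν (n + 1) - ν n| * √((n : ℝ) + 1) := by
    intro M
    induction M with
    | zero => intro _; simp [hs]
    | succ M ih =>
      intro hM
      have hMN : M < N := by omega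
      have hi := ih hMN.le
      rw [Finset.sum_range_succ, Finset.sum_range_succ]
      have hsq : s (M + 1) ^ 2 = s M ^ 2 + d M ^ 2 := by
        simp only [hs]
        rw [Real.sq_sqrt (Finset.sum_nonneg fun _ _ => sq_nonneg _),
          Real.sq_sqrt (Finset.sum_nonneg fun _ _ => sq_nonneg _), Finset.sum_range_succ]
      have hdne := h.grad_ne hα hα1 hMN
      have hd2 : 0 < d M ^ 2 := by positivity
      have hspos : 0 < s (M + 1) := by
        rcases (hs0 (M + 1)).lt_or_eq with h1 | h1
        · exact h1
        · rw [← h1] at hsq; nlinarith [sq_nonneg (s M)]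
      have hmono : s M ≤ s (M + 1) := by
        apply le_of_sq_le_sq _ hspos.le; linarith
      have hs1 : s (M + 1) ≤ √((M : ℝ) + 1) := by exact_mod_cast hsle (M + 1) hM
      -- Both points lie within `1 + rate` of each other, and `(1 + rate) ^ 2 / (2 * rate) < 2.16`.
      have ha : ∀ m ≤ N, (r m - u) ^ 2 / (2 * rate) ≤ 2.2 := by
        intro m hm
        have := h.mem hα hα1 m hm
        rw [div_le_iff₀ (by positivity)]
        have h1 : |r m - u| ≤ 1 + rate := by
          rw [abs_le]; constructor <;> linarith [this.1, this.2, hu.1, hu.2]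
        rw [← sq_abs]
        nlinarith [abs_nonneg (r m - u)]
      have ha0 : ∀ m, 0 ≤ (r m - u) ^ 2 / (2 * rate) := fun m => by positivity
      set q : ℕ → ℝ := fun m => (r m - u) ^ 2 / (2 * rate) with hq
      have hstep : d M * (r M - u) ≤ s (M + 1) * (q M - q (M + 1)) + rate * (s (M + 1) - s M) := by
        have e : d M * (r M - u) = s (M + 1) * (q M - q (M + 1)) +
            rate * (d M ^ 2 / (2 * s (M + 1))) := by
          simp only [hq]
          rw [h.step M hMN]
          change _ = s (M + 1) * ((r M - u) ^ 2 / (2 * rate) -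
            (r M - rate * (d M / s (M + 1)) - u) ^ 2 / (2 * rate)) + _
          field_simp
          ring
        rw [e]
        -- Here `d M ^ 2` is a difference of consecutive squares of `s`, so the second-order terms
        -- telescope.
        have : d M ^ 2 / (2 * s (M + 1)) ≤ s (M + 1) - s M := by
          rw [div_le_iff₀ (by positivity)]
          nlinarith [hs0 M]
        nlinarith
      have e1 : ∀ m, ν m * s m / (2 * rate) * (r m - u) ^ 2 = ν m * s m * q m := by
        intro m; simp only [hq]; ring
      rw [e1] at hi ⊢
      have hν0 := hν M
      have hΔ := abs_nonneg (ν (M + 1) - ν M)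
      have hΔ1 := le_abs_self (ν (M + 1) - ν M)
      have hΔ2 := neg_abs_le (ν (M + 1) - ν M)
      set Δ := |ν (M + 1) - ν M|
      have h1 := mul_le_mul_of_nonneg_left hstep hν0
      have h2 : ν M * (s (M + 1) - s M) * q M ≤ ν M * (s (M + 1) - s M) * 2.2 :=
        mul_le_mul_of_nonneg_left (ha M hMN.le) (mul_nonneg hν0 (by linarith))
      have h3 : (ν (M + 1) - ν M) * (s (M + 1) * q (M + 1)) ≤ Δ * (s (M + 1) * 2.2) := by
        have : (ν (M + 1) - ν M) * (s (M + 1) * q (M + 1)) ≤ Δ * (s (M + 1) * q (M + 1)) :=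
          mul_le_mul_of_nonneg_right hΔ1 (mul_nonneg hspos.le (ha0 _))
        refine this.trans (mul_le_mul_of_nonneg_left ?_ hΔ)
        exact mul_le_mul_of_nonneg_left (ha _ hM) hspos.le
      have h4 : Δ * s (M + 1) ≤ Δ * √((M : ℝ) + 1) := mul_le_mul_of_nonneg_left hs1 hΔ
      have h5 : - Δ * s (M + 1) ≤ (ν (M + 1) - ν M) * s (M + 1) :=
        mul_le_mul_of_nonneg_right hΔ2 hspos.le
      have h6 : ν M * (s (M + 1) - s M) * rate ≤ ν M * (s (M + 1) - s M) * 0.6 :=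
        mul_le_mul_of_nonneg_left (by linarith) (mul_nonneg hν0 (by linarith))
      have h7 : 0 ≤ ν M * (s (M + 1) - s M) := mul_nonneg hν0 (by linarith)
      have h8 : 0 ≤ Δ * s (M + 1) := mul_nonneg hΔ hspos.le
      nlinarith
  have := hmain N le_rfl
  have h1 : 0 ≤ ν N * s N / (2 * rate) * (r N - u) ^ 2 := by
    have := hν N; have := hs0 N; positivity
  have h2 : ν N * s N ≤ ν N * √N := mul_le_mul_of_nonneg_left (hsle N le_rfl) (hν N)
  linarith

/-- Regret of scale-free gradient descent. -/
lemma OGDPath.regret (hα : 0 < α) (hα1 : α < 1) (h : OGDPath α N S r d) {u : ℝ}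
    (hu : u ∈ Set.Icc (0 : ℝ) 1) :
    ∑ n ∈ Finset.range N, (quantileLoss α (S n) (r n) - quantileLoss α (S n) u) ≤ 3 * √N := by
  have := h.weighted_regret hα hα1 (fun _ => 1) (fun _ => zero_le_one) hu
  simp only [one_mul, sub_self, abs_zero, zero_mul, Finset.sum_const_zero, mul_zero,
    add_zero] at this
  refine le_trans (Finset.sum_le_sum fun n hn => ?_) this
  exact h.loss_sub_le (Finset.mem_range.1 hn) u

end SAOCP

/-! ### Betting runs: credit and the bound on the betting fraction -/

namespace SAOCP

lemma quantileLoss_nonneg {α : ℝ} (hα : 0 < α) (hα1 : α < 1) (S s : ℝ) :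
    0 ≤ quantileLoss α S s := by
  unfold quantileLoss
  rcases le_total s S with h | h
  · exact le_max_of_le_left (mul_nonneg (by linarith) (by linarith))
  · exact le_max_of_le_right (mul_nonneg (by linarith) (by linarith))

lemma quantileLoss_of_le {α : ℝ} {S s : ℝ} (h : s ≤ S) :
    quantileLoss α S s = (1 - α) * (S - s) := by
  unfold quantileLoss
  exact max_eq_left (by nlinarith)

lemma quantileLoss_of_ge {α : ℝ} {S s : ℝ} (h : S ≤ s) :
    quantileLoss α S s = α * (s - S) := by
  unfold quantileLoss
  exact max_eq_right (by nlinarith)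

lemma quantileLoss_reflect (α S s : ℝ) :
    quantileLoss (1 - α) (1 - S) (1 - s) = quantileLoss α S s := by
  unfold quantileLoss
  rw [max_comm]
  congr 1 <;> ring

/-- The gain of one round: the loss difference, truncated at `0` if the total gain so far is not
positive. -/
noncomputable def truncGain (G x : ℝ) : ℝ := if 0 < G then x else max x 0

/-- A scale-free gradient descent run of one expert with radii `r`, together with predictions `p`
of the aggregating algorithm and the total truncated gains `G` of the expert. -/
structure BettingRun (α : ℝ) (N : ℕ) (S p r d G : ℕ → ℝ) : Prop extends OGDPath α N S r d where
  predict_mem : ∀ n < N, p n ∈ Set.Icc (-rate) (1 + rate)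
  -- If the gain is positive, the prediction averages only experts of positive weight, all of which
  -- have played the last round, and it inherits `OGDPath.low_after_step`. Otherwise a newborn
  -- expert may dominate and nothing better than `predict_mem` is claimed.
  low : ∀ n, n + 1 < N → 0 < G (n + 1) → min (-overshoot α) (S n - rate) ≤ p (n + 1)
  high : ∀ n, n + 1 < N → 0 < G (n + 1) → p (n + 1) ≤ max (1 + overshoot (1 - α)) (S n + rate)
  gain_zero : G 0 = 0
  gain_succ : ∀ n < N, G (n + 1) = G n +
    truncGain (G n) (quantileLoss α (S n) (p n) - quantileLoss α (S n) (r n))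

variable {α : ℝ} {N : ℕ} {S p r d G : ℕ → ℝ}

lemma BettingRun.reflect (h : BettingRun α N S p r d G) :
    BettingRun (1 - α) N (fun n => 1 - S n) (fun n => 1 - p n) (fun n => 1 - r n)
      (fun n => - d n) G := by
  refine ⟨h.toOGDPath.reflect, fun n hn => ?_, fun n hn hG => ?_, fun n hn hG => ?_, h.gain_zero,
    fun n hn => ?_⟩
  · have := h.predict_mem n hn
    constructor <;> linarith [this.1, this.2]
  · have := h.high n hn hG
    rcases le_max_iff.1 this with h1 | h1
    · exact (min_le_left _ _).trans (by linarith)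
    · exact (min_le_right _ _).trans (by linarith)
  · have := h.low n hn hG
    rw [sub_sub_cancel]
    rcases min_le_iff.1 this with h1 | h1
    · exact le_trans (by linarith) (le_max_left _ _)
    · exact le_trans (by linarith) (le_max_right _ _)
  · rw [h.gain_succ n hn, quantileLoss_reflect, quantileLoss_reflect]

lemma overshoot_lt (hα : 0 < α) (hα1 : α < 1) : overshoot α < rate := by
  unfold overshoot
  have hb := rate_pos
  have h1 : α < √(α ^ 2 + (1 - α) ^ 2) := by
    apply Real.lt_sqrt_of_sq_lt
    have : 0 < (1 - α) ^ 2 := by have : 0 < 1 - α := by linarith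
                                 positivity
    linarith
  rw [div_lt_iff₀ (by linarith)]
  exact mul_lt_mul_of_pos_left h1 hb

/-- This makes `lossCap α` large enough for an expert at `-overshoot α` that meets the radius `1`.
-/
lemma one_sub_mul_overshoot_le (hα : 0 < α) (hα1 : α < 1) :
    (1 - α) * overshoot α ≤ rate * α := by
  unfold overshoot
  have hb := rate_pos
  have h1 : 1 - α ≤ √(α ^ 2 + (1 - α) ^ 2) := by
    apply Real.le_sqrt_of_sq_le; nlinarith
  have h2 : 0 < √(α ^ 2 + (1 - α) ^ 2) := by linarith
  rw [← mul_div_assoc, div_le_iff₀ h2, mul_comm]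
  exact mul_le_mul_of_nonneg_left h1 (by positivity)

/-- The credit that a prediction far below `0` has received in the round before. -/
noncomputable def credit (α p : ℝ) : ℝ :=
  rate * (1 - 2 * α) * max 0 ((-p - overshoot α) / (rate - overshoot α))

/-- The bound for the losses of normal rounds. -/
noncomputable def lossCap (α : ℝ) : ℝ := 1 - (1 - rate) * α

section Credit

variable (hα : 0 < α) (hα2 : α ≤ 1 / 2)

include hα hα2

lemma lossCap_ge : 0.78 ≤ lossCap α := by
  unfold lossCap; nlinarith [rate_gt]

lemma lossCap_lt_one : lossCap α < 1 := by
  unfold lossCap; nlinarith [rate_lt]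

lemma credit_nonneg (p : ℝ) : 0 ≤ credit α p := by
  unfold credit
  exact mul_nonneg (mul_nonneg rate_pos.le (by linarith)) (le_max_left _ _)

lemma credit_le {p : ℝ} (hp : -rate ≤ p) : credit α p ≤ rate * (1 - 2 * α) := by
  unfold credit
  have h1 : 0 < rate - overshoot α := by linarith [overshoot_lt hα (by linarith : α < 1)]
  apply mul_le_of_le_one_right (mul_nonneg rate_pos.le (by linarith))
  apply max_le zero_le_one
  rw [div_le_one h1]; linarith

/-- The credit is linear between `-overshoot α` and `-rate`; the lower `p` may be, the smaller the
last radius `S` was, so the credit is paid from the slack `1 - S` of that round. -/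
lemma credit_le_of_low {S p : ℝ} (hS : S ∈ Set.Icc (0 : ℝ) 1)
    (hp : min (-overshoot α) (S - rate) ≤ p) :
    credit α p ≤ rate * (1 - 2 * α) * (1 - S) := by
  unfold credit
  have hc := overshoot_pos hα
  have h1 : 0 < rate - overshoot α := by linarith [overshoot_lt hα (by linarith : α < 1)]
  have h2 := rate_lt
  apply mul_le_mul_of_nonneg_left _ (mul_nonneg rate_pos.le (by linarith))
  apply max_le (by linarith [hS.2])
  rw [div_le_iff₀ h1]
  rcases min_le_iff.1 hp with h | h
  · have : 0 ≤ (1 - S) * (rate - overshoot α) := mul_nonneg (by linarith [hS.2]) h1.le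
    linarith
  · have : 0 ≤ S * (1 - (rate - overshoot α)) := mul_nonneg hS.1 (by linarith)
    linarith

/-- If the prediction is at most the radius, loss minus credit is linear. -/
lemma loss_sub_credit_le_of_le {S p : ℝ} (hp : -rate ≤ p) (hpS : p ≤ S) (hS : 0 ≤ S) :
    quantileLoss α S p - credit α p ≤ (1 - α) * S + rate * α := by
  have hc := overshoot_pos hα
  have hb := rate_pos
  have h1 : 0 < rate - overshoot α := by linarith [overshoot_lt hα (by linarith : α < 1)]
  have h3 := one_sub_mul_overshoot_le hα (by linarith : α < 1)
  rw [quantileLoss_of_le hpS]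
  set t := (-p - overshoot α) / (rate - overshoot α) with ht
  have hpt : -p = overshoot α + t * (rate - overshoot α) := by
    rw [ht, div_mul_cancel₀ _ h1.ne']; ring
  have hc' : rate * (1 - 2 * α) * max 0 t ≤ credit α p := le_rfl
  have ht1 : t ≤ 1 := by rw [ht, div_le_one h1]; linarith
  rcases le_total t 0 with h0 | h0
  · have := credit_nonneg hα hα2 p
    have : (1 - α) * (-p) ≤ (1 - α) * overshoot α := by
      apply mul_le_mul_of_nonneg_left _ (by linarith)
      nlinarith
    nlinarith
  · rw [max_eq_right h0] at hc'
    have e : (1 - α) * (S - p) = (1 - α) * S + (1 - α) * overshoot α * (1 - t)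
        + (1 - α) * rate * t := by
      linear_combination (1 - α) * hpt
    rw [e]
    have : (1 - α) * overshoot α * (1 - t) ≤ rate * α * (1 - t) :=
      mul_le_mul_of_nonneg_right h3 (by linarith)
    nlinarith

lemma loss_le_of_ge {S p : ℝ} (hp : p ≤ 1 + rate) (hpS : S ≤ p) :
    quantileLoss α S p ≤ α * (1 + rate - S) := by
  rw [quantileLoss_of_ge hpS]
  exact mul_le_mul_of_nonneg_left (by linarith) hα.le

/-- One round costs at most `lossCap α`, once the credit is taken into account. -/
lemma loss_add_credit_le {S p p' : ℝ} (hS : S ∈ Set.Icc (0 : ℝ) 1)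
    (hp : p ∈ Set.Icc (-rate) (1 + rate)) (hp' : min (-overshoot α) (S - rate) ≤ p') :
    quantileLoss α S p + credit α p' ≤ lossCap α + credit α p := by
  have h1 := credit_le_of_low hα hα2 hS hp'
  have hb := rate_pos
  have hb1 := rate_lt
  have hS0 := hS.1
  have hS1 := hS.2
  unfold lossCap
  rcases le_total p S with h | h
  · have := loss_sub_credit_le_of_le hα hα2 hp.1 h hS.1
    have e : 0 ≤ (1 - α - rate * (1 - 2 * α)) * (1 - S) := by
      apply mul_nonneg _ (by linarith)
      nlinarith
    nlinarith
  · have := loss_le_of_ge hα hα2 hp.2 h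
    have := credit_nonneg hα hα2 p
    nlinarith [mul_nonneg (mul_nonneg hb.le (by linarith : 0 ≤ 1 - 2 * α)) hS0,
      mul_nonneg hα.le hS0, mul_nonneg (sub_nonneg.2 hb1.le) (by linarith : 0 ≤ 1 - 2 * α)]

end Credit

/-- A truncated negative difference leaves a nonpositive total nonpositive, so truncation is
invisible whenever the new total is positive. -/
lemma BettingRun.gain_eq_of_pos (h : BettingRun α N S p r d G) {n : ℕ} (hn : n < N)
    (hG : 0 < G (n + 1)) :
    G (n + 1) = G n + (quantileLoss α (S n) (p n) - quantileLoss α (S n) (r n)) := by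
  have h1 := h.gain_succ n hn
  rw [h1]
  unfold truncGain at h1 ⊢
  split_ifs with h0
  · rfl
  · rw [if_neg h0] at h1
    rcases le_total (quantileLoss α (S n) (p n) - quantileLoss α (S n) (r n)) 0 with h2 | h2
    · rw [max_eq_right h2] at h1
      linarith
    · rw [max_eq_left h2]

section Half

variable (hα : 0 < α) (hα2 : α ≤ 1 / 2) (h : BettingRun α N S p r d G)

include hα hα2 h

lemma BettingRun.gain_step_le {n : ℕ} (hn : n < N) (hG : 0 < G (n + 1)) :
    G (n + 1) ≤ G n + credit α (p n) + lossCap α - quantileLoss α (S n) (r n) := by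
  rw [h.gain_eq_of_pos hn hG]
  have h1 := loss_add_credit_le hα hα2 (h.radius_mem n hn) (h.predict_mem n hn)
    -- The run says nothing about a prediction in round `N`, and none is needed here: `0` is a dummy
    -- successor.
    (p' := 0) ((min_le_left _ _).trans (by linarith [overshoot_pos hα]))
  have := credit_nonneg hα hα2 0
  linarith

lemma BettingRun.gain_credit_step_le {n : ℕ} (hn : n + 1 < N) (hG : 0 < G (n + 1)) :
    G (n + 1) + credit α (p (n + 1)) ≤
      G n + credit α (p n) + lossCap α - quantileLoss α (S n) (r n) := by
  rw [h.gain_eq_of_pos (by omega) hG]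
  have h1 := loss_add_credit_le hα hα2 (h.radius_mem n (by omega)) (h.predict_mem n (by omega))
    (h.low n hn hG)
  linarith

/-- Gain plus credit grows by at most `lossCap α` per round; when the gain is nonpositive the count
restarts from the maximal credit `rate * (1 - 2 * α)`. -/
lemma BettingRun.gain_credit_le : ∀ n < N,
    G n + credit α (p n) ≤ lossCap α * n + rate * (1 - 2 * α) := by
  intro n
  induction n with
  | zero =>
    intro hn
    rw [h.gain_zero]
    have := credit_le hα hα2 (h.predict_mem 0 hn).1
    simpa using this
  | succ n ih =>
    intro hn
    have hγ := lossCap_ge hα hα2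
    push_cast
    by_cases hG : 0 < G (n + 1)
    · have h1 := h.gain_credit_step_le hα hα2 hn hG
      have h2 := ih (by omega)
      have h3 := quantileLoss_nonneg hα (by linarith) (S n) (r n)
      linarith
    · have := credit_le hα hα2 (h.predict_mem (n + 1) hn).1
      have : 0 ≤ lossCap α * (n + 1) := by positivity
      linarith [not_lt.1 hG]

lemma BettingRun.gain_le : ∀ n ≤ N, G n ≤ lossCap α * n + rate * (1 - 2 * α) := by
  intro n hn
  have hγ := lossCap_ge hα hα2
  have hb : 0 ≤ rate * (1 - 2 * α) := mul_nonneg rate_pos.le (by linarith)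
  have : 0 ≤ lossCap α * n := by positivity
  rcases n with _ | n
  · rw [h.gain_zero]; linarith
  · by_cases hG : 0 < G (n + 1)
    · have h1 := h.gain_step_le hα hα2 (by omega) hG
      have h2 := h.gain_credit_le hα hα2 n (by omega)
      have h3 := quantileLoss_nonneg hα (by linarith) (S n) (r n)
      push_cast
      linarith
    · linarith [not_lt.1 hG]

/-- The betting fraction never exceeds `lossCap α`. -/
lemma BettingRun.fraction_le {n : ℕ} (hn : n ≤ N) : G n / (n + 1) ≤ lossCap α := by
  rw [div_le_iff₀ (by positivity)]
  have := h.gain_le hα hα2 n hn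
  have := lossCap_ge hα hα2
  -- The maximal credit is smaller than one more `lossCap α`, which the denominator `n + 1`
  -- provides.
  nlinarith [rate_lt, rate_pos]

lemma BettingRun.loss_expert_le {n : ℕ} (hn : n < N) :
    quantileLoss α (S n) (r n) ≤ (1 + rate) * (1 - α) := by
  have h1 := h.mem hα (by linarith) n hn.le
  have h2 := h.radius_mem n hn
  have hb := rate_pos
  rcases le_total (r n) (S n) with h0 | h0
  · rw [quantileLoss_of_le h0, mul_comm]
    exact mul_le_mul_of_nonneg_right (by linarith [h1.1, h2.2]) (by linarith)
  · rw [quantileLoss_of_ge h0]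
    nlinarith [h1.2, h2.1]

lemma BettingRun.loss_predict_le {n : ℕ} (hn : n < N) :
    quantileLoss α (S n) (p n) ≤ (1 + rate) * (1 - α) := by
  have h1 := h.predict_mem n hn
  have h2 := h.radius_mem n hn
  have hb := rate_pos
  rcases le_total (p n) (S n) with h0 | h0
  · rw [quantileLoss_of_le h0, mul_comm]
    exact mul_le_mul_of_nonneg_right (by linarith [h1.1, h2.2]) (by linarith)
  · rw [quantileLoss_of_ge h0]
    nlinarith [h1.2, h2.1]

/-- The betting fraction stays away from `1` by the losses of the expert so far. -/
lemma BettingRun.sub_gain_ge : ∀ n < N,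
    1 - rate + 1 / 2 * ∑ k ∈ Finset.range n, quantileLoss α (S k) (r k) ≤
      n + 1 - G n - credit α (p n) := by
  have hb := rate_lt
  have hb0 := rate_pos
  intro n
  induction n with
  | zero =>
    intro hn
    have := credit_le hα hα2 (h.predict_mem 0 hn).1
    rw [h.gain_zero]
    simp
    nlinarith
  | succ n ih =>
    intro hn
    rw [Finset.sum_range_succ]
    push_cast
    by_cases hG : 0 < G (n + 1)
    · have h1 := h.gain_credit_step_le hα hα2 hn hG
      have h2 := ih (by omega)
      have h3 := quantileLoss_nonneg hα (by linarith) (S n) (r n)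
      have := lossCap_lt_one hα hα2
      linarith
    -- With nonpositive gain the right-hand side is about `n + 2`. The losses are at most `1 + rate`
    -- each, and the factor `1 / 2` suffices because `(1 + rate) / 2 < 1`.
    · have h1 := credit_le hα hα2 (h.predict_mem (n + 1) hn).1
      have h2 : ∑ k ∈ Finset.range (n + 1), quantileLoss α (S k) (r k) ≤
          ∑ k ∈ Finset.range (n + 1), (1 + rate) := by
        apply Finset.sum_le_sum
        intro k hk
        have := h.loss_expert_le hα hα2 (n := k) (by have := Finset.mem_range.1 hk; omega)
        nlinarith
      rw [Finset.sum_range_succ] at h2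
      simp only [Finset.sum_const, Finset.card_range, nsmul_eq_mul] at h2
      push_cast at h2
      have : (0 : ℝ) ≤ n := n.cast_nonneg
      nlinarith [not_lt.1 hG]

/-- Only a positive total can decrease, and by no more than one expert loss. -/
lemma BettingRun.neg_le_gain : ∀ n ≤ N, -((1 + rate) * (1 - α)) ≤ G n := by
  intro n
  have hb := rate_pos
  induction n with
  | zero => intro _; rw [h.gain_zero]; nlinarith
  | succ n ih =>
    intro hn
    rw [h.gain_succ n (by omega)]
    unfold truncGain
    split_ifs with h0
    · have h1 := h.loss_expert_le hα hα2 (n := n) (by omega)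
      have h2 := quantileLoss_nonneg hα (by linarith) (S n) (p n)
      linarith
    · linarith [ih (by omega), le_max_right
        (quantileLoss α (S n) (p n) - quantileLoss α (S n) (r n)) 0]

lemma BettingRun.truncGain_le {n : ℕ} (hn : n < N) :
    truncGain (G n) (quantileLoss α (S n) (p n) - quantileLoss α (S n) (r n)) ≤
      (1 + rate) * (1 - α) := by
  have h1 := h.loss_predict_le hα hα2 hn
  have h2 := quantileLoss_nonneg hα (by linarith) (S n) (r n)
  have hb := rate_pos
  unfold truncGain
  split_ifs
  · linarith
  · exact max_le (by linarith) (mul_nonneg (by linarith) (by linarith))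

lemma BettingRun.neg_loss_le_truncGain {n : ℕ} :
    -quantileLoss α (S n) (r n) ≤
      truncGain (G n) (quantileLoss α (S n) (p n) - quantileLoss α (S n) (r n)) := by
  have h2 := quantileLoss_nonneg hα (by linarith) (S n) (p n)
  have h3 := quantileLoss_nonneg hα (by linarith) (S n) (r n)
  unfold truncGain
  split_ifs
  · linarith
  · linarith [le_max_right (quantileLoss α (S n) (p n) - quantileLoss α (S n) (r n)) 0]

end Half

end SAOCP

/-! ### Positivity of the wealth: the first step up of an expert -/

namespace SAOCP

variable {α : ℝ} {N : ℕ} {S p r d G : ℕ → ℝ}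

/-- Sharper than `credit_le_of_low`: no credit at all is needed once `S ≥ rate - overshoot α`. -/
lemma credit_le_tail (hα : 0 < α) (hα2 : α ≤ 1 / 2) {S p : ℝ}
    (hp : min (-overshoot α) (S - rate) ≤ p) :
    credit α p ≤ rate * (1 - 2 * α) *
      max 0 ((rate - S - overshoot α) / (rate - overshoot α)) := by
  unfold credit
  have h1 : 0 < rate - overshoot α := by linarith [overshoot_lt hα (by linarith : α < 1)]
  apply mul_le_mul_of_nonneg_left _ (mul_nonneg rate_pos.le (by linarith))
  rcases min_le_iff.1 hp with h | h
  · exact max_le (le_max_left _ _)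
      ((div_nonpos_of_nonpos_of_nonneg (by linarith) h1.le).trans (le_max_left _ _))
  · apply max_le_max le_rfl
    gcongr
    linarith

/-- A round in which an expert at `r` moves down. -/
lemma loss_add_credit_sub_le (hα : 0 < α) (hα2 : α ≤ 1 / 2) {S p p' r : ℝ}
    (hS : S ∈ Set.Icc (0 : ℝ) 1) (hp : p ∈ Set.Icc (-rate) (1 + rate))
    (hp' : min (-overshoot α) (S - rate) ≤ p') (hr : S ≤ r) :
    (1 - α) * (quantileLoss α S p - credit α p + credit α p' - quantileLoss α S r) ≤
      max rate S := by
  have hb := rate_pos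
  have hb1 := rate_lt
  have hb2 := rate_gt
  have hS0 := hS.1
  have h1 := credit_le_tail hα hα2 hp'
  have hc := overshoot_pos hα
  have hd : 0 < rate - overshoot α := by linarith [overshoot_lt hα (by linarith : α < 1)]
  have hΘ : 0 ≤ rate * (1 - 2 * α) := mul_nonneg hb.le (by linarith)
  have hM := le_max_left rate S
  rw [quantileLoss_of_ge hr]
  set t := (rate - S - overshoot α) / (rate - overshoot α) with ht
  have ht' : t * (rate - overshoot α) = rate - S - overshoot α := div_mul_cancel₀ _ hd.ne'
  have ht1 : t ≤ 1 := by rw [ht, div_le_one hd]; linarith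
  rcases le_total p S with h | h
  · have h2 := loss_sub_credit_le_of_le hα hα2 hp.1 h hS.1
    have h3 : quantileLoss α S p - credit α p + credit α p' - α * (r - S) ≤ max rate S := by
      have : 0 ≤ α * (r - S) := mul_nonneg hα.le (by linarith)
      rcases le_total t 0 with h0 | h0
      · rw [max_eq_left h0] at h1
        have h4 : (1 - α) * S + rate * α ≤ max rate S := by
          have := mul_le_mul_of_nonneg_left (le_max_right rate S) (by linarith : 0 ≤ 1 - α)
          have := mul_le_mul_of_nonneg_right hM hα.le
          linarith
        linarith
      · rw [max_eq_right h0] at h1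
        have e : S = (1 - t) * (rate - overshoot α) := by linarith
        have : (1 - α) * S ≤ (1 - α) * ((1 - t) * rate) := by
          rw [e]
          apply mul_le_mul_of_nonneg_left _ (by linarith)
          exact mul_le_mul_of_nonneg_left (by linarith) (by linarith)
        nlinarith [mul_nonneg hb.le (mul_nonneg hα.le h0)]
    have h5 : 0 ≤ max rate S := hb.le.trans hM
    nlinarith
  · have h2 := loss_le_of_ge hα hα2 hp.2 h
    have h3 := credit_nonneg hα hα2 p
    have h4 : credit α p' ≤ rate * (1 - 2 * α) :=
      h1.trans (mul_le_of_le_one_right hΘ (max_le zero_le_one ht1))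
    have h5 : quantileLoss α S p - credit α p + credit α p' - α * (r - S) ≤
        rate + α * (1 - rate) := by nlinarith
    have h6 := mul_le_mul_of_nonneg_left h5 (by linarith : 0 ≤ 1 - α)
    -- The factor `1 - α` brings `rate + α * (1 - rate)` back below `rate`, because `2 * rate ≥ 1`.
    nlinarith [mul_nonneg hα.le (by linarith : 0 ≤ 2 * rate - 1)]

/-- What a round of an expert at `r` that moves down fails to add to the gain. -/
noncomputable def deficit (r : ℝ) : ℝ := max (1 - r) 0 - max (rate - r) 0

/-- The integral of the deficit over `[r, ∞)`. -/
noncomputable def deficitInt (r : ℝ) : ℝ := (max (1 - r) 0) ^ 2 / 2 - (max (rate - r) 0) ^ 2 / 2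

/-- An expert at `r` that moves down has seen a radius at most `min r 1`, so this is the form in
which `loss_add_credit_sub_le` is summed. -/
lemma max_rate_min_eq (r : ℝ) : max rate (min r 1) = 1 - deficit r := by
  have hb1 := rate_lt
  unfold deficit
  rcases le_total r rate with h1 | h1
  · rw [max_eq_left (by linarith : 0 ≤ 1 - r), max_eq_left (by linarith : 0 ≤ rate - r),
      min_eq_left (by linarith), max_eq_left h1]; ring
  · rw [max_eq_right (by linarith : rate - r ≤ 0)]
    rcases le_total r 1 with h2 | h2
    · rw [max_eq_left (by linarith : 0 ≤ 1 - r), min_eq_left h2, max_eq_right h1]; ring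
    · rw [max_eq_right (by linarith : 1 - r ≤ 0), min_eq_right h2, max_eq_right (by linarith)]
      ring

lemma deficitInt_nonneg (r : ℝ) : 0 ≤ deficitInt r := by
  unfold deficitInt
  have h1 : max (rate - r) 0 ≤ max (1 - r) 0 := max_le_max (by linarith [rate_lt]) le_rfl
  have h2 : 0 ≤ max (rate - r) 0 := le_max_right _ _
  nlinarith

/-- `deficitInt` is convex and coincides with this line for `r ≤ rate`; the constant is `(1 - rate ^
2) / 2`. -/
lemma deficitInt_ge (r : ℝ) : 1 / 3 - (1 - rate) * r ≤ deficitInt r := by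
  have hb := rate_sq
  have hb1 := rate_lt
  unfold deficitInt
  rcases le_total r rate with h1 | h1
  · rw [max_eq_left (by linarith : 0 ≤ 1 - r), max_eq_left (by linarith : 0 ≤ rate - r)]
    nlinarith
  · rw [max_eq_right (by linarith : rate - r ≤ 0)]
    rcases le_total r 1 with h2 | h2
    · rw [max_eq_left (by linarith : 0 ≤ 1 - r)]
      nlinarith [sq_nonneg (r - rate)]
    · rw [max_eq_right (by linarith : 1 - r ≤ 0)]
      nlinarith

lemma deficitInt_le {r : ℝ} (hr : 0 ≤ r) : deficitInt r ≤ (1 + rate) / 2 * deficit r := by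
  have hb := rate_sq
  have hb0 := rate_pos
  have hb1 := rate_lt
  unfold deficitInt deficit
  rcases le_total r rate with h1 | h1
  · rw [max_eq_left (by linarith : 0 ≤ 1 - r), max_eq_left (by linarith : 0 ≤ rate - r)]
    nlinarith
  · rw [max_eq_right (by linarith : rate - r ≤ 0)]
    rcases le_total r 1 with h2 | h2
    · rw [max_eq_left (by linarith : 0 ≤ 1 - r)]
      nlinarith
    · rw [max_eq_right (by linarith : 1 - r ≤ 0)]
      norm_num

/-- The deficit is nonincreasing, so the rectangle at the left endpoint covers the integral. -/
lemma deficitInt_sub_le {r r' : ℝ} (h : r ≤ r') :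
    deficitInt r - deficitInt r' ≤ deficit r * (r' - r) := by
  have hb1 := rate_lt
  unfold deficitInt deficit
  rcases le_total r rate with h1 | h1 <;> rcases le_total r 1 with h2 | h2 <;>
  rcases le_total r' rate with h3 | h3 <;> rcases le_total r' 1 with h4 | h4 <;>
  simp only [max_eq_left, max_eq_right, sub_nonneg, sub_nonpos, h1, h2, h3, h4] <;>
  nlinarith [sq_nonneg (r - rate), sq_nonneg (r' - r), sq_nonneg (r' - rate), sq_nonneg (1 - r'),
    mul_nonneg (sub_nonneg.2 h1) (sub_nonneg.2 h3)]

lemma deficit_nonneg (r : ℝ) : 0 ≤ deficit r := by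
  unfold deficit
  exact sub_nonneg.2 (max_le_max (by linarith [rate_lt]) le_rfl)

/-- A lower bound on the total deficit of an expert that only moves down. -/
lemma sum_deficit_ge {r : ℕ → ℝ} {M : ℕ} (hr : ∀ j ≤ M, 0 ≤ r j)
    (hstep : ∀ j < M, r (j + 1) = r j - rate / √((j : ℝ) + 1)) :
    √3 * (√((M : ℝ) + 1) - 0.684) * deficitInt (r M) ≤
      ∑ j ∈ Finset.range (M + 1), deficit (r j) := by
  have hb0 := rate_pos
  have hb1 := rate_lt
  have h3 : √3 * rate = 1 := by unfold rate; field_simp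
  have h30 : 0 < √3 := by positivity
  have h3' : √3 ≤ 1.733 := by rw [Real.sqrt_le_left (by norm_num)]; norm_num
  induction M with
  | zero =>
    have h1 := deficitInt_le (hr 0 le_rfl)
    have h2 := deficit_nonneg (r 0)
    have h4 := deficitInt_nonneg (r 0)
    simp only [Nat.cast_zero, zero_add, Real.sqrt_one, Finset.range_one, Finset.sum_singleton]
    nlinarith
  | succ M ih =>
    have hi := ih (fun j hj => hr j (by omega)) (fun j hj => hstep j (by omega))
    rw [Finset.sum_range_succ]
    push_cast
    have hs := hstep M (by omega)
    set x := √((M : ℝ) + 1) with hx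
    set y := √((M : ℝ) + 1 + 1) with hy
    have hx1 : 1 ≤ x := by
      rw [hx, Real.one_le_sqrt]; linarith [M.cast_nonneg (α := ℝ)]
    have hx2 : x ^ 2 = M + 1 := Real.sq_sqrt (by positivity)
    have hy2 : y ^ 2 = M + 1 + 1 := Real.sq_sqrt (by positivity)
    have hy0 : 0 ≤ y := Real.sqrt_nonneg _
    have hxy : x * (y - x) ≤ 1 / 2 := by nlinarith [sq_nonneg (y - x)]
    have hyx : x ≤ y := by apply le_of_sq_le_sq _ hy0; linarith
    have h1 := deficitInt_le (hr (M + 1) le_rfl)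
    have h2 := deficit_nonneg (r (M + 1))
    have h4 := deficitInt_nonneg (r (M + 1))
    have hu : 0 < rate / x := by positivity
    have h5 := deficitInt_sub_le (r := r (M + 1)) (r' := r M) (by linarith)
    set F' := deficitInt (r (M + 1))
    set F := deficitInt (r M)
    set f := deficit (r (M + 1))
    have e : r M - r (M + 1) = rate / x := by linarith
    rw [e] at h5
    -- A step has length `rate / x` with `√3 * rate = 1`, so the sum of deficits is about `√3 * x`
    -- times their integral. The shift `0.684` leaves `0.684 / x * f` for the growth of the factor
    -- from `x` to `y`.
    have h6 : √3 * (x - 0.684) * (F' - F) ≤ (1 - 0.684 / x) * f := by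
      have := mul_le_mul_of_nonneg_left h5 (by nlinarith : 0 ≤ √3 * (x - 0.684))
      have e1 : √3 * (x - 0.684) * (f * (rate / x)) = (√3 * rate) * ((x - 0.684) / x * f) := by
        ring
      have e2 : (x - 0.684) / x = 1 - 0.684 / x := by field_simp
      rw [e1, h3, one_mul, e2] at this
      exact this
    -- The origin of the constant: `x * (y - x) ≤ 1 / 2` and `deficitInt_le` leave `(√3 + 1) / 4`,
    -- which is just below `0.684`.
    have h7 : √3 * (y - x) * F' ≤ 0.684 / x * f := by
      rw [div_mul_eq_mul_div, le_div_iff₀ (by linarith)]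
      have e1 : √3 * (y - x) * F' * x = (x * (y - x)) * (√3 * F') := by ring
      rw [e1]
      have h8 : √3 * F' ≤ √3 * ((1 + rate) / 2 * f) := mul_le_mul_of_nonneg_left h1 h30.le
      have h9 : √3 * ((1 + rate) / 2 * f) = (√3 + 1) / 2 * f := by linear_combination f / 2 * h3
      have h10 : 0 ≤ √3 * F' := mul_nonneg h30.le h4
      have h11 : √3 ≤ 1.7321 := by rw [Real.sqrt_le_left (by norm_num)]; norm_num
      nlinarith
    nlinarith

/-- The numerical core of `gain_mul_loss_le_of_first_up`: `z` is the depth below `0` from which the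
first step up starts, `ζ` the height before the last step down, `sf` the total deficit of the
earlier steps. The worst case is `ζ = 0`, where `z = rate / x` and the main term collapses by `(1 +
rate / x) * (x ^ 2 - rate * x) = x ^ 2 - rate ^ 2`. -/
lemma first_up_aux {k z ζ sf : ℝ} (hk : 0 ≤ k) (hz0 : 0 ≤ z) (hζ0 : 0 ≤ ζ)
    (hzζ : z + ζ = rate / √(k + 1 + 1))
    (hsf : √3 * (√(k + 1) - 0.684) * (1 / 3 - (1 - rate) * (ζ + rate / √(k + 1))) ≤ sf) :
    (1 + z) * (rate + (k + 1) + ζ - sf) + (1 + rate) * z ≤ k + 2.9 := by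
  have hb := rate_pos
  have hb1 := rate_lt
  have hb2 := rate_gt
  have hbs := rate_sq
  set y := √(k + 1) with hy
  set x := √(k + 1 + 1) with hx
  have hy1 : 1 ≤ y := by
    rw [hy, Real.one_le_sqrt]; linarith [hk]
  have hx1 : 1.414 ≤ x := by
    apply Real.le_sqrt_of_sq_le; norm_num; linarith [hk]
  have hy2 : y ^ 2 = k + 1 := Real.sq_sqrt (by positivity)
  have hx2 : x ^ 2 = k + 1 + 1 := Real.sq_sqrt (by positivity)
  have h3 : √3 * rate = 1 := by unfold rate; field_simp
  have h30 : 0 < √3 := by positivity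
  have hyx : y ≤ x := by apply le_of_sq_le_sq _ (by linarith); linarith
  set A := √3 * (y - 0.684) with hA
  have hA0 : 0 ≤ A := mul_nonneg h30.le (by linarith)
  have h31 : √3 = 3 * rate := by
    linear_combination 3 * rate * h3 - 3 * √3 * hbs
  set B := x ^ 2 - rate * y + 0.684 * rate - (1 - rate) * 0.684 / y with hB
  have hAB : rate + (k + 1) + ζ - A * (1 / 3 - (1 - rate) * (ζ + rate / y)) =
      B + ζ * (1 + A * (1 - rate)) := by
    rw [hB, hA, hx2, h31]
    field_simp
    linear_combination (1 - rate) * (y * 3 - 2.052) * hbs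
  set w := rate / x with hw
  have hwx : w * x = rate := by rw [hw]; field_simp
  have hw1 : w ≤ 0.4084 := by rw [hw, div_le_iff₀ (by linarith)]; linarith
  have hw0 : 0 < w := by positivity
  have hBup : B ≤ x ^ 2 - rate * x + 0.395 := by
    have h1 : x - y ≤ 1 / (2 * y) := by
      rw [le_div_iff₀ (by linarith)]; nlinarith [sq_nonneg (x - y)]
    have h2 : rate * (x - y) ≤ (1 - rate) * 0.684 / y := by
      calc rate * (x - y) ≤ rate * (1 / (2 * y)) := mul_le_mul_of_nonneg_left h1 hb.le
        _ = rate * (1 / 2) / y := by field_simp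
        _ ≤ (1 - rate) * 0.684 / y :=
            div_le_div_of_nonneg_right (by linarith) (by linarith)
    rw [hB]; linarith
  have hBlow : x ^ 2 - rate * x + 0.1 ≤ B := by
    have : (1 - rate) * 0.684 / y ≤ 0.2892 := by
      rw [div_le_iff₀ (by linarith)]; linarith
    have h4 := mul_le_mul_of_nonneg_left hyx hb.le
    rw [hB]; linarith
  have hA1 : A * (1 - rate) ≤ 0.733 * (x - 0.684) := by
    have h1 : A ≤ 1.7321 * (x - 0.684) := by
      rw [hA, h31]
      exact mul_le_mul (by linarith) (by linarith) (by linarith) (by norm_num)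
    have h2 := mul_le_mul h1 (by linarith : 1 - rate ≤ 0.42265) (by linarith) (by linarith)
    linarith
  -- Shifting the amount `ζ` to `z` gains `B + (1 + rate)` per unit and loses the left-hand side, so
  -- `ζ = 0` is extremal.
  have hdiff : (1 + z) * (1 + A * (1 - rate)) ≤ B + (1 + rate) := by
    have h1 : (1 + z) * (1 + A * (1 - rate)) ≤ 1.4084 * (1 + 0.733 * (x - 0.684)) := by
      apply mul_le_mul (by linarith) (by linarith) _ (by norm_num)
      have : 0 ≤ A * (1 - rate) := mul_nonneg hA0 (by linarith)
      linarith
    have h9 : rate * x ≤ 0.577351 * x := mul_le_mul_of_nonneg_right hb1.le (by linarith)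
    have h10 := sq_nonneg (x - 0.805)
    linarith
  have hz : z = w - ζ := by linarith
  have h4 : (1 + z) * (rate + (k + 1) + ζ - sf) ≤ (1 + z) * (B + ζ * (1 + A * (1 - rate))) := by
    rw [← hAB]
    exact mul_le_mul_of_nonneg_left (by linarith) (by linarith)
  have h5 : (1 + z) * (B + ζ * (1 + A * (1 - rate))) + (1 + rate) * z ≤
      (1 + w) * B + (1 + rate) * w := by
    have := mul_le_mul_of_nonneg_left hdiff hζ0
    have e : w = z + ζ := by linarith
    rw [e]; linarith
  have h6 : (1 + w) * B ≤ (1 + w) * (x ^ 2 - rate * x + 0.395) :=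
    mul_le_mul_of_nonneg_left hBup (by linarith)
  have h7 : (1 + w) * (x ^ 2 - rate * x + 0.395) =
      x ^ 2 - rate ^ 2 + 0.395 + w * 0.395 := by
    have : w * x ^ 2 = rate * x := by rw [← hwx]; ring
    linear_combination this - rate * hwx
  have h8 : (1 + rate) * w ≤ 1.577351 * w := mul_le_mul_of_nonneg_right (by linarith) hw0.le
  linarith

section Half

variable (hα : 0 < α) (hα2 : α ≤ 1 / 2) (h : BettingRun α N S p r d G)

include hα hα2 h

/-- While the expert only moves down, each round adds at most `max rate S` to the scaled gain plus
credit. The scaling by `1 - α` is harmless because the loss of the step up carries this factor. -/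
lemma BettingRun.gain_credit_le_deficit {n : ℕ} (hn : n < N) (hd : ∀ k < n, d k = α) :
    (1 - α) * (G n + credit α (p n)) ≤
      rate + ∑ j ∈ Finset.range n, (1 - deficit (r j)) := by
  have hb := rate_pos
  have hb1 := rate_lt
  have hcr : ∀ n < N, (1 - α) * credit α (p n) ≤ rate := by
    intro n hn
    have := credit_le hα hα2 (h.predict_mem n hn).1
    have := credit_nonneg hα hα2 (p n)
    nlinarith [mul_nonneg hb.le hα.le]
  induction n with
  | zero =>
    have := hcr 0 hn
    rw [h.gain_zero]; simpa using this
  | succ n ih =>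
    have hi := ih (by omega) (fun k hk => hd k (by omega))
    by_cases hG : 0 < G (n + 1)
    · rw [Finset.sum_range_succ, h.gain_eq_of_pos (by omega) hG]
      have hS := h.radius_mem n (by omega)
      have hSr := (h.down_step hα (n := n) (by omega) (hd n (by omega))).1
      have h1 := loss_add_credit_sub_le hα hα2 hS (h.predict_mem n (by omega)) (h.low n hn hG) hSr
      have h2 : max rate (S n) ≤ 1 - deficit (r n) := by
        rw [← max_rate_min_eq]
        exact max_le_max le_rfl (le_min hSr hS.2)
      linarith
    · have h1 := hcr (n + 1) hn
      have h2 : 0 ≤ ∑ j ∈ Finset.range (n + 1), (1 - deficit (r j)) := by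
        apply Finset.sum_nonneg
        intro j _
        rw [← max_rate_min_eq]
        exact hb.le.trans (le_max_left _ _)
      nlinarith [not_lt.1 hG]

/-- The first step up of an expert below `-overshoot α` does not exhaust its wealth. -/
lemma BettingRun.gain_mul_loss_le_of_first_up {n : ℕ} (hn : n < N) (hd : ∀ k < n, d k = α)
    (hG : 0 < G n) (hr : α * (1 - r n) ≤ -r n) :
    G n * ((1 - α) * (1 - r n)) ≤ n + 0.9 := by
  have hb := rate_pos
  have hb1 := rate_lt
  have hb2 := rate_gt
  have hbs := rate_sq
  obtain ⟨m, rfl⟩ : ∃ m, n = m + 1 := by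
    rcases n with _ | m
    · rw [h.gain_zero] at hG; exact absurd hG (lt_irrefl _)
    · exact ⟨m, rfl⟩
  have h0 := h.gain_credit_le_deficit hα hα2 (n := m) (by omega) (fun k hk => hd k (by omega))
  have hS := h.radius_mem m (by omega)
  have hSr := (h.down_step hα (n := m) (by omega) (hd m (by omega))).1
  have hp := h.predict_mem m (by omega)
  have hrm := h.step_of_down hα (n := m) (by omega) (fun k hk => hd k (by omega))
  have hrn : r (m + 1) ≤ 0 := by nlinarith
  -- The last round down has to provide no credit for its successor, so it adds at most `r m` and a
  -- term that `hr` absorbs at the end. The assumption `hr` says that the largest possible loss of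
  -- the step up, `(1 - α) * (1 - r n)`, is at least `1`.
  have hlast : (1 - α) * (quantileLoss α (S m) (p m) - credit α (p m) -
      quantileLoss α (S m) (r m)) ≤ r m + (1 + rate) * α * (1 - α) := by
    have h6 : quantileLoss α (S m) (p m) - credit α (p m) -
      quantileLoss α (S m) (r m) ≤ r m + (1 + rate) * α := by
      rw [quantileLoss_of_ge hSr]
      rcases le_total (p m) (S m) with h1 | h1
      · have := loss_sub_credit_le_of_le hα hα2 hp.1 h1 hS.1
        nlinarith [mul_nonneg hα.le (hS.1.trans hSr)]
      · have := loss_le_of_ge hα hα2 hp.2 h1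
        have := credit_nonneg hα hα2 (p m)
        nlinarith [hS.1]
    have := mul_le_mul_of_nonneg_left h6 (by linarith : 0 ≤ 1 - α)
    nlinarith [mul_nonneg hα.le (hS.1.trans hSr)]
  have hGm : (1 - α) * G (m + 1) ≤ rate + ∑ j ∈ Finset.range m, (1 - deficit (r j)) + r m +
      (1 + rate) * α * (1 - α) := by
    rw [h.gain_eq_of_pos (by omega) hG]
    linarith
  rw [Finset.sum_sub_distrib] at hGm
  simp only [Finset.sum_const, Finset.card_range, nsmul_eq_mul, mul_one] at hGm
  set z := -r (m + 1) with hz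
  have hz0 : 0 ≤ z := by linarith
  have e : 1 - r (m + 1) = 1 + z := by rw [hz]; ring
  rw [e] at hr ⊢
  set ζ := r m with hζ
  have hζ0 : 0 ≤ ζ := hS.1.trans hSr
  have hzζ : z + ζ = rate / √((m : ℝ) + 1) := by rw [hz, hrm]; ring
  set sf := ∑ j ∈ Finset.range m, deficit (r j)
  have hfin : (1 + z) * (rate + m + ζ - sf) + (1 + rate) * z ≤ m + 1.9 := by
    rcases m with _ | k
    · have : sf = 0 := by simp [sf]
      rw [this]
      simp only [Nat.cast_zero, zero_add, Real.sqrt_one, div_one] at hzζ ⊢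
      nlinarith
    · have hsum := sum_deficit_ge (r := r) (M := k)
        (fun j hj => (h.radius_mem j (by omega)).1.trans
          (h.down_step hα (n := j) (by omega) (hd j (by omega))).1)
        (fun j hj => h.step_of_down hα (n := j) (by omega) (fun i hi => hd i (by omega)))
      have hrk := h.step_of_down hα (n := k) (by omega) (fun i hi => hd i (by omega))
      have hF := deficitInt_ge (r k)
      push_cast at hzζ ⊢
      set y := √((k : ℝ) + 1) with hy
      set x := √((k : ℝ) + 1 + 1) with hx
      rw [show r k = ζ + rate / y by linarith] at hF hsum
      have hA0 : 0 ≤ √3 * (y - 0.684) := by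
        have : 1 ≤ y := by
          rw [hy, Real.one_le_sqrt]; linarith [k.cast_nonneg (α := ℝ)]
        exact mul_nonneg (Real.sqrt_nonneg _) (by linarith)
      have := first_up_aux k.cast_nonneg hz0 hζ0 hzζ
        ((mul_le_mul_of_nonneg_left hF hA0).trans hsum)
      linarith
  calc G (m + 1) * ((1 - α) * (1 + z)) = (1 + z) * ((1 - α) * G (m + 1)) := by ring
    _ ≤ (1 + z) * (rate + (m - sf) + ζ + (1 + rate) * α * (1 - α)) :=
        mul_le_mul_of_nonneg_left hGm (by linarith)
    _ ≤ (1 + z) * (rate + m + ζ - sf) + (1 + rate) * z := by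
        have h1 : (1 + rate) * ((1 + z) * α) * (1 - α) ≤ (1 + rate) * z := by
          have : (1 + rate) * ((1 + z) * α) ≤ (1 + rate) * z :=
            mul_le_mul_of_nonneg_left (by linarith) (by linarith)
          have : 0 ≤ (1 + rate) * z := by positivity
          nlinarith
        nlinarith
    _ ≤ ((m + 1 : ℕ) : ℝ) + 0.9 := by push_cast; linarith

/-- Apart from its first step up after some steps down, an expert loses at most `lossCap α`. -/
lemma BettingRun.loss_le_lossCap {n : ℕ} (hn : n < N)
    (hd : ¬ ((∀ k < n, d k = α) ∧ d n = α - 1)) :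
    quantileLoss α (S n) (r n) ≤ lossCap α := by
  have hb := rate_pos
  have hb1 := rate_lt
  have hS := h.radius_mem n hn
  have hr := h.mem hα (by linarith) n hn.le
  unfold lossCap
  rcases h.grad n hn with ⟨h1, h2⟩ | ⟨h1, h2⟩
  · rw [quantileLoss_of_ge h2]
    have : α * (r n - S n) ≤ α * (1 + rate) :=
      mul_le_mul_of_nonneg_left (by linarith [hr.2, hS.1]) hα.le
    linarith
  · rw [quantileLoss_of_le h2]
    have h3 : ∃ k < n, d k = α - 1 := by
      by_contra hne
      push Not at hne
      refine hd ⟨fun k hk => ?_, h1⟩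
      rcases h.grad k (by omega) with ⟨h4, _⟩ | ⟨h4, _⟩
      · exact h4
      · exact absurd h4 (hne k hk)
    have h4 := h.ge_neg_overshoot hα (by linarith) n hn.le h3
    have h5 := one_sub_mul_overshoot_le hα (by linarith : α < 1)
    have : (1 - α) * (S n - r n) ≤ (1 - α) * (1 + overshoot α) :=
      mul_le_mul_of_nonneg_left (by linarith [hS.2]) (by linarith)
    linarith

/-- For a loss of at most `1` the gap `n + 1 - G n ≥ 1 - rate` of `sub_gain_ge` is enough. A larger
loss exceeds `lossCap α`, so it occurs at a first step up. -/
lemma BettingRun.one_add_mul_ge_of_pos {n : ℕ} (hn : n < N) (hG : 0 < G n) :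
    0.1 / (n + 1) ≤ 1 + G n / (n + 1) * (G (n + 1) - G n) := by
  have hb := rate_pos
  have hb1 := rate_lt
  have hn0 : (0 : ℝ) < n + 1 := by positivity
  have hg : -quantileLoss α (S n) (r n) ≤ G (n + 1) - G n := by
    rw [h.gain_succ n hn, add_sub_cancel_left]
    exact h.neg_loss_le_truncGain hα hα2
  set lam := quantileLoss α (S n) (r n) with hlam
  have hlam0 : 0 ≤ lam := quantileLoss_nonneg hα (by linarith) _ _
  suffices hs : G n * lam ≤ n + 0.9 by
    rw [div_mul_eq_mul_div, add_div' _ _ _ hn0.ne', div_le_div_iff_of_pos_right hn0]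
    nlinarith
  by_cases h1 : lam ≤ 1
  · have h2 := h.sub_gain_ge hα hα2 n hn
    have h3 := credit_nonneg hα hα2 (p n)
    have h4 : 0 ≤ ∑ k ∈ Finset.range n, quantileLoss α (S k) (r k) :=
      Finset.sum_nonneg fun k _ => quantileLoss_nonneg hα (by linarith) _ _
    nlinarith
  · have hn1 : 0 < n := by
      rcases n with _ | n
      · rw [h.gain_zero] at hG; exact absurd hG (lt_irrefl _)
      · omega
    have h2 : (∀ k < n, d k = α) ∧ d n = α - 1 := by
      by_contra hne
      have := h.loss_le_lossCap hα hα2 hn hne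
      have := lossCap_lt_one hα hα2
      linarith
    have h3 := (h.up_step (by linarith) hn h2.2).1
    have hS := h.radius_mem n hn
    have h4 : lam ≤ (1 - α) * (1 - r n) := by
      rw [hlam, quantileLoss_of_le h3]
      exact mul_le_mul_of_nonneg_left (by linarith [hS.2]) (by linarith)
    have h5 := h.gain_mul_loss_le_of_first_up hα hα2 hn h2.1 hG (by linarith)
    nlinarith

/-- Round `0` starts with gain `0`, so its difference is truncated and `G 1 ≥ 0`. -/
lemma BettingRun.two_le_of_neg {n : ℕ} (hn : n ≤ N) (hG : G n < 0) : 2 ≤ n := by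
  rcases n with _ | _ | n
  · rw [h.gain_zero] at hG; exact absurd hG (lt_irrefl _)
  · have := h.gain_succ 0 (by omega)
    rw [h.gain_zero] at this
    simp only [truncGain, lt_irrefl, if_false, zero_add] at this hG
    rw [this] at hG
    exact absurd hG (not_lt.2 (le_max_right _ _))
  · omega

/-- Below `0` the next gain is truncated to be nonnegative; it and `|G n|` are at most `1.578`, with
product below `2.489`. As a negative gain needs `n + 1 ≥ 3`, the factor is at least `1 - 2.489 / 3 >
0.17`. -/
lemma BettingRun.one_add_mul_ge_of_neg {n : ℕ} (hn : n < N) (hG : G n ≤ 0) :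
    0.17 ≤ 1 + G n / (n + 1) * (G (n + 1) - G n) ∧
      1 - 4 / (n + 1) ≤ 1 + G n / (n + 1) * (G (n + 1) - G n) := by
  have hb := rate_pos
  have hb1 := rate_lt
  have hn0 : (0 : ℝ) < n + 1 := by positivity
  rcases hG.lt_or_eq with h1 | h1
  · have h2 : (3 : ℝ) ≤ n + 1 := by
      have := h.two_le_of_neg hα hα2 hn.le h1
      have : (2 : ℝ) ≤ n := by exact_mod_cast this
      linarith
    have h3 := h.neg_le_gain hα hα2 n hn.le
    have h4 := h.truncGain_le hα hα2 hn
    have h5 : 0 ≤ truncGain (G n) (quantileLoss α (S n) (p n) - quantileLoss α (S n) (r n)) := by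
      rw [truncGain, if_neg (by linarith)]; exact le_max_right _ _
    rw [h.gain_succ n hn, add_sub_cancel_left]
    set g := truncGain (G n) (quantileLoss α (S n) (p n) - quantileLoss α (S n) (r n))
    have h6 : -(2.489 : ℝ) ≤ G n * g := by
      have hK : (1 + rate) * (1 - α) ≤ 1.577351 := by nlinarith
      nlinarith
    rw [div_mul_eq_mul_div, add_div' _ _ _ hn0.ne']
    constructor
    · rw [le_div_iff₀ hn0]; nlinarith
    · rw [le_div_iff₀ hn0, sub_mul, div_mul_cancel₀ _ hn0.ne']; linarith
  · rw [h1, zero_div, zero_mul, add_zero]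
    refine ⟨by norm_num, ?_⟩
    have : 0 < 4 / ((n : ℝ) + 1) := by positivity
    linarith

/-- All factors of the wealth are positive. -/
lemma BettingRun.one_add_mul_ge {n : ℕ} (hn : n < N) :
    0.1 / (n + 1) ≤ 1 + G n / (n + 1) * (G (n + 1) - G n) := by
  rcases lt_or_ge 0 (G n) with hG | hG
  · exact h.one_add_mul_ge_of_pos hα hα2 hn hG
  · refine le_trans ?_ (h.one_add_mul_ge_of_neg hα hα2 hn hG).1
    rw [div_le_iff₀ (by positivity)]
    have : (0 : ℝ) ≤ n := n.cast_nonneg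
    linarith

end Half

end SAOCP

/-! ### The betting potential and the positivity of its net drift -/

namespace SAOCP

/-- The slope of the chord of `log (1 + m x)` over `[0, K]`. -/
noncomputable def betLog (K m : ℝ) : ℝ := Real.log (1 + K * m) / K

/-- The integral of `betLog K` over `[0, m]`. -/
noncomputable def betPot (K m : ℝ) : ℝ := ((1 + K * m) * Real.log (1 + K * m) - K * m) / K ^ 2

/-- The Legendre dual quantity `m * betLog K m - betPot K m`. -/
noncomputable def betDrift (K m : ℝ) : ℝ := (K * m - Real.log (1 + K * m)) / K ^ 2

/-- The price of a unit of expert loss at betting fraction `m`. -/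
noncomputable def betPen (K γ m : ℝ) : ℝ := -Real.log (1 - γ * m) / γ - betLog K m

variable {K γ m m' : ℝ}

lemma betDrift_eq (hK : 0 < K) : betDrift K m = m * betLog K m - betPot K m := by
  unfold betDrift betLog betPot
  field_simp
  ring

lemma mul_log_one_add_le {s p : ℝ} (hs : -1 < s) (hp0 : 0 ≤ p) (hp1 : p ≤ 1) :
    p * Real.log (1 + s) ≤ Real.log (1 + p * s) := by
  rw [← Real.log_rpow (by linarith)]
  exact Real.log_le_log (Real.rpow_pos_of_pos (by linarith) _)
    (rpow_one_add_le_one_add_mul_self hs.le hp0 hp1)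

lemma betLog_nonneg (hK : 0 < K) (hm : 0 ≤ m) : 0 ≤ betLog K m :=
  div_nonneg (Real.log_nonneg (by nlinarith)) hK.le

lemma betLog_le (hK : 0 < K) (hm : 0 ≤ m) : betLog K m ≤ m := by
  unfold betLog
  rw [div_le_iff₀ hK]
  have := Real.log_le_sub_one_of_pos (show 0 < 1 + K * m by positivity)
  linarith

lemma betLog_mul_le_log (hK : 0 < K) (hm : 0 ≤ m) {x : ℝ} (hx0 : 0 ≤ x) (hxK : x ≤ K) :
    x * betLog K m ≤ Real.log (1 + m * x) := by
  have := mul_log_one_add_le (s := K * m) (p := x / K) (by nlinarith) (by positivity)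
    ((div_le_one hK).2 hxK)
  have e : x / K * (K * m) = m * x := by field_simp
  rw [e] at this
  unfold betLog
  rw [mul_div_assoc', ← div_mul_eq_mul_div]
  exact this

lemma betPen_nonneg (hK : 0 < K) (hγ : 0 < γ) (hm : 0 ≤ m) (hm1 : γ * m < 1) :
    0 ≤ betPen K γ m := by
  unfold betPen
  have h1 := betLog_le hK hm
  have h2 : m ≤ -Real.log (1 - γ * m) / γ := by
    rw [le_div_iff₀ hγ]
    have := Real.log_le_sub_one_of_pos (show 0 < 1 - γ * m by linarith)
    linarith
  linarith

/-- The lower bound for the log-wealth of a round in which the expert loses at most `γ`. -/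
lemma betLog_sub_betPen_le_log (hK : 0 < K) (hγ : 0 < γ) (hm : 0 ≤ m) (hm1 : γ * m < 1)
    {x lam : ℝ} (hx : x ≤ K) (hlx : -lam ≤ x) (hl0 : 0 ≤ lam) (hl : lam ≤ γ) :
    x * betLog K m - lam * betPen K γ m ≤ Real.log (1 + m * x) := by
  have hp := betPen_nonneg hK hγ hm hm1
  rcases le_total 0 x with h | h
  · have := betLog_mul_le_log hK hm h hx
    have := mul_nonneg hl0 hp
    linarith
  -- For negative gains, the chord of the logarithm over `[-γ, 0]`; its slope is `betLog K m +
  -- betPen K γ m`.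
  · have h1 := mul_log_one_add_le (s := -(γ * m)) (p := -x / γ) (by linarith)
      (div_nonneg (by linarith) hγ.le) ((div_le_one hγ).2 (by linarith))
    have e : -x / γ * (-(γ * m)) = m * x := by field_simp
    rw [e, ← sub_eq_add_neg] at h1
    have e2 : -x / γ * Real.log (1 - γ * m) = x * (betPen K γ m + betLog K m) := by
      unfold betPen; ring
    rw [e2] at h1
    have := mul_le_mul_of_nonneg_right (show -x ≤ lam by linarith) hp
    linarith

/-- A Taylor bound: the derivative of `betPot K` is `betLog K`, whose derivative `1 / (1 + K * m)`
is at most `1`. -/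
lemma betPot_le (hK : 0 < K) (hm : 0 ≤ m) (hm' : 0 ≤ m') :
    betPot K m' ≤ betPot K m + (m' - m) * betLog K m + (m' - m) ^ 2 := by
  have hu : 1 ≤ 1 + K * m := by nlinarith
  have hu' : 1 ≤ 1 + K * m' := by nlinarith
  set u := 1 + K * m with hue
  set u' := 1 + K * m' with hue'
  have h1 : Real.log u' ≤ Real.log u + (u' - u) / u := by
    have := Real.log_le_sub_one_of_pos (show 0 < u' / u by positivity)
    rw [Real.log_div (by linarith) (by linarith)] at this
    have e : (u' - u) / u = u' / u - 1 := by field_simp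
    linarith
  have h2 : u' * ((u' - u) / u) ≤ (u' - u) + (u' - u) ^ 2 := by
    have e : u' * ((u' - u) / u) = (u' - u) + (u' - u) ^ 2 / u := by field_simp; ring
    rw [e]
    have := div_le_self (sq_nonneg (u' - u)) hu
    linarith
  have h3 := mul_le_mul_of_nonneg_left h1 (show 0 ≤ u' by linarith)
  have e1 : m = (u - 1) / K := by rw [hue]; field_simp; ring
  have e1' : m' = (u' - 1) / K := by rw [hue']; field_simp; ring
  have e2 : betPot K m + (m' - m) * betLog K m + (m' - m) ^ 2 =
      (u' * Real.log u - (u - 1) + (u' - u) ^ 2) / K ^ 2 := by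
    unfold betPot betLog
    rw [← hue, e1', e1]
    field_simp
    ring
  rw [e2]
  unfold betPot
  rw [← hue']
  apply div_le_div_of_nonneg_right _ (by positivity)
  have : K * m' = u' - 1 := by rw [hue']; ring
  rw [this]
  linarith

/-- With `s = √(1 + K * m)`, bounding `log s` by rational functions leaves `(s - 1) ^ 2` below both
`K ^ 2 * betDrift` and `K ^ 2 * betPot`. The `7` bounds `(s + 1) ^ 2`. -/
lemma sqrt_one_add_sub_one_sq_ge (hK : 0 < K) (hm : 0 ≤ m) (hKm : K * m ≤ 1.6) :
    K ^ 2 * m ^ 2 / 7 ≤ (√(1 + K * m) - 1) ^ 2 := by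
  set s := √(1 + K * m) with hs
  have hs2 : s ^ 2 = 1 + K * m := Real.sq_sqrt (by positivity)
  have hs0 : 0 ≤ s := Real.sqrt_nonneg _
  have hs1 : s ≤ 1.63 := by nlinarith
  have e : K ^ 2 * m ^ 2 = (s - 1) ^ 2 * (s + 1) ^ 2 := by
    have : K * m = s ^ 2 - 1 := by linarith
    rw [← mul_pow, this]; ring
  rw [e, div_le_iff₀ (by norm_num)]
  apply mul_le_mul_of_nonneg_left _ (sq_nonneg _)
  nlinarith

lemma betDrift_ge (hK : 0 < K) (hm : 0 ≤ m) (hKm : K * m ≤ 1.6) : m ^ 2 / 7 ≤ betDrift K m := by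
  have h := sqrt_one_add_sub_one_sq_ge hK hm hKm
  unfold betDrift
  rw [le_div_iff₀ (by positivity)]
  have hs2 : √(1 + K * m) ^ 2 = 1 + K * m := Real.sq_sqrt (by positivity)
  have hpos : 0 < √(1 + K * m) := Real.sqrt_pos.2 (by positivity)
  set s := √(1 + K * m) with hs
  have h1 : Real.log (1 + K * m) ≤ 2 * (s - 1) := by
    rw [← hs2, Real.log_pow]
    have := Real.log_le_sub_one_of_pos hpos
    push_cast; linarith
  nlinarith

lemma betPot_ge (hK : 0 < K) (hm : 0 ≤ m) (hKm : K * m ≤ 1.6) : m ^ 2 / 7 ≤ betPot K m := by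
  have h := sqrt_one_add_sub_one_sq_ge hK hm hKm
  unfold betPot
  rw [le_div_iff₀ (by positivity)]
  have hs2 : √(1 + K * m) ^ 2 = 1 + K * m := Real.sq_sqrt (by positivity)
  have hpos : 0 < √(1 + K * m) := Real.sqrt_pos.2 (by positivity)
  set s := √(1 + K * m) with hs
  have h1 : 2 * (s ^ 2 - s) ≤ (1 + K * m) * Real.log (1 + K * m) := by
    rw [← hs2, Real.log_pow]
    have := Real.one_sub_inv_le_log_of_pos hpos
    have h2 : s * (1 - s⁻¹) ≤ s * Real.log s := mul_le_mul_of_nonneg_left this hpos.le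
    rw [mul_sub, mul_inv_cancel₀ hpos.ne'] at h2
    push_cast
    nlinarith
  nlinarith

/-- The derivative of `betPen` is `1 / (1 - γ * m) - 1 / (1 + K * m) = (γ + K) * m / ((1 - γ * m) *
(1 + K * m))`. The factor `m` makes the price quadratic near `0`. -/
lemma betPen_sub_le (hK : 0 < K) (hγ : 0 < γ) (hm : 0 ≤ m) (hmm : m ≤ m') {δ : ℝ} (hδ : 0 < δ)
    (hm1 : δ ≤ 1 - γ * m') :
    betPen K γ m' - betPen K γ m ≤ (γ + K) / δ * (m' * (m' - m)) := by
  have hm' : 0 ≤ m' := hm.trans hmm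
  have h0 : 0 < 1 - γ * m' := by linarith
  have h0' : 0 < 1 - γ * m := by nlinarith
  have hu : 0 < 1 + K * m := by positivity
  have hu' : 0 < 1 + K * m' := by positivity
  have h1 : (-Real.log (1 - γ * m') + Real.log (1 - γ * m)) / γ ≤ (m' - m) / (1 - γ * m') := by
    have := Real.log_le_sub_one_of_pos (div_pos h0' h0)
    rw [Real.log_div h0'.ne' h0.ne', div_sub_one h0.ne'] at this
    rw [div_le_iff₀ hγ, div_mul_eq_mul_div]
    calc _ = Real.log (1 - γ * m) - Real.log (1 - γ * m') := by ring
      _ ≤ _ := this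
      _ = _ := by congr 1; ring
  have h2 : (m' - m) / (1 + K * m') ≤ betLog K m' - betLog K m := by
    have := Real.log_le_sub_one_of_pos (div_pos hu hu')
    rw [Real.log_div hu.ne' hu'.ne', div_sub_one hu'.ne'] at this
    unfold betLog
    rw [← sub_div, le_div_iff₀ hK, div_mul_eq_mul_div]
    have e : (m' - m) * K / (1 + K * m') = - ((1 + K * m - (1 + K * m')) / (1 + K * m')) := by
      rw [← neg_div]; congr 1; ring
    rw [e]; linarith
  have h3 : (m' - m) / (1 - γ * m') - (m' - m) / (1 + K * m') =
      (γ + K) * (m' * (m' - m)) / ((1 - γ * m') * (1 + K * m')) := by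
    rw [div_sub_div _ _ h0.ne' hu'.ne']
    congr 1
    ring
  have h4 : (γ + K) * (m' * (m' - m)) / ((1 - γ * m') * (1 + K * m')) ≤
      (γ + K) / δ * (m' * (m' - m)) := by
    rw [div_mul_eq_mul_div]
    apply div_le_div_of_nonneg_left _ hδ _
    · have : 0 ≤ m' - m := by linarith
      positivity
    · nlinarith [mul_nonneg hK.le hm']
  have e : betPen K γ m' - betPen K γ m = (-Real.log (1 - γ * m') + Real.log (1 - γ * m)) / γ -
      (betLog K m' - betLog K m) := by unfold betPen; ring
  rw [e]
  linarith

lemma betPen_mono (hK : 0 < K) (hγ : 0 < γ) (hm : 0 ≤ m) (hmm : m ≤ m') (hm1 : γ * m' < 1) :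
    betPen K γ m ≤ betPen K γ m' := by
  have hm' : 0 ≤ m' := hm.trans hmm
  have h0 : 0 < 1 - γ * m' := by linarith
  have h0' : 0 < 1 - γ * m := by nlinarith
  have hu : 0 < 1 + K * m := by positivity
  have hu' : 0 < 1 + K * m' := by positivity
  have h1 : m' - m ≤ (-Real.log (1 - γ * m') + Real.log (1 - γ * m)) / γ := by
    have := Real.log_le_sub_one_of_pos (div_pos h0 h0')
    rw [Real.log_div h0.ne' h0'.ne', div_sub_one h0'.ne'] at this
    rw [le_div_iff₀ hγ]
    have h2 : (1 - γ * m' - (1 - γ * m)) / (1 - γ * m) ≤ 1 - γ * m' - (1 - γ * m) := by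
      rw [div_le_iff₀ h0']
      nlinarith [mul_nonneg hγ.le hm, mul_nonneg hγ.le (sub_nonneg.2 hmm),
        mul_nonneg (mul_nonneg hγ.le hm) (mul_nonneg hγ.le (sub_nonneg.2 hmm))]
    linarith
  have h2 : betLog K m' - betLog K m ≤ m' - m := by
    have := Real.log_le_sub_one_of_pos (div_pos hu' hu)
    rw [Real.log_div hu'.ne' hu.ne', div_sub_one hu.ne'] at this
    unfold betLog
    rw [← sub_div, div_le_iff₀ hK]
    have h2 : (1 + K * m' - (1 + K * m)) / (1 + K * m) ≤ 1 + K * m' - (1 + K * m) :=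
      div_le_self (by nlinarith) (by nlinarith)
    linarith
  have e : betPen K γ m' - betPen K γ m = (-Real.log (1 - γ * m') + Real.log (1 - γ * m)) / γ -
      (betLog K m' - betLog K m) := by unfold betPen; ring
  linarith

lemma betPen_zero : betPen K γ 0 = 0 := by simp [betPen, betLog]

lemma abs_betPen_sub_le (hK : 0 < K) (hγ : 0 < γ) (hm : 0 ≤ m) (hm' : 0 ≤ m') {δ : ℝ}
    (hδ : 0 < δ) (h1 : δ ≤ 1 - γ * m) (h2 : δ ≤ 1 - γ * m') :
    |betPen K γ m' - betPen K γ m| ≤ (γ + K) / δ * (max m m' * |m' - m|) := by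
  rcases le_total m m' with h | h
  · rw [max_eq_right h, abs_of_nonneg (sub_nonneg.2 (betPen_mono hK hγ hm h (by linarith))),
      abs_of_nonneg (sub_nonneg.2 h)]
    exact betPen_sub_le hK hγ hm h hδ h2
  · rw [max_eq_left h, abs_sub_comm, abs_sub_comm m',
      abs_of_nonneg (sub_nonneg.2 (betPen_mono hK hγ hm' h (by linarith))),
      abs_of_nonneg (sub_nonneg.2 h)]
    exact betPen_sub_le hK hγ hm' h hδ h1

lemma betPen_le (hK : 0 < K) (hγ : 0 < γ) (hm : 0 ≤ m) {δ : ℝ}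
    (hδ : 0 < δ) (h1 : δ ≤ 1 - γ * m) : betPen K γ m ≤ (γ + K) / δ * m ^ 2 := by
  have := betPen_sub_le hK hγ le_rfl hm hδ h1
  rw [betPen_zero] at this
  simpa [sq] using this

/-- `-log (1 - z) - z` grows faster than `z²`. -/
lemma neg_log_one_sub_sub_le {z z₀ : ℝ} (hz : 0 ≤ z) (hzz : z ≤ z₀) (hz0 : 0 < z₀) (hz1 : z₀ < 1) :
    -Real.log (1 - z) - z ≤ (z / z₀) ^ 2 * (-Real.log (1 - z₀) - z₀) := by
  -- After division by `x ^ 2` all terms of the power series of `-log (1 - x) - x` are nondecreasing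
  -- in `x`, so the series can be compared term by term.
  have key : ∀ x : ℝ, 0 ≤ x → x < 1 →
      HasSum (fun n : ℕ => x ^ (n + 2) / ((n : ℝ) + 2)) (-Real.log (1 - x) - x) := by
    intro x hx hx1
    have := Real.hasSum_pow_div_log_of_abs_lt_one (x := x) (by rw [abs_of_nonneg hx]; exact hx1)
    rw [← hasSum_nat_add_iff' 1] at this
    simp only [Finset.range_one, Finset.sum_singleton, zero_add, pow_one, Nat.cast_zero,
      div_one] at this
    have e : (fun n : ℕ => x ^ (n + 2) / ((n : ℝ) + 2)) =
        fun n : ℕ => x ^ (n + 1 + 1) / (((n + 1 : ℕ) : ℝ) + 1) := by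
      funext n
      congr 1
      push_cast; ring
    rw [e]
    exact this
  refine hasSum_le (fun n => ?_) (key z hz (by linarith)) ((key z₀ hz0.le hz1).mul_left _)
  rw [← mul_div_assoc]
  apply div_le_div_of_nonneg_right _ (by positivity)
  rw [div_pow, pow_add, pow_add z₀]
  have : z ^ n ≤ z₀ ^ n := by gcongr
  have e : z ^ 2 / z₀ ^ 2 * (z₀ ^ n * z₀ ^ 2) = z₀ ^ n * z ^ 2 := by field_simp
  rw [e]
  gcongr

/-- A rational substitute for `-log y`, sharp at `y = exp (-l)`; the parameter `l` is adapted to the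
range of `y`. -/
lemma neg_log_le (l : ℝ) {y Y : ℝ} (hy : 0 < y) (hY : Real.exp (-l) ≤ Y) :
    -Real.log y ≤ l - 1 + Y / y := by
  have h := Real.log_le_sub_one_of_pos (show 0 < Real.exp (-l) / y by positivity)
  rw [Real.log_div (Real.exp_pos _).ne' hy.ne', Real.log_exp] at h
  have : Real.exp (-l) / y ≤ Y / y := by gcongr
  linarith

lemma exp_neg_le {l Y : ℝ} (hl : 0 ≤ l) (hY : 0 < Y) (n : ℕ)
    (h : 1 / Y ≤ ∑ i ∈ Finset.range n, l ^ i / (i.factorial : ℝ)) : Real.exp (-l) ≤ Y := by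
  rw [Real.exp_neg, inv_le_comm₀ (Real.exp_pos _) hY, ← one_div]
  exact h.trans (Real.sum_le_exp_of_nonneg hl n)

/-- What remains of `critical_inequality` after `neg_log_le` and clearing denominators: a polynomial
of degree `6` in `α`. On each of three ranges of `α` a fixed `l` is good enough. -/
lemma critical_polynomial {α : ℝ} (hα : 0 < α) (hα2 : α ≤ 1 / 2) :
    ∃ l Y : ℝ, Real.exp (-l) ≤ Y ∧
      0 ≤ 0.997 * (1 - 0.4226 * α) ^ 4 * (0.4226 * (2 - 0.4226 * α)) +
        2 * ((1 - α) * (2.5774 - 2 * α)) * ((1 - 0.4226 * α) ^ 2 + 1 - l) *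
          (0.4226 * α * (2 - 0.4226 * α)) - 2 * ((1 - α) * (2.5774 - 2 * α)) * Y := by
  rcases le_total α (1 / 5) with h1 | h1
  · refine ⟨1.9, 0.14957, exp_neg_le (by norm_num) (by norm_num) 12
      (by norm_num [Finset.sum_range_succ, Nat.factorial]), ?_⟩
    have hb : 0 ≤ 1 / 5 - α := by linarith
    have t : ∀ i j : ℕ, 0 ≤ α ^ i * (1 / 5 - α) ^ j := fun i j => by positivity
    -- A certificate in the Bernstein basis of the range: the polynomial is a nonnegative
    -- combination of these products.
    linarith [t 0 6, t 1 5, t 2 4, t 3 3, t 4 2, t 5 1, t 6 0]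
  rcases le_total α (27 / 100) with h2 | h2
  · refine ⟨1.65, 0.19205, exp_neg_le (by norm_num) (by norm_num) 12
      (by norm_num [Finset.sum_range_succ, Nat.factorial]), ?_⟩
    have ha : 0 ≤ α - 1 / 5 := by linarith
    have hb : 0 ≤ 27 / 100 - α := by linarith
    have t : ∀ i j : ℕ, 0 ≤ (α - 1 / 5) ^ i * (27 / 100 - α) ^ j := fun i j => by positivity
    linarith [t 0 6, t 1 5, t 2 4, t 3 3, t 4 2, t 5 1, t 6 0]
  · refine ⟨1.4, 0.2466, exp_neg_le (by norm_num) (by norm_num) 12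
      (by norm_num [Finset.sum_range_succ, Nat.factorial]), ?_⟩
    have ha : 0 ≤ α - 27 / 100 := by linarith
    have hb : 0 ≤ 1 / 2 - α := by linarith
    have t : ∀ i j : ℕ, 0 ≤ (α - 27 / 100) ^ i * (1 / 2 - α) ^ j := fun i j => by positivity
    linarith [t 0 6, t 1 5, t 2 4, t 3 3, t 4 2, t 5 1, t 6 0]

/-- The extreme case of `netDrift_ge`, where the betting fraction reaches the cap. Here `0.4226` is
a lower bound for `1 - rate` and `2.5774` an upper bound for `2 + rate`, so `1 - 0.4226 * α`
dominates `lossCap α`, and `2.5774 - 2 * α` dominates the sum of cap and largest gain. -/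
lemma critical_inequality {α : ℝ} (hα : 0 < α) (hα2 : α ≤ 1 / 2) :
    α * (1 - α) * (2.5774 - 2 * α) *
      (-Real.log (1 - (1 - 0.4226 * α) ^ 2) - (1 - 0.4226 * α) ^ 2) ≤
      0.997 / 2 * ((1 - 0.4226 * α) ^ 2) ^ 2 := by
  obtain ⟨l, Y, hY, hP⟩ := critical_polynomial hα hα2
  have hy' : 0 < 0.4226 * (2 - 0.4226 * α) := by nlinarith
  have ey : 1 - (1 - 0.4226 * α) ^ 2 = α * (0.4226 * (2 - 0.4226 * α)) := by ring
  have hy : 0 < 1 - (1 - 0.4226 * α) ^ 2 := by rw [ey]; positivity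
  have h1 := neg_log_le l hy hY
  have hA : 0 < (1 - α) * (2.5774 - 2 * α) := mul_pos (by linarith) (by linarith)
  have h2 : α * (1 - α) * (2.5774 - 2 * α) *
      (-Real.log (1 - (1 - 0.4226 * α) ^ 2) - (1 - 0.4226 * α) ^ 2) ≤
      α * ((1 - α) * (2.5774 - 2 * α)) *
        (l - 1 + Y / (1 - (1 - 0.4226 * α) ^ 2) - (1 - 0.4226 * α) ^ 2) := by
    rw [mul_assoc α]
    exact mul_le_mul_of_nonneg_left (by linarith) (by positivity)
  refine h2.trans ?_
  rw [ey]
  set y' := 0.4226 * (2 - 0.4226 * α) with hy'e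
  have e : α * ((1 - α) * (2.5774 - 2 * α)) *
        (l - 1 + Y / (α * y') - (1 - 0.4226 * α) ^ 2) =
      ((1 - α) * (2.5774 - 2 * α)) * (Y - ((1 - 0.4226 * α) ^ 2 + 1 - l) * (α * y')) / y' := by
    field_simp
    ring
  rw [e, div_le_iff₀ hy']
  have e2 : 0.4226 * α * (2 - 0.4226 * α) = α * y' := by rw [hy'e]; ring
  rw [e2] at hP
  linarith

/-- The function whose positivity drives the regret analysis. -/
noncomputable def netDrift (α m : ℝ) : ℝ :=
  betDrift ((1 + rate) * (1 - α)) m - α * (1 - α) * betPen ((1 + rate) * (1 - α)) (lossCap α) m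

/-- A comparison function for `netDrift`, without the factor `1 / (1 + K t)` in the derivative. -/
noncomputable def driftAux (γ A t : ℝ) : ℝ :=
  t ^ 2 / 2 - A * (-Real.log (1 - γ * t) - γ * t) / γ ^ 2

lemma hasDerivAt_log_one_sub {γ t : ℝ} (h : 0 < 1 - γ * t) :
    HasDerivAt (fun t => Real.log (1 - γ * t)) (-γ / (1 - γ * t)) t := by
  have := (((hasDerivAt_id t).const_mul γ).const_sub 1).log (by simpa using h.ne')
  simpa using this

lemma hasDerivAt_driftAux {γ A t : ℝ} (hγ : 0 < γ) (h : 0 < 1 - γ * t) :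
    HasDerivAt (driftAux γ A) (t * (1 - A / (1 - γ * t))) t := by
  have hγt : HasDerivAt (fun t => γ * t) γ t := by
    simpa using (hasDerivAt_id t).const_mul γ
  have hsq : HasDerivAt (fun t : ℝ => t ^ 2) (2 * t) t := by
    simpa using hasDerivAt_pow 2 t
  have hmain := (hsq.div_const 2).sub
    ((((hasDerivAt_log_one_sub h).neg.sub hγt).const_mul A).div_const (γ ^ 2))
  refine hmain.congr_deriv ?_
  have h5 : A * (-(-γ / (1 - γ * t)) - γ) / γ ^ 2 = A * (t / (1 - γ * t)) := by
    rw [mul_div_assoc, neg_div (1 - γ * t) γ, neg_neg]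
    congr 1
    rw [div_eq_div_iff (by positivity) h.ne', sub_mul, div_mul_cancel₀ _ h.ne']
    ring
  rw [h5]
  ring

/-- Drift and price share the factor `1 / (1 + K * t)`; the remaining bracket changes its sign only
once, at `γ * t = 1 - a * (γ + K)`. -/
lemma hasDerivAt_betDrift_sub {K γ t : ℝ} (a : ℝ) (hK : 0 < K) (hγ : 0 < γ) (h : 0 < 1 - γ * t)
    (ht : 0 ≤ t) : HasDerivAt (fun t => betDrift K t - a * betPen K γ t)
      (1 / (1 + K * t) * (t * (1 - a * (γ + K) / (1 - γ * t)))) t := by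
  have h2 : 0 < 1 + K * t := by positivity
  have hl2 : HasDerivAt (fun t => Real.log (1 + K * t)) (K / (1 + K * t)) t := by
    have := (((hasDerivAt_id t).const_mul K).const_add 1).log (by simpa using h2.ne')
    simpa using this
  have hKt : HasDerivAt (fun t => K * t) K t := by
    simpa using (hasDerivAt_id t).const_mul K
  have hmain := ((hKt.sub hl2).div_const (K ^ 2)).sub
    ((((hasDerivAt_log_one_sub h).neg.div_const γ).sub (hl2.div_const K)).const_mul a)
  refine hmain.congr_deriv ?_
  have h3 : (K - K / (1 + K * t)) / K ^ 2 = t / (1 + K * t) := by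
    rw [div_eq_div_iff (by positivity) h2.ne', sub_mul, div_mul_cancel₀ _ h2.ne']
    ring
  have h4 : -(-γ / (1 - γ * t)) / γ - K / (1 + K * t) / K =
      (γ + K) * t / ((1 - γ * t) * (1 + K * t)) := by
    have e1 : -(-γ / (1 - γ * t)) / γ = 1 / (1 - γ * t) := by
      rw [neg_div (1 - γ * t) γ, neg_neg, div_right_comm, div_self hγ.ne']
    have e2 : K / (1 + K * t) / K = 1 / (1 + K * t) := by
      rw [div_right_comm, div_self hK.ne']
    rw [e1, e2, div_sub_div _ _ h.ne' h2.ne']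
    congr 1
    ring
  rw [h3, h4, mul_div_mul_comm]
  ring

/-- The part of the derivative of `netDrift` that changes its sign dominates. -/
lemma driftAux_le_betDrift_sub {K γ a T m : ℝ} (hK : 0 < K) (hγ : 0 < γ) (hγ1 : γ < 1)
    (hT0 : 0 < T) (hγT : γ * T = 1 - a * (γ + K)) (hm : 0 ≤ m) (hmγ : m ≤ γ) :
    1 / (1 + K * T) * driftAux γ (a * (γ + K)) m ≤ betDrift K m - a * betPen K γ m := by
  set c := 1 / (1 + K * T) with hc
  clear_value c
  have hpos : ∀ t ∈ Set.Icc 0 γ, 0 < 1 - γ * t := fun t ht => by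
    have := mul_le_mul hγ1.le (ht.2.trans hγ1.le) ht.1 zero_le_one
    have := mul_lt_mul'' hγ1 (ht.2.trans_lt hγ1) hγ.le ht.1
    linarith
  have hder : ∀ t ∈ Set.Icc 0 γ, HasDerivAt
      (fun t => betDrift K t - a * betPen K γ t - c * driftAux γ (a * (γ + K)) t)
      ((1 / (1 + K * t) - c) * (t * (1 - a * (γ + K) / (1 - γ * t)))) t := by
    intro t ht
    refine ((hasDerivAt_betDrift_sub a hK hγ (hpos t ht) ht.1).sub
      ((hasDerivAt_driftAux hγ (hpos t ht)).const_mul c)).congr_deriv ?_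
    ring
  -- Freezing the factor `1 / (1 + K * t)` at the sign change `T` only lowers the integral: the
  -- error factor and the bracket change sign together at `T`, so the difference has a nonnegative
  -- derivative.
  have hmono : MonotoneOn
      (fun t => betDrift K t - a * betPen K γ t - c * driftAux γ (a * (γ + K)) t)
      (Set.Icc 0 γ) := by
    apply monotoneOn_of_deriv_nonneg (convex_Icc 0 γ)
    · exact fun t ht => (hder t ht).continuousAt.continuousWithinAt
    · intro t ht
      rw [interior_Icc] at ht
      exact (hder t ⟨ht.1.le, ht.2.le⟩).differentiableAt.differentiableWithinAt
    · intro t ht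
      rw [interior_Icc] at ht
      have ht' : t ∈ Set.Icc 0 γ := ⟨ht.1.le, ht.2.le⟩
      rw [(hder t ht').deriv]
      have h1 := hpos t ht'
      have ht0 := ht.1
      have h2 : 0 < 1 + K * t := by positivity
      have h3 : 0 < 1 + K * T := by positivity
      have e1 : 1 / (1 + K * t) - c = K * (T - t) / ((1 + K * t) * (1 + K * T)) := by
        rw [hc, div_sub_div _ _ h2.ne' h3.ne']
        congr 1
        ring
      have e2 : 1 - a * (γ + K) / (1 - γ * t) = γ * (T - t) / (1 - γ * t) := by
        rw [one_sub_div h1.ne']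
        congr 1
        linear_combination -hγT
      have e : (1 / (1 + K * t) - c) * (t * (1 - a * (γ + K) / (1 - γ * t))) =
          K * γ * t * (T - t) ^ 2 / ((1 + K * t) * (1 + K * T) * (1 - γ * t)) := by
        rw [e1, e2, ← mul_div_assoc, div_mul_div_comm]
        congr 1
        ring
      rw [e]
      positivity
  have h0 := hmono ⟨le_rfl, hγ.le⟩ ⟨hm, hmγ⟩ hm
  have e0 : betDrift K 0 - a * betPen K γ 0 - c * driftAux γ (a * (γ + K)) 0 = 0 := by
    simp [betDrift, betPen_zero, driftAux]
  simp only at h0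
  rw [e0] at h0
  linarith

/-- Up to the positive factor `1 / (1 + K * T)`, `driftAux` is a lower bound. Its negative part
divided by `m ^ 2` is largest at the largest `m`, so everything reduces to `critical_inequality`.
The quadratic surplus later absorbs the error from the varying weights. -/
lemma netDrift_ge {α : ℝ} (hα : 0 < α) (hα2 : α ≤ 1 / 2) {m : ℝ} (hm : 0 ≤ m) (hmγ : m ≤ lossCap α) : 0.0004 * m ^ 2 ≤ netDrift α m := by
  have hb := rate_pos
  have hb1 := rate_lt
  have hγ1 := lossCap_lt_one hα hα2
  have hγ0 := lossCap_ge hα hα2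
  have hγe : lossCap α = 1 - (1 - rate) * α := rfl
  set γ := lossCap α with hγ
  set K := (1 + rate) * (1 - α) with hKe
  have hK : 0 < K := mul_pos (by linarith) (by linarith)
  have hK2 : K ≤ 1.58 := by rw [hKe]; nlinarith
  set a := α * (1 - α) with ha
  have ha0 : 0 < a := mul_pos hα (by linarith)
  set A := a * (γ + K) with hA
  have hA0 : 0 < A := by positivity
  have hγK : γ + K = 2 + rate - 2 * α := by rw [hγe, hKe]; ring
  have hA1 : A ≤ 0.65 := by
    rw [hA, hγK, ha]
    nlinarith [sq_nonneg (α - 1 / 2), mul_nonneg hα.le (by linarith : 0 ≤ 1 - α)]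
  have hA2 : A ≤ a * (2.5774 - 2 * α) := by
    rw [hA, hγK]; exact mul_le_mul_of_nonneg_left (by linarith) ha0.le
  set T := (1 - A) / γ with hT
  have hT0 : 0 < T := div_pos (by linarith) (by linarith)
  have hγT : γ * T = 1 - A := by rw [hT]; field_simp
  have hc1 : 1 / 3.1 ≤ 1 / (1 + K * T) := by
    apply one_div_le_one_div_of_le (by positivity)
    have h1 : T ≤ 1.29 := by rw [hT, div_le_iff₀ (by linarith)]; linarith
    have := mul_le_mul hK2 h1 hT0.le (by norm_num)
    linarith
  -- The constant is `(1 - 0.997) / 2`; with `1 / 3.1` it leaves more than `0.0004`.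
  have hJm : 0.0015 * m ^ 2 ≤ driftAux γ A m := by
    set γ' := 1 - 0.4226 * α with hγ'
    have hγγ' : γ ≤ γ' := by
      rw [hγe, hγ']
      linarith [mul_le_mul_of_nonneg_right (by linarith : 0.4226 ≤ 1 - rate) hα.le]
    have hγ'1 : γ' < 1 := by linarith
    have hγ'0 : 0 < γ' := by linarith
    have hz1 : γ' ^ 2 < 1 := pow_lt_one₀ hγ'0.le hγ'1 two_ne_zero
    have hz2 : γ * m ≤ γ' ^ 2 := by
      rw [sq]; exact mul_le_mul hγγ' (hmγ.trans hγγ') hm hγ'0.le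
    have h1 := neg_log_one_sub_sub_le (z := γ * m) (z₀ := γ' ^ 2)
      (mul_nonneg (by linarith) hm) hz2 (pow_pos hγ'0 2) hz1
    have h2 := critical_inequality hα hα2
    rw [← hγ', ← ha] at h2
    set ψ := -Real.log (1 - γ' ^ 2) - γ' ^ 2 with hψ
    have hψ0 : 0 ≤ ψ := by
      have := Real.log_le_sub_one_of_pos (show 0 < 1 - γ' ^ 2 by linarith)
      rw [hψ]; linarith
    have h3 : A * (-Real.log (1 - γ * m) - γ * m) ≤ 0.997 / 2 * (γ * m) ^ 2 := by
      calc A * (-Real.log (1 - γ * m) - γ * m) ≤ A * ((γ * m / γ' ^ 2) ^ 2 * ψ) :=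
            mul_le_mul_of_nonneg_left h1 hA0.le
        _ = (A * ψ) * (γ * m / γ' ^ 2) ^ 2 := by ring
        _ ≤ (0.997 / 2 * (γ' ^ 2) ^ 2) * (γ * m / γ' ^ 2) ^ 2 := by
            apply mul_le_mul_of_nonneg_right _ (sq_nonneg _)
            exact (mul_le_mul_of_nonneg_right hA2 hψ0).trans h2
        _ = 0.997 / 2 * (γ * m) ^ 2 := by field_simp
    have h4 : A * (-Real.log (1 - γ * m) - γ * m) / γ ^ 2 ≤ 0.997 / 2 * m ^ 2 := by
      rw [div_le_iff₀ (by positivity)]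
      calc _ ≤ _ := h3
        _ = _ := by ring
    unfold driftAux
    linarith
  have h0 := driftAux_le_betDrift_sub hK (by linarith) hγ1 hT0 hγT hm hmγ
  have : 1 / 3.1 * (0.0015 * m ^ 2) ≤ 1 / (1 + K * T) * driftAux γ A m :=
    mul_le_mul hc1 hJm (by positivity) (by positivity)
  have h2 := sq_nonneg m
  unfold netDrift
  rw [← hKe, ← hγ, ← ha]
  linarith

end SAOCP

/-! ### Change of potential and log-wealth in one round -/

namespace SAOCP

/-- The nonnegative part of the betting fraction. -/
noncomputable def posFrac (G : ℕ → ℝ) (n : ℕ) : ℝ := max (G n / (n + 1)) 0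

/-- The increment of the log-wealth. -/
noncomputable def logFactor (G : ℕ → ℝ) (n : ℕ) : ℝ :=
  Real.log (1 + G n / (n + 1) * (G (n + 1) - G n))

/-- The first step up of an expert happens in round `n`. -/
def FirstUp (α : ℝ) (d : ℕ → ℝ) (n : ℕ) : Prop := (∀ k < n, d k = α) ∧ d n = α - 1

lemma FirstUp.unique {α : ℝ} {d : ℕ → ℝ} {n m : ℕ} (hn : FirstUp α d n) (hm : FirstUp α d m) :
    n = m := by
  rcases lt_trichotomy n m with h | h | h
  · have h1 := hm.1 n h
    have h2 := hn.2
    linarith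
  · exact h
  · have h1 := hn.1 m h
    have h2 := hm.2
    linarith

lemma sum_ite_le_of_unique {P : ℕ → Prop} [DecidablePred P] (hP : ∀ n m, P n → P m → n = m)
    {c : ℕ → ℝ} {M : ℝ} (hM : 0 ≤ M) (s : Finset ℕ) (hc : ∀ n ∈ s, c n ≤ M) :
    ∑ n ∈ s, (if P n then c n else 0) ≤ M := by
  rw [← Finset.sum_filter]
  have h1 : (s.filter P).card ≤ 1 := by
    rw [Finset.card_le_one]
    intro a ha b hb
    exact hP a b (Finset.mem_filter.1 ha).2 (Finset.mem_filter.1 hb).2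
  calc ∑ n ∈ s.filter P, c n ≤ (s.filter P).card • M :=
        Finset.sum_le_card_nsmul _ _ _ fun n hn => hc n (Finset.mem_filter.1 hn).1
    _ ≤ M := by
        rw [nsmul_eq_mul]
        exact mul_le_of_le_one_left hM (by exact_mod_cast h1)

lemma sum_inv_le_one_add_log (N : ℕ) :
    ∑ n ∈ Finset.range N, 1 / ((n : ℝ) + 1) ≤ 1 + Real.log (N + 1) := by
  have h := harmonic_le_one_add_log N
  have e : ((harmonic N : ℚ) : ℝ) = ∑ n ∈ Finset.range N, 1 / ((n : ℝ) + 1) := by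
    simp [harmonic]
  rw [e] at h
  refine h.trans ?_
  rcases N.eq_zero_or_pos with h0 | h0
  · simp [h0]
  · have : Real.log N ≤ Real.log (N + 1) :=
      Real.log_le_log (by exact_mod_cast h0) (by linarith)
    linarith

/-- The point `1 - α` equalizes the losses at the extreme radii `0` and `1`; it is the comparator
for the losses of the expert. -/
lemma quantileLoss_one_sub_le {α S : ℝ} (hα : 0 < α) (hα1 : α < 1) (hS : S ∈ Set.Icc (0 : ℝ) 1) :
    quantileLoss α S (1 - α) ≤ α * (1 - α) := by
  unfold quantileLoss
  apply max_le
  · nlinarith [hS.2]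
  · nlinarith [hS.1]

variable {α : ℝ} {N : ℕ} {S p r d G : ℕ → ℝ}

lemma posFrac_eq_zero {G : ℕ → ℝ} {n : ℕ} (hG : G n ≤ 0) : posFrac G n = 0 := by
  rw [posFrac, max_eq_right]
  exact div_nonpos_of_nonpos_of_nonneg hG (by positivity)

lemma posFrac_eq {G : ℕ → ℝ} {n : ℕ} (hG : 0 ≤ G n) : posFrac G n = G n / (n + 1) := by
  rw [posFrac, max_eq_left]
  positivity

section Half

variable (hα : 0 < α) (hα2 : α ≤ 1 / 2) (h : BettingRun α N S p r d G)

include hα hα2 h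

lemma BettingRun.posFrac_mem {n : ℕ} (hn : n ≤ N) : posFrac G n ∈ Set.Icc 0 (lossCap α) := by
  refine ⟨le_max_right _ _, max_le (h.fraction_le hα hα2 hn) ?_⟩
  linarith [lossCap_ge hα hα2]

lemma BettingRun.abs_gain_sub_le {n : ℕ} (hn : n < N) :
    G (n + 1) - G n ≤ (1 + rate) * (1 - α) ∧
      -quantileLoss α (S n) (r n) ≤ G (n + 1) - G n ∧ |G (n + 1) - G n| ≤ 1.58 := by
  have h1 := h.truncGain_le hα hα2 hn
  have h2 : -quantileLoss α (S n) (r n) ≤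
      truncGain (G n) (quantileLoss α (S n) (p n) - quantileLoss α (S n) (r n)) :=
    h.neg_loss_le_truncGain hα hα2
  have h3 := h.loss_expert_le hα hα2 hn
  have hK : (1 + rate) * (1 - α) ≤ 1.58 := by nlinarith [rate_lt, rate_pos]
  rw [h.gain_succ n hn, add_sub_cancel_left]
  exact ⟨h1, h2, abs_le.2 ⟨by linarith, by linarith⟩⟩

lemma BettingRun.abs_posFrac_sub_le {n : ℕ} (hn : n < N) :
    |posFrac G (n + 1) - posFrac G n| ≤ 4 / (n + 2) := by
  have hn0 : (0 : ℝ) < n + 1 := by positivity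
  have hn2 : (0 : ℝ) < n + 2 := by positivity
  have h1 := (h.abs_gain_sub_le hα hα2 hn).2.2
  have h2 := h.neg_le_gain hα hα2 n hn.le
  have h3 := h.fraction_le hα hα2 hn.le
  have h4 := lossCap_lt_one hα hα2
  have hK : (1 + rate) * (1 - α) ≤ 1.58 := by nlinarith [rate_lt, rate_pos]
  have h5 : -1.58 ≤ G n / (n + 1) := by
    rw [le_div_iff₀ hn0]
    nlinarith [n.cast_nonneg (α := ℝ)]
  have h1' := abs_le.1 h1
  calc |posFrac G (n + 1) - posFrac G n| ≤ |G (n + 1) / ((n + 1 : ℕ) + 1) - G n / (n + 1)| :=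
        abs_max_sub_max_le_abs _ _ _
    _ = |(G (n + 1) - G n - G n / (n + 1)) / (n + 2)| := by
        congr 1
        push_cast
        field_simp
        ring
    _ ≤ 4 / (n + 2) := by
        rw [abs_div, abs_of_pos hn2]
        apply div_le_div_of_nonneg_right _ hn2.le
        rw [abs_le]
        constructor <;> linarith [h1'.1, h1'.2]

/-- If the gain stays positive, `(n + 2) * (B' - B)` is the gain of the round minus `B`; `betPot_le`
and `betDrift_eq` give the claim up to a squared increment of order `1 / n ^ 2`, times `n + 2`. -/
lemma BettingRun.potential_step {n : ℕ} (hn : n < N) :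
    ((n : ℝ) + 2) * betPot ((1 + rate) * (1 - α)) (posFrac G (n + 1)) -
      ((n : ℝ) + 1) * betPot ((1 + rate) * (1 - α)) (posFrac G n) ≤
      (G (n + 1) - G n) * betLog ((1 + rate) * (1 - α)) (posFrac G n) -
        betDrift ((1 + rate) * (1 - α)) (posFrac G n) + 16 / (n + 1) := by
  have hb := rate_pos
  have hK : 0 < (1 + rate) * (1 - α) := mul_pos (by linarith) (by linarith)
  have hB := h.posFrac_mem hα hα2 hn.le
  have hB' := h.posFrac_mem hα hα2 (n := n + 1) hn
  have h1 := h.abs_gain_sub_le hα hα2 hn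
  have hγ := lossCap_lt_one hα hα2
  have hn0 : (0 : ℝ) < n + 1 := by positivity
  have hn2 : (0 : ℝ) < n + 2 := by positivity
  rw [betDrift_eq hK]
  set B := posFrac G n with hBe
  set B' := posFrac G (n + 1) with hBe'
  have hmain := betPot_le hK hB.1 hB'.1
  have hL0 := betLog_nonneg hK hB.1
  have hL1 := betLog_le hK hB.1
  set K := (1 + rate) * (1 - α)
  have hsq : ((n : ℝ) + 2) * (B' - B) ^ 2 ≤ 16 / (n + 2) := by
    have := h.abs_posFrac_sub_le hα hα2 hn
    rw [← hBe, ← hBe'] at this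
    have h2 : (B' - B) ^ 2 ≤ (4 / ((n : ℝ) + 2)) ^ 2 := by
      rw [← sq_abs]; exact pow_le_pow_left₀ (abs_nonneg _) this 2
    calc ((n : ℝ) + 2) * (B' - B) ^ 2 ≤ (n + 2) * (4 / ((n : ℝ) + 2)) ^ 2 :=
          mul_le_mul_of_nonneg_left h2 hn2.le
      _ = 16 / (n + 2) := by field_simp; norm_num
  have hx1 := abs_le.1 h1.2.2
  set x := G (n + 1) - G n with hx
  -- The positive part spoils the identity only when the gain falls from positive to nonpositive,
  -- and then `B` is already of order `1 / n`.
  have hclip : ((n : ℝ) + 2) * (B' - B) * betLog K B ≤ (x - B) * betLog K B ∨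
      (B ≤ 1.58 / (n + 1) ∧ B' = 0) := by
    rcases lt_or_ge 0 (G n) with hG | hG
    · have eB : B * (n + 1) = G n := by
        rw [hBe, posFrac, max_eq_left (by positivity), div_mul_cancel₀ _ hn0.ne']
      rcases lt_or_ge 0 (G (n + 1)) with hG' | hG'
      · left
        have eB' : B' * (n + 2) = G (n + 1) := by
          rw [hBe', posFrac, max_eq_left (by positivity)]
          push_cast
          field_simp
          ring
        apply le_of_eq
        congr 1
        rw [hx]
        linarith
      · right
        constructor
        · rw [le_div_iff₀ hn0, eB]; linarith [hx1.1]
        · rw [hBe', posFrac, max_eq_right]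
          exact div_nonpos_of_nonpos_of_nonneg hG' (by positivity)
    · left
      have eB : B = 0 := by
        rw [hBe, posFrac, max_eq_right]
        exact div_nonpos_of_nonpos_of_nonneg hG (by positivity)
      have : betLog K B = 0 := by rw [eB]; simp [betLog]
      rw [this]; simp
  rcases hclip with hc | ⟨hc1, hc2⟩
  · have h2 := mul_le_mul_of_nonneg_left hmain hn2.le
    have h3 : 16 / ((n : ℝ) + 2) ≤ 16 / (n + 1) := by gcongr; linarith
    linarith
  · have e0 : betPot K B' = 0 := by rw [hc2]; simp [betPot]
    rw [e0]
    have h2 : (B - x) * betLog K B ≤ 2.58 * (1.58 / (n + 1)) := by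
      have : betLog K B ≤ 1.58 / (n + 1) := hL1.trans hc1
      apply (mul_le_mul_of_nonneg_right (show B - x ≤ 2.58 by linarith [hB.2, hx1.1]) hL0).trans
      exact mul_le_mul_of_nonneg_left this (by norm_num)
    have h3 : 2.58 * (1.58 / ((n : ℝ) + 1)) ≤ 16 / (n + 1) := by
      rw [← mul_div_assoc]
      apply div_le_div_of_nonneg_right (by norm_num) hn0.le
    have h4 : 0 ≤ betPot K B := by
      refine le_trans (by positivity) (betPot_ge hK hB.1 ?_)
      have hK2 : K ≤ 1.58 := by simp only [K]; nlinarith [rate_lt]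
      nlinarith [hB.1, hB.2]
    have h5 : 0 ≤ ((n : ℝ) + 1) * betPot K B := by positivity
    linarith

lemma BettingRun.neg_div_le_logFactor {n : ℕ} (hn : n < N) (hG : G n ≤ 0) :
    -(24 / ((n : ℝ) + 1)) ≤ logFactor G n := by
  have h1 := h.one_add_mul_ge_of_neg hα hα2 hn hG
  have hn0 : (0 : ℝ) < n + 1 := by positivity
  unfold logFactor
  set y := 1 + G n / (n + 1) * (G (n + 1) - G n)
  have hy : 0 < y := by linarith [h1.1]
  refine le_trans ?_ (Real.one_sub_inv_le_log_of_pos hy)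
  have h2 : 1 - y ≤ 4 / (n + 1) := by linarith [h1.2]
  have h3 : y⁻¹ - 1 ≤ 24 / (n + 1) := by
    have e : y⁻¹ - 1 = (1 - y) / y := by field_simp
    rw [e, div_le_iff₀ hy]
    calc 1 - y ≤ 4 / (n + 1) := h2
      _ = 24 / (n + 1) * (1 / 6) := by ring
      _ ≤ 24 / (n + 1) * y := by
          apply mul_le_mul_of_nonneg_left (by linarith [h1.1]) (by positivity)
  linarith

lemma BettingRun.neg_log_le_logFactor {n : ℕ} (hn : n < N) (hG : 0 < G n) :
    -Real.log (10 * (n + 1)) ≤ logFactor G n := by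
  have h1 := h.one_add_mul_ge_of_pos hα hα2 hn hG
  rw [← Real.log_inv]
  apply Real.log_le_log (by positivity)
  refine le_trans (le_of_eq ?_) h1
  rw [mul_inv]; norm_num [div_eq_mul_inv]

-- Ordinary rounds with positive gain follow from the chord bounds, since the expert loses at most
-- `lossCap α`. A first step up occurs at most once and may cost a logarithm. Rounds with
-- nonpositive gain cost `O(1 / n)`.
open Classical in
lemma BettingRun.logFactor_ge {n : ℕ} (hn : n < N) :
    (G (n + 1) - G n) * betLog ((1 + rate) * (1 - α)) (posFrac G n) -
      quantileLoss α (S n) (r n) * betPen ((1 + rate) * (1 - α)) (lossCap α) (posFrac G n) -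
      24 / (n + 1) - (if FirstUp α d n then 2 + Real.log (10 * (n + 1)) else 0) ≤
      logFactor G n := by
  have hb := rate_pos
  have hK : 0 < (1 + rate) * (1 - α) := mul_pos (by linarith) (by linarith)
  have hB := h.posFrac_mem hα hα2 hn.le
  have h1 := h.abs_gain_sub_le hα hα2 hn
  have hγ := lossCap_lt_one hα hα2
  have hγ0 := lossCap_ge hα hα2
  have hlam := quantileLoss_nonneg hα (by linarith : α < 1) (S n) (r n)
  have hlog : 0 ≤ Real.log (10 * (n + 1)) :=
    Real.log_nonneg (by linarith [n.cast_nonneg (α := ℝ)])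
  have h24 : 0 ≤ 24 / ((n : ℝ) + 1) := by positivity
  have hite : 0 ≤ (if FirstUp α d n then 2 + Real.log (10 * (n + 1)) else 0) := by
    split_ifs <;> linarith
  have hγB : lossCap α * posFrac G n < 1 := by nlinarith [hB.1, hB.2]
  rcases lt_or_ge 0 (G n) with hG | hG
  · by_cases hu : FirstUp α d n
    · rw [if_pos hu]
      have h2 := h.neg_log_le_logFactor hα hα2 hn hG
      have hp := mul_nonneg hlam (betPen_nonneg hK (by linarith) hB.1 hγB)
      have hL0 := betLog_nonneg hK hB.1
      have hL1 := betLog_le hK hB.1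
      have hx := abs_le.1 h1.2.2
      have h3 : (G (n + 1) - G n) * betLog ((1 + rate) * (1 - α)) (posFrac G n) ≤ 1.58 * 1 :=
        mul_le_mul hx.2 (by linarith [hB.2]) hL0 (by norm_num)
      linarith
    · have h2 := h.loss_le_lossCap hα hα2 hn hu
      have h3 := betLog_sub_betPen_le_log hK (by linarith) hB.1 hγB h1.1 h1.2.1 hlam h2
      rw [posFrac_eq hG.le] at h3 ⊢
      unfold logFactor
      linarith
  · have h2 := h.neg_div_le_logFactor hα hα2 hn hG
    rw [posFrac_eq_zero hG, betPen_zero]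
    have : betLog ((1 + rate) * (1 - α)) 0 = 0 := by simp [betLog]
    rw [this]
    linarith

end Half

end SAOCP

/-! ### Summation: from log-wealth to the betting fraction -/

namespace SAOCP

lemma filter_range_le_eq_Ico (a N : ℕ) :
    (Finset.range N).filter (fun n => a ≤ n) = Finset.Ico a N := by
  ext n
  simp [and_comm]

lemma sum_Ico_sub_eq (f : ℕ → ℝ) {a N : ℕ} (h : a ≤ N) :
    ∑ n ∈ Finset.Ico a N, (f (n + 1) - f n) = f N - f a := by
  rw [Finset.sum_Ico_eq_sub _ h, Finset.sum_range_sub, Finset.sum_range_sub]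
  ring

variable {α : ℝ} {N : ℕ} {S p r d G : ℕ → ℝ}

section Half

variable (hα : 0 < α) (hα2 : α ≤ 1 / 2) (h : BettingRun α N S p r d G)

include hα hα2 h

/-- The regret of the expert against `1 - α`, weighted with the prices of its losses. -/
lemma BettingRun.sum_pen_le {a : ℕ} (ha : a ≤ N) {δ M : ℝ} (hδ : 0 < δ) (hM : M = 3 / δ)
    (hB : ∀ n, a ≤ n → n ≤ N → δ ≤ 1 - lossCap α * posFrac G n) :
    ∑ n ∈ Finset.Ico a N, betPen ((1 + rate) * (1 - α)) (lossCap α) (posFrac G n) *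
        (quantileLoss α (S n) (r n) - α * (1 - α)) ≤
      3 * (M * posFrac G N ^ 2 * √N) + 6 * (M * (a + 1)) +
        ∑ n ∈ Finset.Ico a N, (0.0004 * posFrac G n ^ 2 +
          (360000 * M ^ 2 + 96 * M) * (1 / ((n : ℝ) + 1))) := by
  classical
  have hb := rate_pos
  have hb1 := rate_lt
  have hK : 0 < (1 + rate) * (1 - α) := mul_pos (by linarith) (by linarith)
  have hγ := lossCap_lt_one hα hα2
  have hγ0 := lossCap_ge hα hα2
  have hK2 : (1 + rate) * (1 - α) ≤ 1.58 := by nlinarith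
  set K := (1 + rate) * (1 - α)
  set γ := lossCap α
  have hM0 : 0 < M := by rw [hM]; positivity
  have hMM : (γ + K) / δ ≤ M := by
    rw [hM]; exact div_le_div_of_nonneg_right (by linarith) hδ.le
  have hmem : ∀ n ≤ N, posFrac G n ∈ Set.Icc 0 γ := fun n hn => h.posFrac_mem hα hα2 hn
  have hγB : ∀ n ≤ N, γ * posFrac G n < 1 := fun n hn => by
    have := hmem n hn
    nlinarith [this.1, this.2]
  have hD0 : ∀ n ≤ N, 0 ≤ betPen K γ (posFrac G n) := fun n hn =>
    betPen_nonneg hK (by linarith) (hmem n hn).1 (hγB n hn)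
  have hD1 : ∀ n, a ≤ n → n ≤ N → betPen K γ (posFrac G n) ≤ M * posFrac G n ^ 2 :=
    fun n hn hn' => (betPen_le hK (by linarith) (hmem n hn').1 hδ (hB n hn hn')).trans
      (mul_le_mul_of_nonneg_right hMM (sq_nonneg _))
  -- The prices serve as weights of the regret bound. They are switched on at `a`, where the jump
  -- costs at most `M * (a + 1)`.
  set ν : ℕ → ℝ := fun n => if a ≤ n ∧ n ≤ N then betPen K γ (posFrac G n) else 0 with hν
  have hν0 : ∀ n, 0 ≤ ν n := by
    intro n
    simp only [hν]
    split_ifs with hn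
    · exact hD0 n hn.2
    · exact le_rfl
  have hreg := h.toOGDPath.weighted_regret hα (by linarith) ν hν0 (u := 1 - α)
    ⟨by linarith, by linarith⟩
  have hleft : ∑ n ∈ Finset.Ico a N, betPen K γ (posFrac G n) *
      (quantileLoss α (S n) (r n) - α * (1 - α)) ≤
      ∑ n ∈ Finset.range N, ν n * (d n * (r n - (1 - α))) := by
    rw [← filter_range_le_eq_Ico, Finset.sum_filter]
    apply Finset.sum_le_sum
    intro n hn
    have hn' := Finset.mem_range.1 hn
    simp only [hν]
    by_cases han : a ≤ n
    · rw [if_pos han, if_pos ⟨han, hn'.le⟩]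
      apply mul_le_mul_of_nonneg_left _ (hD0 n hn'.le)
      have h1 := h.toOGDPath.loss_sub_le hn' (1 - α)
      have h2 := quantileLoss_one_sub_le hα (by linarith : α < 1) (h.radius_mem n hn')
      linarith
    · rw [if_neg han, if_neg (fun hc => han hc.1), zero_mul]
  have hνN : ν N ≤ M * posFrac G N ^ 2 := by
    simp only [hν]
    rw [if_pos ⟨ha, le_rfl⟩]
    exact hD1 N ha le_rfl
  have hvar : ∑ n ∈ Finset.range N, |ν (n + 1) - ν n| * √((n : ℝ) + 1) ≤
      M * (a + 1) + ∑ n ∈ Finset.Ico a N, 1 / 6 * (0.0004 * posFrac G n ^ 2 +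
          (360000 * M ^ 2 + 96 * M) * (1 / ((n : ℝ) + 1))) := by
    have h1 : ∀ n ∈ Finset.range N, |ν (n + 1) - ν n| * √((n : ℝ) + 1) ≤
        (if n + 1 = a then M * ((a : ℝ) + 1) else 0) +
        (if a ≤ n then 1 / 6 * (0.0004 * posFrac G n ^ 2 +
          (360000 * M ^ 2 + 96 * M) * (1 / ((n : ℝ) + 1))) else 0) := by
      intro n hn
      have hn' := Finset.mem_range.1 hn
      simp only [hν]
      by_cases han : a ≤ n
      · rw [if_pos han, if_pos (⟨by omega, hn'⟩ : a ≤ n + 1 ∧ n + 1 ≤ N),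
          if_pos (⟨han, hn'.le⟩ : a ≤ n ∧ n ≤ N), if_neg (by omega), zero_add]
        have h2 := abs_betPen_sub_le hK (by linarith : 0 < γ) (hmem n hn'.le).1
          (hmem (n + 1) hn').1 hδ (hB n han hn'.le) (hB (n + 1) (by omega) hn')
        have h3 := h.abs_posFrac_sub_le hα hα2 hn'
        have hB0 := (hmem n hn'.le).1
        have hB0' := (hmem (n + 1) hn').1
        set B := posFrac G n
        set B' := posFrac G (n + 1)
        set s := √((n : ℝ) + 1) with hs
        have hs2 : s ^ 2 = n + 1 := Real.sq_sqrt (by positivity)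
        have hs0 : 0 < s := Real.sqrt_pos.2 (by positivity)
        have hn2 : (n : ℝ) + 2 = s ^ 2 + 1 := by linarith
        have h4 : max B B' ≤ B + 4 / (n + 2) := by
          apply max_le
          · have : 0 ≤ 4 / ((n : ℝ) + 2) := by positivity
            linarith
          · linarith [(abs_le.1 h3).2]
        have h5 : max B B' * |B' - B| ≤ (B + 4 / (n + 2)) * (4 / (n + 2)) :=
          mul_le_mul h4 h3 (abs_nonneg _) (by positivity)
        have h6 : |betPen K γ B' - betPen K γ B| ≤
            M * ((B + 4 / (n + 2)) * (4 / (n + 2))) :=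
          h2.trans (mul_le_mul hMM h5 (by positivity) hM0.le)
        have h7 : s / (n + 2) ≤ 1 / s := by
          rw [hn2, div_le_div_iff₀ (by positivity) hs0]; nlinarith
        have h8 : 1 / ((n : ℝ) + 2) ≤ 1 / s := by
          rw [hn2]; exact one_div_le_one_div_of_le hs0 (by nlinarith [sq_nonneg (s - 1)])
        calc |betPen K γ B' - betPen K γ B| * s
            ≤ M * ((B + 4 / (n + 2)) * (4 / (n + 2))) * s :=
              mul_le_mul_of_nonneg_right h6 hs0.le
          _ = 4 * M * ((B + 4 * (1 / (n + 2))) * (s / (n + 2))) := by ring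
          _ ≤ 4 * M * ((B + 4 * (1 / s)) * (1 / s)) := by
              apply mul_le_mul_of_nonneg_left _ (by positivity)
              exact mul_le_mul (by linarith) h7 (by positivity) (by positivity)
          _ ≤ 1 / 6 * (0.0004 * B ^ 2 + (360000 * M ^ 2 + 96 * M) * (1 / (n + 1))) := by
              have e : 1 / ((n : ℝ) + 1) = (1 / s) ^ 2 := by rw [← hs2]; field_simp
              rw [e]
              -- Young's inequality with `0.02 ^ 2 = 0.0004`, the surplus in `netDrift_ge`; this
              -- also fixes `360000 = 600 ^ 2`.
              nlinarith [sq_nonneg (0.02 * B - 600 * M * (1 / s))]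
      · rw [if_neg han, if_neg (fun hc => han hc.1 : ¬(a ≤ n ∧ n ≤ N)), add_zero]
        by_cases han' : n + 1 = a
        · rw [if_pos han', if_pos ⟨by omega, hn'⟩, sub_zero, abs_of_nonneg (hD0 _ hn')]
          have h2 := hD1 (n + 1) (by omega) hn'
          have h3 := hmem (n + 1) hn'
          have h4 : √((n : ℝ) + 1) ≤ a + 1 := by
            rw [Real.sqrt_le_left (by positivity), ← han']
            push_cast
            nlinarith [n.cast_nonneg (α := ℝ)]
          have h5 : betPen K γ (posFrac G (n + 1)) ≤ M := by
            refine h2.trans (mul_le_of_le_one_right hM0.le ?_)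
            exact pow_le_one₀ h3.1 (h3.2.trans hγ.le)
          exact mul_le_mul h5 h4 (Real.sqrt_nonneg _) hM0.le
        · rw [if_neg han', if_neg (by omega)]; simp
    refine (Finset.sum_le_sum h1).trans ?_
    rw [Finset.sum_add_distrib, ← Finset.sum_filter (fun n => a ≤ n), filter_range_le_eq_Ico]
    gcongr
    exact sum_ite_le_of_unique (fun n m hn hm => by omega) (by positivity) _ (fun _ _ => le_rfl)
  have h9 := mul_le_mul_of_nonneg_right hνN (Real.sqrt_nonneg (N : ℝ))
  rw [← Finset.mul_sum] at hvar
  linarith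

set_option maxHeartbeats 1000000 in
/-- The gain of an expert is controlled by its log-wealth from time `a` on, if its betting
fraction stays away from `1`. -/
lemma BettingRun.posFrac_sq_le {a : ℕ} (ha : a ≤ N) {δ M : ℝ} (hδ : 0 < δ) (hM : M = 3 / δ)
    (hB : ∀ n, a ≤ n → n ≤ N → δ ≤ 1 - lossCap α * posFrac G n) :
    ((N : ℝ) + 1) * posFrac G N ^ 2 ≤ 14 * (∑ n ∈ Finset.Ico a N, logFactor G n +
      (60 + 102 * M + 360040 * M ^ 2) * (a + 1 + Real.log (N + 1))) := by
  classical
  have hb := rate_pos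
  have hb1 := rate_lt
  have hK : 0 < (1 + rate) * (1 - α) := mul_pos (by linarith) (by linarith)
  have hγ := lossCap_lt_one hα hα2
  have hK2 : (1 + rate) * (1 - α) ≤ 1.58 := by nlinarith
  have hM0 : 0 < M := by rw [hM]; positivity
  have hpen := h.sum_pen_le hα hα2 ha hδ hM hB
  have hBa := h.posFrac_mem hα hα2 ha
  have hBN := h.posFrac_mem hα hα2 le_rfl
  have hnet : ∑ n ∈ Finset.Ico a N, 0.0004 * posFrac G n ^ 2 ≤
      ∑ n ∈ Finset.Ico a N, (betDrift ((1 + rate) * (1 - α)) (posFrac G n) -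
        α * (1 - α) * betPen ((1 + rate) * (1 - α)) (lossCap α) (posFrac G n)) := by
    apply Finset.sum_le_sum
    intro n hn
    have := h.posFrac_mem hα hα2 (Finset.mem_Ico.1 hn).2.le
    exact netDrift_ge hα hα2 this.1 this.2
  have htel : ∑ n ∈ Finset.Ico a N,
      (((n : ℝ) + 2) * betPot ((1 + rate) * (1 - α)) (posFrac G (n + 1)) -
      ((n : ℝ) + 1) * betPot ((1 + rate) * (1 - α)) (posFrac G n)) =
      ((N : ℝ) + 1) * betPot ((1 + rate) * (1 - α)) (posFrac G N) -
      ((a : ℝ) + 1) * betPot ((1 + rate) * (1 - α)) (posFrac G a) := by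
    rw [← sum_Ico_sub_eq (fun n : ℕ => ((n : ℝ) + 1) *
      betPot ((1 + rate) * (1 - α)) (posFrac G n)) ha]
    apply Finset.sum_congr rfl
    intro n _
    push_cast
    ring
  -- The potential telescopes on the left. On the right, `hpen` replaces the priced losses by `α *
  -- (1 - α)` times the prices, and `hnet` lets the drift absorb these together with the quadratic
  -- error in `hpen`.
  have hstep : ∑ n ∈ Finset.Ico a N,
      (((n : ℝ) + 2) * betPot ((1 + rate) * (1 - α)) (posFrac G (n + 1)) -
      ((n : ℝ) + 1) * betPot ((1 + rate) * (1 - α)) (posFrac G n)) ≤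
      ∑ n ∈ Finset.Ico a N, (logFactor G n +
        quantileLoss α (S n) (r n) *
          betPen ((1 + rate) * (1 - α)) (lossCap α) (posFrac G n) -
        betDrift ((1 + rate) * (1 - α)) (posFrac G n) + 40 * (1 / ((n : ℝ) + 1)) +
        (if FirstUp α d n then 2 + Real.log (10 * (n + 1)) else 0)) := by
    apply Finset.sum_le_sum
    intro n hn
    have hn' := (Finset.mem_Ico.1 hn).2
    have h1 := h.potential_step hα hα2 hn'
    have h2 := h.logFactor_ge hα hα2 hn'
    have e : 40 * (1 / ((n : ℝ) + 1)) = 16 / (n + 1) + 24 / (n + 1) := by ring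
    linarith
  have hlogN : 0 ≤ Real.log (N + 1) := Real.log_nonneg (by linarith [N.cast_nonneg (α := ℝ)])
  have hfirst : ∑ n ∈ Finset.Ico a N,
      (if FirstUp α d n then 2 + Real.log (10 * ((n : ℝ) + 1)) else 0) ≤
      11 + Real.log (N + 1) := by
    apply sum_ite_le_of_unique (fun n m hn hm => hn.unique hm) (by linarith)
    intro n hn
    have hn' : (n : ℝ) + 1 ≤ N + 1 := by
      have : (n : ℝ) ≤ N := by exact_mod_cast (Finset.mem_Ico.1 hn).2.le
      linarith
    rw [Real.log_mul (by norm_num) (by positivity)]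
    have h1 : Real.log ((n : ℝ) + 1) ≤ Real.log (N + 1) := Real.log_le_log (by positivity) hn'
    have h2 := Real.log_le_sub_one_of_pos (show (0 : ℝ) < 10 by norm_num)
    linarith
  have hH : ∑ n ∈ Finset.Ico a N, 1 / ((n : ℝ) + 1) ≤ 1 + Real.log (N + 1) := by
    refine le_trans (Finset.sum_le_sum_of_subset_of_nonneg (t := Finset.range N) ?_ ?_)
      (sum_inv_le_one_add_log N)
    · intro n hn; exact Finset.mem_range.2 (Finset.mem_Ico.1 hn).2
    · intro n _ _; positivity
  have hpotN := betPot_ge hK hBN.1 (by nlinarith [hBN.1, hBN.2])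
  have hpota : betPot ((1 + rate) * (1 - α)) (posFrac G a) ≤ 1 := by
    have := betPot_le hK le_rfl hBa.1
    have e0 : betPot ((1 + rate) * (1 - α)) 0 = 0 := by simp [betPot]
    have e1 : betLog ((1 + rate) * (1 - α)) 0 = 0 := by simp [betLog]
    rw [e0, e1] at this
    nlinarith [hBa.1, hBa.2]
  have hpenexp : ∑ n ∈ Finset.Ico a N,
      betPen ((1 + rate) * (1 - α)) (lossCap α) (posFrac G n) *
        (quantileLoss α (S n) (r n) - α * (1 - α)) =
      ∑ n ∈ Finset.Ico a N, quantileLoss α (S n) (r n) *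
          betPen ((1 + rate) * (1 - α)) (lossCap α) (posFrac G n) -
      ∑ n ∈ Finset.Ico a N, α * (1 - α) *
          betPen ((1 + rate) * (1 - α)) (lossCap α) (posFrac G n) := by
    rw [← Finset.sum_sub_distrib]
    exact Finset.sum_congr rfl fun n _ => by ring
  simp only [Finset.sum_add_distrib, Finset.sum_sub_distrib, ← Finset.mul_sum] at hpen hnet hstep hpenexp
  rw [Finset.sum_sub_distrib] at htel
  have hN0 : (0 : ℝ) ≤ N := N.cast_nonneg
  -- The boundary term of the weighted regret takes one half of the final potential `(N + 1) * B ^ 2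
  -- / 7`; hence the factor `14`.
  have hyoung : 3 * (M * posFrac G N ^ 2 * √N) ≤
      ((N : ℝ) + 1) * posFrac G N ^ 2 / 14 + 32 * M ^ 2 := by
    have hs2 : √(N : ℝ) ^ 2 = N := Real.sq_sqrt hN0
    have hs0 : 0 ≤ √(N : ℝ) := Real.sqrt_nonneg _
    have hB1 : posFrac G N ^ 2 ≤ posFrac G N := by nlinarith [hBN.1, hBN.2]
    have h1 : M * posFrac G N ^ 2 * √N ≤ M * posFrac G N * √N := by gcongr
    have h2 : 3 * (M * posFrac G N * √N) ≤ √(N : ℝ) ^ 2 * posFrac G N ^ 2 / 14 + 32 * M ^ 2 := by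
      nlinarith [sq_nonneg (√(N : ℝ) * posFrac G N - 21 * M), sq_nonneg M]
    rw [hs2] at h2
    nlinarith [sq_nonneg (posFrac G N)]
  have ha0 : (0 : ℝ) ≤ a := a.cast_nonneg
  set X := (a : ℝ) + 1 + Real.log (N + 1) with hX
  have h1 : (360000 * M ^ 2 + 96 * M) * ∑ n ∈ Finset.Ico a N, 1 / ((n : ℝ) + 1) ≤
      (360000 * M ^ 2 + 96 * M) * X :=
    mul_le_mul_of_nonneg_left (by linarith) (by positivity)
  have h2 : M * ((a : ℝ) + 1) ≤ M * X := mul_le_mul_of_nonneg_left (by linarith) hM0.le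
  have h3 : M ^ 2 * 1 ≤ M ^ 2 * X := mul_le_mul_of_nonneg_left (by linarith) (sq_nonneg M)
  have h4 : ((a : ℝ) + 1) * betPot ((1 + rate) * (1 - α)) (posFrac G a) ≤ a + 1 :=
    mul_le_of_le_one_right (by linarith) hpota
  have h5 := mul_le_mul_of_nonneg_left hpotN (show 0 ≤ (N : ℝ) + 1 by linarith)
  have h6 : 0 ≤ M * X := by positivity
  have h7 : 0 ≤ M ^ 2 * X := by positivity
  linarith

end Half

end SAOCP

/-! ### Very small `α`, and the bound on the gain -/

namespace SAOCP

lemma log_le_two_mul_sqrt {y : ℝ} (hy : 0 < y) : Real.log y ≤ 2 * √y := by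
  have h1 := Real.log_le_sub_one_of_pos (Real.sqrt_pos.2 hy)
  rw [Real.log_sqrt hy.le] at h1
  linarith

lemma neg_log_one_sub_le {y : ℝ} (hy0 : 0 ≤ y) (hy : y ≤ 1 / 2) : -Real.log (1 - y) ≤ 2 * y := by
  have h1 := Real.one_sub_inv_le_log_of_pos (show 0 < 1 - y by linarith)
  have h2 : (1 - y)⁻¹ ≤ 1 + 2 * y := by
    rw [inv_le_iff_one_le_mul₀ (by linarith)]; nlinarith
  linarith

/-- A discrete form of `∫ dx / √x = 2 √x`. The offset `c` keeps consecutive roots within a factor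
`1.7`, and `2 * (1 + 1.7) ≤ 5.5`. -/
lemma sum_div_sqrt_le {lam : ℕ → ℝ} {c : ℝ} (hc : 0.42 ≤ c) {n : ℕ}
    (h0 : ∀ k < n, 0 ≤ lam k) (h1 : ∀ k < n, lam k ≤ 1.58) :
    ∑ k ∈ Finset.range n, lam k / √(c + 1 / 2 * ∑ j ∈ Finset.range k, lam j) ≤
      5.5 * √(c + 1 / 2 * ∑ j ∈ Finset.range n, lam j) := by
  induction n with
  | zero => simp; positivity
  | succ n ih =>
    have hi := ih (fun k hk => h0 k (by omega)) (fun k hk => h1 k (by omega))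
    have hs : 0 ≤ ∑ j ∈ Finset.range n, lam j :=
      Finset.sum_nonneg fun k hk => h0 k (by have := Finset.mem_range.1 hk; omega)
    rw [Finset.sum_range_succ, Finset.sum_range_succ lam n]
    have hl0 := h0 n (by omega)
    have hl1 := h1 n (by omega)
    set x := c + 1 / 2 * ∑ j ∈ Finset.range n, lam j with hx
    have e : c + 1 / 2 * (∑ j ∈ Finset.range n, lam j + lam n) = x + 1 / 2 * lam n := by
      rw [hx]; ring
    rw [e]
    have hx0 : 0.42 ≤ x := by linarith
    have h2 : √x ^ 2 = x := Real.sq_sqrt (by linarith)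
    have h3 : √(x + 1 / 2 * lam n) ^ 2 = x + 1 / 2 * lam n := Real.sq_sqrt (by linarith)
    have h4 : 0 < √x := Real.sqrt_pos.2 (by linarith)
    have h5 : 0 ≤ √(x + 1 / 2 * lam n) := Real.sqrt_nonneg _
    set s := √x
    set s' := √(x + 1 / 2 * lam n)
    have h6 : s' ≤ 1.7 * s := by
      apply le_of_sq_le_sq _ (by linarith)
      rw [mul_pow, h2, h3]; linarith
    have h7 : s ≤ s' := by apply le_of_sq_le_sq _ h5; linarith
    have h8 : lam n / s ≤ 5.5 * (s' - s) := by
      rw [div_le_iff₀ h4]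
      have : lam n = 2 * ((s' - s) * (s' + s)) := by linarith
      rw [this]
      nlinarith [mul_nonneg (sub_nonneg.2 h7) (by linarith : 0 ≤ 1.7 * s - s'),
        mul_nonneg (sub_nonneg.2 h7) h4.le]
    linarith

variable {α : ℝ} {N : ℕ} {S p r d G : ℕ → ℝ}

section Half

variable (hα : 0 < α) (hα2 : α ≤ 1 / 2) (h : BettingRun α N S p r d G)

include hα hα2 h

lemma BettingRun.sum_loss_le {n : ℕ} (hn : n ≤ N) :
    ∑ k ∈ Finset.range n, quantileLoss α (S k) (r k) ≤ α * n + 3 * √n := by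
  have h1 := (h.toOGDPath.mono hn).regret hα (by linarith) (u := 1 - α)
    ⟨by linarith, by linarith⟩
  rw [Finset.sum_sub_distrib] at h1
  have h2 : ∑ k ∈ Finset.range n, quantileLoss α (S k) (1 - α) ≤ ∑ k ∈ Finset.range n, α := by
    apply Finset.sum_le_sum
    intro k hk
    have hk' := Finset.mem_range.1 hk
    have := quantileLoss_one_sub_le hα (by linarith : α < 1) (h.radius_mem k (by omega))
    nlinarith
  simp only [Finset.sum_const, Finset.card_range, nsmul_eq_mul] at h2
  linarith

open Classical in
/-- A lower bound for the log-wealth that does not deteriorate as the betting fraction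
approaches `1`. -/
lemma BettingRun.logFactor_ge_of_total_loss {n k : ℕ} (hn : n ≤ N) (hk : k < n) :
    (G (k + 1) - G k) * betLog ((1 + rate) * (1 - α)) (posFrac G k) -
      (2 * quantileLoss α (S k) (r k) + 4 * √n * (quantileLoss α (S k) (r k) /
        √(1 - rate + 1 / 2 * ∑ j ∈ Finset.range k, quantileLoss α (S j) (r j)))) -
      24 / (k + 1) - (if FirstUp α d k then 2 + Real.log (10 * (k + 1)) else 0) ≤
      logFactor G k := by
  have hb := rate_pos
  have hb1 := rate_lt
  have hkN : k < N := by omega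
  have hK : 0 < (1 + rate) * (1 - α) := mul_pos (by linarith) (by linarith)
  have hB := h.posFrac_mem hα hα2 hkN.le
  have h1 := h.abs_gain_sub_le hα hα2 hkN
  have hγ := lossCap_lt_one hα hα2
  have hlamk : ∀ k, 0 ≤ quantileLoss α (S k) (r k) := fun k =>
    quantileLoss_nonneg hα (by linarith : α < 1) (S k) (r k)
  have hlam := hlamk k
  have hlog : 0 ≤ Real.log (10 * (k + 1)) :=
    Real.log_nonneg (by linarith [k.cast_nonneg (α := ℝ)])
  have h24 : 0 ≤ 24 / ((k : ℝ) + 1) := by positivity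
  have hite : 0 ≤ (if FirstUp α d k then 2 + Real.log (10 * (k + 1)) else 0) := by
    split_ifs <;> linarith
  have hsum : 0 ≤ ∑ j ∈ Finset.range k, quantileLoss α (S j) (r j) :=
    Finset.sum_nonneg fun j _ => hlamk j
  have hwealth := h.sub_gain_ge hα hα2 k hkN
  have hcr := credit_nonneg hα hα2 (p k)
  set D := 1 - rate + 1 / 2 * ∑ j ∈ Finset.range k, quantileLoss α (S j) (r j) with hD
  have hD0 : 0 < D := by linarith
  have hpen : 0 ≤ 2 * quantileLoss α (S k) (r k) +
      4 * √n * (quantileLoss α (S k) (r k) / √D) := by positivity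
  have hL0 := betLog_nonneg hK hB.1
  have hL1 := betLog_le hK hB.1
  have hx := abs_le.1 h1.2.2
  rcases lt_or_ge 0 (G k) with hG | hG
  · by_cases hu : FirstUp α d k
    · rw [if_pos hu]
      have h2 := h.neg_log_le_logFactor hα hα2 hkN hG
      have h3 : (G (k + 1) - G k) * betLog ((1 + rate) * (1 - α)) (posFrac G k) ≤ 1.58 * 1 :=
        mul_le_mul hx.2 (by linarith [hB.2]) hL0 (by norm_num)
      linarith
    · rw [if_neg hu]
      rcases le_total 0 (G (k + 1) - G k) with hx0 | hx0
      · have h2 := betLog_mul_le_log hK hB.1 hx0 h1.1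
        rw [posFrac_eq hG.le] at h2 ⊢
        unfold logFactor
        linarith
      · have h2 := h.loss_le_lossCap hα hα2 hkN hu
        have h3 : (G (k + 1) - G k) * betLog ((1 + rate) * (1 - α)) (posFrac G k) ≤ 0 :=
          mul_nonpos_of_nonpos_of_nonneg hx0 hL0
        suffices hs : -logFactor G k ≤ 2 * quantileLoss α (S k) (r k) +
            4 * √n * (quantileLoss α (S k) (r k) / √D) by linarith
        set lam := quantileLoss α (S k) (r k) with hlame
        have hk0 : (0 : ℝ) < k + 1 := by positivity
        rw [posFrac_eq hG.le] at hB
        set B := G k / (k + 1) with hBe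
        have hBD : D / (k + 1) ≤ 1 - B := by
          have : (k + 1 : ℝ) * (1 - B) = k + 1 - G k := by rw [hBe]; field_simp
          rw [div_le_iff₀ hk0]
          linarith
        have hBl : B * lam ≤ B := mul_le_of_le_one_right hB.1 (by linarith)
        have hBl' : B * lam ≤ lam := mul_le_of_le_one_left hlam (by linarith [hB.2])
        have h4 : 1 - B * lam ≤ 1 + B * (G (k + 1) - G k) := by
          have := mul_le_mul_of_nonneg_left h1.2.1 hB.1
          linarith
        have h5 : 0 < 1 - B * lam := by linarith [div_pos hD0 hk0]
        have h6 : -logFactor G k ≤ -Real.log (1 - B * lam) := by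
          unfold logFactor
          exact neg_le_neg (Real.log_le_log h5 h4)
        refine h6.trans ?_
        -- A small loss is harmless for any betting fraction. For a large one, `1 - B ≥ D / (k + 1)`
        -- bounds the logarithm by `2 * √((k + 1) / D)`, and `2 * lam ≥ 1` makes the bound
        -- proportional to the loss.
        rcases le_total lam (1 / 2) with h7 | h7
        · have h8 := neg_log_one_sub_le (mul_nonneg hB.1 hlam) (by linarith : B * lam ≤ 1 / 2)
          have : 0 ≤ 4 * √n * (lam / √D) := by positivity
          linarith
        · have h8 : -Real.log (1 - B * lam) ≤ Real.log ((k + 1) / D) := by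
            rw [← Real.log_inv]
            apply Real.log_le_log (by positivity)
            rw [inv_le_comm₀ h5 (by positivity), inv_div]
            linarith
          have h9 := log_le_two_mul_sqrt (show 0 < ((k : ℝ) + 1) / D by positivity)
          rw [Real.sqrt_div (by positivity)] at h9
          have h10 : √((k : ℝ) + 1) ≤ √n := by
            apply Real.sqrt_le_sqrt
            exact_mod_cast hk
          have h11 : √((k : ℝ) + 1) / √D ≤ √n / √D := by gcongr
          have h12 : 2 * (√n / √D) ≤ 4 * √n * (lam / √D) := by
            have : 0 ≤ √n / √D := by positivity
            have e : 4 * √n * (lam / √D) = 4 * lam * (√n / √D) := by ring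
            rw [e]
            nlinarith
          linarith
  · have h2 := h.neg_div_le_logFactor hα hα2 hkN hG
    rw [posFrac_eq_zero hG]
    have : betLog ((1 + rate) * (1 - α)) 0 = 0 := by simp [betLog]
    rw [this]
    linarith

/-- By `sum_loss_le` the total loss is at most `α * n + 3 * √n`, so even the crude prices of
`logFactor_ge_of_total_loss` add up to a tiny multiple of `n`. -/
lemma BettingRun.betPot_le_of_small (hα3 : α ≤ 1e-7) {n : ℕ} (hn : n ≤ N) :
    ((n : ℝ) + 1) * betPot ((1 + rate) * (1 - α)) (posFrac G n) ≤
      ∑ k ∈ Finset.range n, logFactor G k + 0.007 * n + 3e12 + 41 * Real.log (n + 1) := by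
  classical
  have hb := rate_pos
  have hb1 := rate_lt
  have hb2 := rate_gt
  have hn0 : (0 : ℝ) ≤ n := n.cast_nonneg
  have htel : ∑ k ∈ Finset.range n,
      (((k : ℝ) + 2) * betPot ((1 + rate) * (1 - α)) (posFrac G (k + 1)) -
      ((k : ℝ) + 1) * betPot ((1 + rate) * (1 - α)) (posFrac G k)) =
      ((n : ℝ) + 1) * betPot ((1 + rate) * (1 - α)) (posFrac G n) := by
    have e := Finset.sum_range_sub (fun n : ℕ => ((n : ℝ) + 1) *
      betPot ((1 + rate) * (1 - α)) (posFrac G n)) n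
    have e0 : betPot ((1 + rate) * (1 - α)) (posFrac G 0) = 0 := by
      rw [posFrac_eq_zero h.gain_zero.le]; simp [betPot]
    rw [e0, mul_zero, sub_zero] at e
    rw [← e]
    apply Finset.sum_congr rfl
    intro k _
    push_cast
    ring
  have hstep := Finset.sum_le_sum (s := Finset.range n)
    (f := fun k : ℕ => ((k : ℝ) + 2) * betPot ((1 + rate) * (1 - α)) (posFrac G (k + 1)) -
      ((k : ℝ) + 1) * betPot ((1 + rate) * (1 - α)) (posFrac G k))
    (g := fun k : ℕ => logFactor G k + (2 * quantileLoss α (S k) (r k) +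
      4 * √n * (quantileLoss α (S k) (r k) /
        √(1 - rate + 1 / 2 * ∑ j ∈ Finset.range k, quantileLoss α (S j) (r j)))) +
      40 * (1 / ((k : ℝ) + 1)) + (if FirstUp α d k then 2 + Real.log (10 * (k + 1)) else 0))
    (fun k hk => by
      have hk' := Finset.mem_range.1 hk
      have h1 := h.potential_step hα hα2 (n := k) (by omega)
      have h2 := h.logFactor_ge_of_total_loss hα hα2 hn hk'
      have h3 : 0 ≤ betDrift ((1 + rate) * (1 - α)) (posFrac G k) := by
        have hB := h.posFrac_mem hα hα2 (n := k) (by omega)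
        have hγ := lossCap_lt_one hα hα2
        have hK : 0 < (1 + rate) * (1 - α) := mul_pos (by linarith) (by linarith)
        refine le_trans (by positivity) (betDrift_ge hK hB.1 ?_)
        have hK2 : (1 + rate) * (1 - α) ≤ 1.58 := by nlinarith
        nlinarith [hB.1, hB.2]
      have e : 40 * (1 / ((k : ℝ) + 1)) = 16 / (k + 1) + 24 / (k + 1) := by ring
      linarith)
  rw [htel] at hstep
  simp only [Finset.sum_add_distrib, ← Finset.mul_sum] at hstep
  have hfirst : ∑ k ∈ Finset.range n,
      (if FirstUp α d k then 2 + Real.log (10 * ((k : ℝ) + 1)) else 0) ≤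
      11 + Real.log (n + 1) := by
    have hlogN : 0 ≤ Real.log ((n : ℝ) + 1) := Real.log_nonneg (by linarith)
    apply sum_ite_le_of_unique (fun n m hn hm => hn.unique hm) (by linarith)
    intro k hk
    have hk' : (k : ℝ) + 1 ≤ n + 1 := by
      have : (k : ℝ) ≤ n := by exact_mod_cast (Finset.mem_range.1 hk).le
      linarith
    rw [Real.log_mul (by norm_num) (by positivity)]
    have h1 : Real.log ((k : ℝ) + 1) ≤ Real.log (n + 1) := Real.log_le_log (by positivity) hk'
    have h2 := Real.log_le_sub_one_of_pos (show (0 : ℝ) < 10 by norm_num)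
    linarith
  have hH := sum_inv_le_one_add_log n
  have hloss := h.sum_loss_le hα hα2 hn
  have hsq := sum_div_sqrt_le (lam := fun k => quantileLoss α (S k) (r k)) (c := 1 - rate)
    (by linarith) (n := n)
    (fun k _ => quantileLoss_nonneg hα (by linarith : α < 1) (S k) (r k))
    (fun k hk => (h.loss_expert_le hα hα2 (by omega)).trans (by nlinarith))
  set Q := ∑ k ∈ Finset.range n, quantileLoss α (S k) (r k)
  have hQ0 : 0 ≤ Q :=
    Finset.sum_nonneg fun k _ => quantileLoss_nonneg hα (by linarith : α < 1) (S k) (r k)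
  have hs2 : √(n : ℝ) ^ 2 = n := Real.sq_sqrt hn0
  have hs0 : 0 ≤ √(n : ℝ) := Real.sqrt_nonneg _
  have hy2 : √(1 - rate + 1 / 2 * Q) ^ 2 = 1 - rate + 1 / 2 * Q := Real.sq_sqrt (by linarith)
  have h1 := mul_le_mul_of_nonneg_left hsq (show 0 ≤ 4 * √(n : ℝ) by positivity)
  set y := √(1 - rate + 1 / 2 * Q)
  have h2 : 22 * (√(n : ℝ) * y) ≤ 0.002 * n + 60500 * (1 - rate + 1 / 2 * Q) := by
    rw [← hs2, ← hy2, hs2]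
    nlinarith [sq_nonneg (0.002 * √(n : ℝ) - 11 * y)]
  have h3 : 90756 * √(n : ℝ) ≤ 0.001 * n + 2.1e12 := by
    nlinarith [sq_nonneg (0.001 * √(n : ℝ) - 45378)]
  have h4 : α * n ≤ 1e-7 * n := mul_le_mul_of_nonneg_right hα3 hn0
  linarith

end Half

/-- The gain of an expert is of the order `√(N Λ)` if its wealth is at most `exp Λ`. -/
theorem BettingRun.gain_le_sqrt_of_le_half (hα : 0 < α) (hα2 : α ≤ 1 / 2)
    (h : BettingRun α N S p r d G) {Λ : ℝ}
    (hΛ1 : 1 ≤ Λ) (hlog : Real.log (N + 1) ≤ Λ)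
    (hΛ : ∀ n ≤ N, ∑ k ∈ Finset.range n, logFactor G k ≤ Λ) : G N ≤ 1e13 * √(N * Λ) := by
  have hb := rate_pos
  have hb1 := rate_lt
  have hγ := lossCap_lt_one hα hα2
  have hK : 0 < (1 + rate) * (1 - α) := mul_pos (by linarith) (by linarith)
  have hN0 : (0 : ℝ) ≤ N := N.cast_nonneg
  have hBN := h.posFrac_mem hα hα2 le_rfl
  rcases lt_or_ge 0 (G N) with hG | hG
  swap
  · exact hG.trans (by positivity)
  have hN1 : (1 : ℝ) ≤ N := by
    rcases N.eq_zero_or_pos with h0 | h0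
    · rw [h0, h.gain_zero] at hG; exact absurd hG (lt_irrefl _)
    · exact_mod_cast h0
  suffices hs : ((N : ℝ) + 1) * posFrac G N ^ 2 ≤ 1e25 * Λ ∨ N ≤ 1e15 * Λ by
    have h2 : G N ^ 2 ≤ 1e26 * (N * Λ) := by
      rcases hs with hs | hs
      · have e : G N = (N + 1) * posFrac G N := by rw [posFrac_eq hG.le]; field_simp
        rw [e, mul_pow, sq ((N : ℝ) + 1), mul_assoc]
        have := mul_le_mul_of_nonneg_left hs (show 0 ≤ (N : ℝ) + 1 by linarith)
        nlinarith
      · have h3 := h.gain_le hα hα2 N le_rfl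
        have h4 : G N ≤ 2 * N := by nlinarith
        have h5 : G N ^ 2 ≤ (2 * N) ^ 2 := pow_le_pow_left₀ hG.le h4 2
        nlinarith
    apply le_of_sq_le_sq _ (by positivity)
    rw [mul_pow, Real.sq_sqrt (by positivity)]
    norm_num at h2 ⊢
    linarith
  rcases le_total α 1e-7 with hα3 | hα3
  · by_cases hNΛ : (N : ℝ) ≤ 1e15 * Λ
    · exact Or.inr hNΛ
    left
    push Not at hNΛ
    -- From round `a` on, a fraction above `1 / 3` would give a potential of at least `(n + 1) /
    -- 63`, contradicting `betPot_le_of_small`. So the prices are tame with `δ = 2 / 3`, and the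
    -- wealth before `a` is bounded by the same lemma.
    set a := ⌊1e15 * Λ⌋₊ + 1 with ha
    have ha1 : 1e15 * Λ < a := by rw [ha]; push_cast; exact Nat.lt_floor_add_one _
    have ha2 : (a : ℝ) ≤ 1e15 * Λ + 1 := by
      rw [ha]; push_cast
      linarith [Nat.floor_le (show 0 ≤ 1e15 * Λ by positivity)]
    have haN : a ≤ N := by
      rw [ha]
      exact Nat.succ_le_of_lt ((Nat.floor_lt (by positivity)).2 hNΛ)
    have hlogn : ∀ n ≤ N, Real.log ((n : ℝ) + 1) ≤ Λ := by
      intro n hn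
      refine le_trans (Real.log_le_log (by positivity) ?_) hlog
      have : (n : ℝ) ≤ N := by exact_mod_cast hn
      linarith
    have hK2 : (1 + rate) * (1 - α) ≤ 1.58 := by nlinarith
    have hpot : ∀ n ≤ N, posFrac G n ^ 2 / 7 ≤
        betPot ((1 + rate) * (1 - α)) (posFrac G n) := by
      intro n hn
      have hB := h.posFrac_mem hα hα2 hn
      exact betPot_ge hK hB.1 (by nlinarith [hB.1, hB.2])
    have hB : ∀ n, a ≤ n → n ≤ N → 2 / 3 ≤ 1 - lossCap α * posFrac G n := by
      intro n han hn
      have hB := h.posFrac_mem hα hα2 hn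
      suffices hs : posFrac G n ≤ 1 / 3 by nlinarith [hB.1]
      by_contra hne
      push Not at hne
      have h1 := h.betPot_le_of_small hα hα2 hα3 hn
      have h2 := hΛ n hn
      have h3 := hlogn n hn
      have h4 : (1 : ℝ) / 63 ≤ betPot ((1 + rate) * (1 - α)) (posFrac G n) := by
        refine le_trans ?_ (hpot n hn)
        nlinarith
      have h5 := mul_le_mul_of_nonneg_left h4 (show 0 ≤ (n : ℝ) + 1 by positivity)
      have h6 : (a : ℝ) ≤ n := by exact_mod_cast han
      norm_num at h1 ha1
      linarith
    have hmain := h.posFrac_sq_le hα hα2 haN (by norm_num) (M := 9 / 2) (by norm_num) hB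
    have h1 := h.betPot_le_of_small hα hα2 hα3 haN
    have h2 := hΛ N le_rfl
    have h3 := hlogn a haN
    have h4 : 0 ≤ ((a : ℝ) + 1) * betPot ((1 + rate) * (1 - α)) (posFrac G a) :=
      mul_nonneg (by positivity) (le_trans (by positivity) (hpot a haN))
    rw [Finset.sum_Ico_eq_sub _ haN] at hmain
    norm_num at hmain h1 ha2 ⊢
    linarith
  · left
    -- For `α ≥ 1e-7` the cap is below `1` by `(1 - rate) * α ≥ 4e-8`, so no initial segment has to
    -- be removed.
    have hB : ∀ n, 0 ≤ n → n ≤ N → 4e-8 ≤ 1 - lossCap α * posFrac G n := by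
      intro n _ hn
      have hB := h.posFrac_mem hα hα2 hn
      have h1 : lossCap α * posFrac G n ≤ lossCap α :=
        mul_le_of_le_one_right (by linarith [hB.1, hB.2]) (by linarith [hB.2])
      unfold lossCap at h1 ⊢
      nlinarith
    have hmain := h.posFrac_sq_le hα hα2 (Nat.zero_le N) (by norm_num) (M := 75000000)
      (by norm_num) hB
    have h2 := hΛ N le_rfl
    rw [← Finset.range_eq_Ico] at hmain
    norm_num at hmain ⊢
    linarith

/-- The gain of an expert is of the order `√(N Λ)` if its wealth is at most `exp Λ`. -/
theorem BettingRun.gain_le_sqrt (hα : 0 < α) (hα1 : α < 1)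
    (h : BettingRun α N S p r d G) {Λ : ℝ}
    (hΛ1 : 1 ≤ Λ) (hlog : Real.log (N + 1) ≤ Λ)
    (hΛ : ∀ n ≤ N, ∑ k ∈ Finset.range n, logFactor G k ≤ Λ) : G N ≤ 1e13 * √(N * Λ) := by
  rcases le_total α (1 / 2) with h2 | h2
  · exact h.gain_le_sqrt_of_le_half hα h2 hΛ1 hlog hΛ
  · exact h.reflect.gain_le_sqrt_of_le_half (by linarith) (by linarith) hΛ1 hlog hΛ

/-- All factors of the wealth of an expert are positive. -/
theorem BettingRun.one_add_mul_pos (hα : 0 < α) (hα1 : α < 1)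
    (h : BettingRun α N S p r d G) {n : ℕ} (hn : n < N) :
    0 < 1 + G n / (n + 1) * (G (n + 1) - G n) := by
  refine lt_of_lt_of_le (by positivity : (0 : ℝ) < 0.1 / (n + 1)) ?_
  rcases le_total α (1 / 2) with h2 | h2
  · exact h.one_add_mul_ge hα h2 hn
  · exact h.reflect.one_add_mul_ge (by linarith) (by linarith) hn

end SAOCP

/-! ### The experts of the algorithm as betting runs -/

namespace SAOCP

lemma one_le_lifetime {g : ℕ} (hg : 1 ≤ g) (i : ℕ) : 1 ≤ lifetime g i :=
  Nat.mul_pos hg (by positivity)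

lemma mem_active {g t i : ℕ} : i ∈ active g t ↔ (1 ≤ i ∧ i ≤ t) ∧ t < i + lifetime g i := by
  simp [active]

lemma priorMass_pos {i : ℕ} (hi : 1 ≤ i) : 0 < priorMass i := by
  unfold priorMass
  have : (0 : ℝ) < i := by exact_mod_cast hi
  positivity

lemma self_mem_active {g t : ℕ} (hg : 1 ≤ g) (ht : 1 ≤ t) : t ∈ active g t :=
  mem_active.2 ⟨⟨ht, le_rfl⟩, by have := one_le_lifetime hg t; omega⟩

lemma sum_priorMass_active_pos {g t : ℕ} (hg : 1 ≤ g) (ht : 1 ≤ t) :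
    0 < ∑ j ∈ active g t, priorMass j :=
  Finset.sum_pos (fun _ hj => priorMass_pos (mem_active.1 hj).1.1) ⟨t, self_mem_active hg ht⟩

lemma prior_nonneg {g t i : ℕ} (hi : i ∈ active g t) : 0 ≤ prior g t i :=
  div_nonneg (priorMass_pos (mem_active.1 hi).1.1).le
    (Finset.sum_nonneg fun _ hj => (priorMass_pos (mem_active.1 hj).1.1).le)

lemma State.prob_nonneg {g t i : ℕ} (σ : State) (hi : i ∈ active g t) : 0 ≤ σ.prob g t i := by
  unfold State.prob
  split_ifs with h
  · exact div_nonneg (mul_nonneg (prior_nonneg hi) (le_max_right _ _)) h.le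
  · exact prior_nonneg hi

lemma State.sum_prob {g t : ℕ} (σ : State) (hg : 1 ≤ g) (ht : 1 ≤ t) :
    ∑ i ∈ active g t, σ.prob g t i = 1 := by
  unfold State.prob
  split_ifs with h
  · rw [← Finset.sum_div, div_self h.ne']
  · unfold prior
    rw [← Finset.sum_div, div_self (sum_priorMass_active_pos hg ht).ne']

/-- If some active expert has positive weight, experts without do not contribute. -/
lemma State.prob_eq_zero {g t i j : ℕ} (σ : State) (hg : 1 ≤ g) (ht : 1 ≤ t)
    (hj : j ∈ active g t) (hwj : 0 < σ.weight j) (hwi : σ.weight i ≤ 0) : σ.prob g t i = 0 := by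
  have hpos : 0 < ∑ k ∈ active g t, σ.unnormalized g t k := by
    apply Finset.sum_pos'
    · intro k hk
      exact mul_nonneg (prior_nonneg hk) (le_max_right _ _)
    · refine ⟨j, hj, mul_pos ?_ (lt_max_of_lt_left hwj)⟩
      exact div_pos (priorMass_pos (mem_active.1 hj).1.1) (sum_priorMass_active_pos hg ht)
  unfold State.prob
  rw [if_pos hpos, State.unnormalized, max_eq_right hwi, mul_zero, zero_div]

lemma sum_mul_mem_Icc {s : Finset ℕ} {p x : ℕ → ℝ} {a b : ℝ} (hp : ∀ i ∈ s, 0 ≤ p i)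
    (hsum : ∑ i ∈ s, p i = 1) (hx : ∀ i ∈ s, p i ≠ 0 → x i ∈ Set.Icc a b) :
    ∑ i ∈ s, p i * x i ∈ Set.Icc a b := by
  have h1 : ∑ i ∈ s, p i * a ≤ ∑ i ∈ s, p i * x i := by
    apply Finset.sum_le_sum
    intro i hi
    by_cases h0 : p i = 0
    · simp [h0]
    · exact mul_le_mul_of_nonneg_left (hx i hi h0).1 (hp i hi)
  have h2 : ∑ i ∈ s, p i * x i ≤ ∑ i ∈ s, p i * b := by
    apply Finset.sum_le_sum
    intro i hi
    by_cases h0 : p i = 0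
    · simp [h0]
    · exact mul_le_mul_of_nonneg_left (hx i hi h0).2 (hp i hi)
  rw [← Finset.sum_mul, hsum, one_mul] at h1 h2
  exact ⟨h1, h2⟩

lemma quantileLoss_div {α D : ℝ} (hD : 0 < D) (S s : ℝ) :
    quantileLoss α (S / D) (s / D) = quantileLoss α S s / D := by
  unfold quantileLoss
  rw [← max_div_div_right hD.le]
  congr 1 <;> ring

variable {α D : ℝ} {g : ℕ} {S : ℕ → ℝ}

/-- The memory of the algorithm in round `t`. -/
noncomputable def during (α D : ℝ) (g : ℕ) (S : ℕ → ℝ) (t : ℕ) : State :=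
  (stateAfter α D g S (t - 1)).spawn t

lemma stateAfter_eq {t : ℕ} (ht : 1 ≤ t) :
    stateAfter α D g S t = (during α D g S t).finish α D g t (S t) := by
  obtain ⟨m, rfl⟩ : ∃ m, t = m + 1 := ⟨t - 1, by omega⟩
  rfl

lemma during_succ (t : ℕ) : during α D g S (t + 1) = (stateAfter α D g S t).spawn (t + 1) := rfl

lemma radius_eq_predict (t : ℕ) : radius α D g S t = (during α D g S t).predict g t := rfl

lemma last_stateAfter {t : ℕ} (ht : 1 ≤ t) : (stateAfter α D g S t).last = radius α D g S t := by
  rw [stateAfter_eq ht]; rfl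

lemma during_self (i : ℕ) :
    (during α D g S i).radius i = (stateAfter α D g S (i - 1)).last ∧
    (during α D g S i).gradSq i = 0 ∧ (during α D g S i).gain i = 0 ∧
    (during α D g S i).bet i = 0 ∧ (during α D g S i).weight i = 0 := by
  simp [during, State.spawn]

lemma during_succ_of_ne {t i : ℕ} (hi : i ≠ t + 1) :
    (during α D g S (t + 1)).radius i = (stateAfter α D g S t).radius i ∧
    (during α D g S (t + 1)).gradSq i = (stateAfter α D g S t).gradSq i ∧
    (during α D g S (t + 1)).gain i = (stateAfter α D g S t).gain i ∧
    (during α D g S (t + 1)).bet i = (stateAfter α D g S t).bet i ∧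
    (during α D g S (t + 1)).weight i = (stateAfter α D g S t).weight i := by
  simp [during_succ, State.spawn, hi]

/-- The normalized radii of expert `i`, by age. -/
noncomputable def expertRadius (α D : ℝ) (g : ℕ) (S : ℕ → ℝ) (i n : ℕ) : ℝ :=
  (during α D g S (i + n)).radius i / D

/-- The loss gradients of expert `i`, by age. -/
noncomputable def expertGrad (α D : ℝ) (g : ℕ) (S : ℕ → ℝ) (i n : ℕ) : ℝ :=
  quantileGrad α (S (i + n)) ((during α D g S (i + n)).radius i)

/-- The total gain of expert `i`, by age. -/
noncomputable def expertGain (α D : ℝ) (g : ℕ) (S : ℕ → ℝ) (i n : ℕ) : ℝ :=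
  (during α D g S (i + n)).gain i

/-- The wealth of expert `i`, by age. -/
noncomputable def expertWealth (α D : ℝ) (g : ℕ) (S : ℕ → ℝ) (i n : ℕ) : ℝ :=
  1 + (during α D g S (i + n)).bet i

lemma mem_active_add {i n : ℕ} (hi : 1 ≤ i) (hn : n < lifetime g i) : i ∈ active g (i + n) :=
  mem_active.2 ⟨⟨hi, by omega⟩, by omega⟩

lemma gradSq_eq {i n : ℕ} (hi : 1 ≤ i) (hn : n ≤ lifetime g i) :
    (during α D g S (i + n)).gradSq i = ∑ k ∈ Finset.range n, expertGrad α D g S i k ^ 2 := by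
  induction n with
  | zero => simpa using (during_self i).2.1
  | succ n ih =>
    rw [Finset.sum_range_succ, ← ih (by omega), ← add_assoc,
      (during_succ_of_ne (by omega)).2.1, stateAfter_eq (by omega)]
    simp only [State.finish, if_pos (mem_active_add hi (by omega : n < lifetime g i))]
    rfl

lemma expertRadius_succ (hD : 0 < D) {i n : ℕ} (hi : 1 ≤ i) (hn : n < lifetime g i) :
    expertRadius α D g S i (n + 1) = expertRadius α D g S i n - rate * (expertGrad α D g S i n /
      √(∑ k ∈ Finset.range (n + 1), expertGrad α D g S i k ^ 2)) := by
  unfold expertRadius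
  rw [Finset.sum_range_succ, ← gradSq_eq hi hn.le, ← add_assoc,
    (during_succ_of_ne (by omega)).1, stateAfter_eq (by omega)]
  simp only [State.finish, if_pos (mem_active_add hi hn)]
  change ((during α D g S (i + n)).radius i - D / √3 * (expertGrad α D g S i n / _)) / D = _
  rw [sub_div, rate]
  congr 1
  field_simp
  rfl

lemma gain_succ_eq {i n : ℕ} (hi : 1 ≤ i) (hn : n < lifetime g i) :
    expertGain α D g S i (n + 1) = expertGain α D g S i n +
      (during α D g S (i + n)).roundGain α D g (i + n) (S (i + n)) i := by
  unfold expertGain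
  rw [← add_assoc, (during_succ_of_ne (by omega)).2.2.1, stateAfter_eq (by omega)]
  simp only [State.finish, if_pos (mem_active_add hi hn)]

lemma wealth_succ_eq {i n : ℕ} (hi : 1 ≤ i) (hn : n < lifetime g i) :
    expertWealth α D g S i (n + 1) = expertWealth α D g S i n +
      (during α D g S (i + n)).weight i *
      (during α D g S (i + n)).roundGain α D g (i + n) (S (i + n)) i := by
  unfold expertWealth
  rw [← add_assoc, (during_succ_of_ne (by omega)).2.2.2.1, stateAfter_eq (by omega)]
  simp only [State.finish, if_pos (mem_active_add hi hn)]
  ring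

/-- At age `n` the last update was made in round `i + n - 1`, whose denominator `t - i + 2` is `n +
1`. With positive wealth, weight and gain have the same sign. -/
lemma weight_eq {i n : ℕ} (hi : 1 ≤ i) (hn : n ≤ lifetime g i) :
    (during α D g S (i + n)).weight i =
      expertGain α D g S i n / (n + 1) * expertWealth α D g S i n := by
  rcases n with _ | n
  · have h := during_self (α := α) (D := D) (g := g) (S := S) i
    simp [expertGain, expertWealth, h.2.2.1, h.2.2.2.2]
  · rw [gain_succ_eq hi hn, wealth_succ_eq hi hn, ← add_assoc,
      (during_succ_of_ne (by omega)).2.2.2.2, stateAfter_eq (by omega)]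
    simp only [State.finish, if_pos (mem_active_add hi hn)]
    unfold expertGain expertWealth
    push_cast
    congr 1
    · congr 1; ring
    · ring

lemma wealth_zero (i : ℕ) : expertWealth α D g S i 0 = 1 := by
  have h := during_self (α := α) (D := D) (g := g) (S := S) i
  simp [expertWealth, h.2.2.2.1]

lemma gain_zero (i : ℕ) : expertGain α D g S i 0 = 0 := by
  have h := during_self (α := α) (D := D) (g := g) (S := S) i
  simp [expertGain, h.2.2.1]

lemma expertWealth_succ {i n : ℕ} (hi : 1 ≤ i) (hn : n < lifetime g i) :
    expertWealth α D g S i (n + 1) = expertWealth α D g S i n *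
      (1 + expertGain α D g S i n / (n + 1) *
        (expertGain α D g S i (n + 1) - expertGain α D g S i n)) := by
  rw [wealth_succ_eq hi hn, weight_eq hi hn.le, gain_succ_eq hi hn]
  ring

section Run

variable (hα : 0 < α) (hα1 : α < 1) (hD : 0 < D) (hg : 1 ≤ g)
  (hS : ∀ t, S t ∈ Set.Icc 0 D)

include hα hα1 hD hg hS

lemma ogdPath_of_start {i N : ℕ} (hi : 1 ≤ i) (hN : N ≤ lifetime g i)
    (hstart : expertRadius α D g S i 0 ∈ Set.Icc (-rate) (1 + rate)) :
    OGDPath α N (fun n => S (i + n) / D) (expertRadius α D g S i) (expertGrad α D g S i) := by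
  refine ⟨fun n _ => ?_, hstart, fun n _ => ?_, fun n hn => ?_⟩
  · have := hS (i + n)
    exact ⟨div_nonneg this.1 hD.le, (div_le_one hD).2 this.2⟩
  · unfold expertGrad quantileGrad expertRadius
    split_ifs with h
    · exact Or.inr ⟨rfl, (div_le_div_iff_of_pos_right hD).2 h.le⟩
    · exact Or.inl ⟨by ring, (div_le_div_iff_of_pos_right hD).2 (not_lt.1 h)⟩
  · exact expertRadius_succ hD hi (by omega)

/-- Strong induction, since experts and predictions depend on each other: an expert starts at an
earlier prediction (or at `0`), stays in the range by `OGDPath.mem`, and predictions are averages.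
-/
lemma radius_div_mem : ∀ t, 1 ≤ t → radius α D g S t / D ∈ Set.Icc (-rate) (1 + rate) := by
  intro t
  induction t using Nat.strong_induction_on with
  | _ t ih =>
    intro ht
    have hb := rate_pos
    rw [radius_eq_predict]
    unfold State.predict
    split_ifs with h1
    · simp only [zero_div]; constructor <;> linarith
    · have e : (∑ i ∈ active g t, (during α D g S t).prob g t i * (during α D g S t).radius i) / D
          = ∑ i ∈ active g t, (during α D g S t).prob g t i *
            ((during α D g S t).radius i / D) := by
        rw [Finset.sum_div]
        exact Finset.sum_congr rfl fun i _ => by ring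
      rw [e]
      apply sum_mul_mem_Icc (fun i hi => State.prob_nonneg _ hi) (State.sum_prob _ hg ht)
      intro i hi _
      obtain ⟨⟨hi1, hit⟩, htL⟩ := mem_active.1 hi
      have hstart : expertRadius α D g S i 0 ∈ Set.Icc (-rate) (1 + rate) := by
        have h0 := (during_self (α := α) (D := D) (g := g) (S := S) i).1
        simp only [expertRadius, add_zero, h0]
        rcases Nat.lt_or_ge i 2 with hi2 | hi2
        · have : i = 1 := by omega
          subst this
          simp [stateAfter, State.init, hb.le]
          linarith
        · rw [last_stateAfter (by omega)]
          exact ih (i - 1) (by omega) (by omega)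
      have hp := ogdPath_of_start hα hα1 hD hg hS (N := t - i) hi1 (by omega) hstart
      have := hp.mem hα hα1 (t - i) le_rfl
      simpa [expertRadius, Nat.add_sub_cancel' hit] using this

lemma ogdPath_expert {i N : ℕ} (hi : 1 ≤ i) (hN : N ≤ lifetime g i) :
    OGDPath α N (fun n => S (i + n) / D) (expertRadius α D g S i) (expertGrad α D g S i) := by
  have hb := rate_pos
  apply ogdPath_of_start hα hα1 hD hg hS hi hN
  have h0 := (during_self (α := α) (D := D) (g := g) (S := S) i).1
  simp only [expertRadius, add_zero, h0]
  rcases Nat.lt_or_ge i 2 with hi2 | hi2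
  · have : i = 1 := by omega
    subst this
    simp [stateAfter, State.init, hb.le]
    linarith
  · rw [last_stateAfter (by omega)]
    exact radius_div_mem hα hα1 hD hg hS (i - 1) (by omega)

/-- Experts with positive weight are old enough to have reacted to the last radius. -/
lemma radius_mem_of_weight_pos {t j : ℕ} (hj : j ∈ active g (t + 1))
    (hw : 0 < (during α D g S (t + 1)).weight j) :
    radius α D g S (t + 1) / D ∈ Set.Icc (min (-overshoot α) (S t / D - rate))
      (max (1 + overshoot (1 - α)) (S t / D + rate)) := by
  rw [radius_eq_predict]
  unfold State.predict
  -- The newborn expert has weight `0`, so it has no influence once some active weight is positive.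
  have hne : ∀ i, 0 < (during α D g S (t + 1)).weight i → i ≠ t + 1 := by
    rintro i hwi rfl
    rw [(during_self (t + 1)).2.2.2.2] at hwi
    exact lt_irrefl _ hwi
  obtain ⟨⟨hj1, hjt⟩, _⟩ := mem_active.1 hj
  have h1 : t + 1 ≠ 1 := by
    have := hne j hw
    omega
  rw [if_neg h1, Finset.sum_div]
  have e : ∑ i ∈ active g (t + 1), (during α D g S (t + 1)).prob g (t + 1) i *
      (during α D g S (t + 1)).radius i / D = ∑ i ∈ active g (t + 1),
      (during α D g S (t + 1)).prob g (t + 1) i * ((during α D g S (t + 1)).radius i / D) :=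
    Finset.sum_congr rfl fun i _ => by ring
  rw [e]
  apply sum_mul_mem_Icc (fun i hi => State.prob_nonneg _ hi)
    (State.sum_prob _ hg (by omega))
  intro i hi hp
  have hwi : 0 < (during α D g S (t + 1)).weight i := by
    by_contra hc
    exact hp (State.prob_eq_zero _ hg (by omega) hj hw (not_lt.1 hc))
  obtain ⟨⟨hi1, hit⟩, hiL⟩ := mem_active.1 hi
  have := hne i hwi
  have hrun := ogdPath_expert hα hα1 hD hg hS (N := t + 1 - i) hi1 (by omega)
  obtain ⟨n, rfl⟩ : ∃ n, t = i + n := ⟨t - i, by omega⟩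
  have h2 := hrun.low_after_step hα hα1 (n := n) (by omega)
  have h3 := hrun.high_after_step hα hα1 (n := n) (by omega)
  exact ⟨h2, h3⟩

/-- The algorithm truncates by the sign of the weight, a betting run by the sign of the gain. They
agree as long as the wealth is positive. -/
lemma bettingRun_expert_of_wealth {i N : ℕ} (hi : 1 ≤ i) (hN : N ≤ lifetime g i)
    (hW : ∀ n < N, 0 < expertWealth α D g S i n) :
    BettingRun α N (fun n => S (i + n) / D) (fun n => radius α D g S (i + n) / D)
      (expertRadius α D g S i) (expertGrad α D g S i) (expertGain α D g S i) := by
  have hweight : ∀ n < N, (0 < (during α D g S (i + n)).weight i ↔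
      0 < expertGain α D g S i n) := by
    intro n hn
    rw [weight_eq hi (by omega), mul_pos_iff_of_pos_right (hW n hn),
      div_pos_iff_of_pos_right (by positivity)]
  have hpool : ∀ n, n + 1 < N → 0 < expertGain α D g S i (n + 1) →
      radius α D g S (i + (n + 1)) / D ∈ Set.Icc (min (-overshoot α) (S (i + n) / D - rate))
      (max (1 + overshoot (1 - α)) (S (i + n) / D + rate)) := by
    intro n hn hG
    exact radius_mem_of_weight_pos hα hα1 hD hg hS (t := i + n) (j := i)
      (mem_active_add (n := n + 1) hi (by omega)) ((hweight (n + 1) hn).2 hG)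
  refine ⟨ogdPath_expert hα hα1 hD hg hS hi hN, fun n _ => ?_, fun n hn hG => ?_,
    fun n hn hG => ?_, gain_zero i, fun n hn => ?_⟩
  · exact radius_div_mem hα hα1 hD hg hS (i + n) (by omega)
  · exact (hpool n hn hG).1
  · exact (hpool n hn hG).2
  · rw [gain_succ_eq hi (by omega)]
    congr 1
    unfold State.roundGain truncGain expertRadius
    rw [quantileLoss_div hD, quantileLoss_div hD, ← sub_div, radius_eq_predict]
    by_cases hG : 0 < expertGain α D g S i n
    · rw [if_pos hG, if_pos ((hweight n hn).2 hG)]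
    · rw [if_neg hG, if_neg (fun hc => hG ((hweight n hn).1 hc))]
      rw [← max_div_div_right hD.le, zero_div]

/-- This closes the circle: positive wealth up to age `n` gives a betting run of length `n + 1`,
whose last factor is positive, hence positive wealth at age `n + 1`. -/
lemma expertWealth_pos {i : ℕ} (hi : 1 ≤ i) :
    ∀ n ≤ lifetime g i, 0 < expertWealth α D g S i n := by
  intro n
  induction n using Nat.strong_induction_on with
  | _ n ih =>
    intro hn
    rcases n with _ | n
    · rw [wealth_zero]; norm_num
    · have hrun := bettingRun_expert_of_wealth hα hα1 hD hg hS (N := n + 1) hi hn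
        (fun k hk => ih k hk (by omega))
      rw [expertWealth_succ hi hn]
      exact mul_pos (ih n (by omega) (by omega)) (hrun.one_add_mul_pos hα hα1 (by omega))

lemma bettingRun_expert {i N : ℕ} (hi : 1 ≤ i) (hN : N ≤ lifetime g i) :
    BettingRun α N (fun n => S (i + n) / D) (fun n => radius α D g S (i + n) / D)
      (expertRadius α D g S i) (expertGrad α D g S i) (expertGain α D g S i) :=
  bettingRun_expert_of_wealth hα hα1 hD hg hS hi hN
    (fun n hn => expertWealth_pos hα hα1 hD hg hS hi n (by omega))

lemma sum_logFactor_eq {i : ℕ} (hi : 1 ≤ i) {n : ℕ} (hn : n ≤ lifetime g i) :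
    ∑ k ∈ Finset.range n, logFactor (expertGain α D g S i) k =
      Real.log (expertWealth α D g S i n) := by
  induction n with
  | zero => simp [wealth_zero]
  | succ n ih =>
    have hrun := bettingRun_expert hα hα1 hD hg hS hi hn
    rw [Finset.sum_range_succ, ih (by omega), expertWealth_succ hi hn,
      Real.log_mul (expertWealth_pos hα hα1 hD hg hS hi n (by omega)).ne'
        (hrun.one_add_mul_pos hα hα1 (by omega)).ne']
    rfl

end Run

end SAOCP

/-! ### From bounded wealth to regret on intervals -/

namespace SAOCP

lemma convexOn_quantileLoss (α S : ℝ) : ConvexOn ℝ Set.univ (quantileLoss α S) := by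
  have h1 : ConvexOn ℝ Set.univ (fun s : ℝ => (1 - α) * (S - s)) := by
    refine ⟨convex_univ, fun x _ y _ a b _ _ hab => le_of_eq ?_⟩
    simp only [smul_eq_mul]
    linear_combination -(1 - α) * S * hab
  have h2 : ConvexOn ℝ Set.univ (fun s : ℝ => α * (s - S)) := by
    refine ⟨convex_univ, fun x _ y _ a b _ _ hab => le_of_eq ?_⟩
    simp only [smul_eq_mul]
    linear_combination α * S * hab
  exact h1.sup h2

lemma sum_priorMass_le (n : ℕ) : ∑ i ∈ Finset.Icc 1 n, priorMass i ≤ 2 := by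
  have h := sum_Ioo_inv_sq_le (α := ℝ) 0 (n + 1)
  have e : Finset.Ioo 0 (n + 1) = Finset.Icc 1 n := by
    ext i; simp; omega
  rw [e] at h
  refine le_trans (Finset.sum_le_sum fun i _ => ?_) (h.trans (by norm_num))
  unfold priorMass
  apply mul_le_of_le_one_right (by positivity)
  apply inv_le_one_of_one_le₀
  have : (0 : ℝ) ≤ (Nat.log 2 i : ℝ) := Nat.cast_nonneg _
  linarith

/-- The bets of one round do not win on average over the prior. -/
lemma State.sum_bet_nonpos {α D : ℝ} {g t : ℕ} (hD : 0 < D) (hg : 1 ≤ g) (ht : 1 ≤ t) (σ : State)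
    (S : ℝ) (h1 : t = 1 → ∀ i ∈ active g t, σ.weight i ≤ 0) :
    ∑ i ∈ active g t, priorMass i * (σ.weight i * σ.roundGain α D g t S i) ≤ 0 := by
  set P := ∑ j ∈ active g t, priorMass j with hP
  have hP0 : 0 < P := sum_priorMass_active_pos hg ht
  have hterm : ∀ i ∈ active g t, priorMass i * (σ.weight i * σ.roundGain α D g t S i) ≤
      P / D * (σ.unnormalized g t i *
        (quantileLoss α S (σ.predict g t) - quantileLoss α S (σ.radius i))) := by
    intro i hi
    have hpi := priorMass_pos (mem_active.1 hi).1.1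
    unfold State.roundGain State.unnormalized prior
    rw [← hP]
    split_ifs with hw
    · rw [max_eq_left hw.le]
      apply le_of_eq
      field_simp
    · rw [max_eq_right (not_lt.1 hw)]
      simp only [mul_zero, zero_mul]
      apply mul_nonpos_of_nonneg_of_nonpos hpi.le
      exact mul_nonpos_of_nonpos_of_nonneg (not_lt.1 hw)
        (div_nonneg (le_max_right _ _) hD.le)
  refine (Finset.sum_le_sum hterm).trans ?_
  rw [← Finset.mul_sum]
  apply mul_nonpos_of_nonneg_of_nonpos (by positivity)
  have hu0 : ∀ i ∈ active g t, 0 ≤ σ.unnormalized g t i := fun i hi =>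
    mul_nonneg (prior_nonneg hi) (le_max_right _ _)
  by_cases hU : 0 < ∑ j ∈ active g t, σ.unnormalized g t j
  -- In round `1` the prediction is `0` by decree and not the average of the experts; `h1` excludes
  -- this case when some weight is positive.
  · have ht1 : t ≠ 1 := by
      intro h
      have : ∑ j ∈ active g t, σ.unnormalized g t j = 0 :=
        Finset.sum_eq_zero fun i hi => by
          rw [State.unnormalized, max_eq_right (h1 h i hi), mul_zero]
      linarith
    have hprob : ∀ i, σ.unnormalized g t i =
        (∑ j ∈ active g t, σ.unnormalized g t j) * σ.prob g t i := by
      intro i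
      rw [State.prob, if_pos hU]
      field_simp
    have hpred : σ.predict g t = ∑ i ∈ active g t, σ.prob g t i • σ.radius i := by
      rw [State.predict, if_neg ht1]; rfl
    have hJ := (convexOn_quantileLoss α S).map_sum_le (t := active g t) (w := σ.prob g t)
      (p := σ.radius) (fun i hi => σ.prob_nonneg hi) (σ.sum_prob hg ht) (fun _ _ => Set.mem_univ _)
    rw [← hpred] at hJ
    simp only [smul_eq_mul] at hJ
    have e : ∑ i ∈ active g t, σ.unnormalized g t i *
        (quantileLoss α S (σ.predict g t) - quantileLoss α S (σ.radius i)) =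
        (∑ j ∈ active g t, σ.unnormalized g t j) * (quantileLoss α S (σ.predict g t) -
          ∑ i ∈ active g t, σ.prob g t i * quantileLoss α S (σ.radius i)) := by
      have e1 : quantileLoss α S (σ.predict g t) =
          ∑ i ∈ active g t, σ.prob g t i * quantileLoss α S (σ.predict g t) := by
        rw [← Finset.sum_mul, σ.sum_prob hg ht, one_mul]
      conv_rhs => rw [e1, ← Finset.sum_sub_distrib, Finset.mul_sum]
      apply Finset.sum_congr rfl
      intro i _
      rw [hprob i]
      ring
    rw [e]
    exact mul_nonpos_of_nonneg_of_nonpos hU.le (by linarith)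
  · have h0 : ∑ j ∈ active g t, σ.unnormalized g t j = 0 :=
      le_antisymm (not_lt.1 hU) (Finset.sum_nonneg hu0)
    rw [Finset.sum_eq_zero_iff_of_nonneg hu0] at h0
    apply le_of_eq
    exact Finset.sum_eq_zero fun i hi => by rw [h0 i hi, zero_mul]

variable {α D : ℝ} {g : ℕ} {S : ℕ → ℝ}

/-- The normalization of the prior depends on the round, so the unnormalized masses are used to add
up rounds. Newborn experts enter with bet `0`, and expired ones keep theirs. -/
lemma sum_priorMass_mul_bet_nonpos (hD : 0 < D) (hg : 1 ≤ g) (m : ℕ) :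
    ∑ i ∈ Finset.Icc 1 m, priorMass i * (stateAfter α D g S m).bet i ≤ 0 := by
  induction m with
  | zero => simp
  | succ m ih =>
    have hbet : ∀ i, (stateAfter α D g S (m + 1)).bet i = (during α D g S (m + 1)).bet i +
        if i ∈ active g (m + 1) then (during α D g S (m + 1)).weight i *
          (during α D g S (m + 1)).roundGain α D g (m + 1) (S (m + 1)) i else 0 := by
      intro i
      rw [stateAfter_eq (by omega)]
      simp only [State.finish]
      split_ifs <;> simp
    simp only [hbet, mul_add, Finset.sum_add_distrib]
    have h1 : ∑ i ∈ Finset.Icc 1 (m + 1), priorMass i * (during α D g S (m + 1)).bet i ≤ 0 := by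
      rw [Finset.sum_Icc_succ_top (by omega), (during_self (m + 1)).2.2.2.1, mul_zero, add_zero]
      refine le_trans (le_of_eq (Finset.sum_congr rfl fun i hi => ?_)) ih
      rw [(during_succ_of_ne (by have := (Finset.mem_Icc.1 hi).2; omega)).2.2.2.1]
    have h2 : ∑ i ∈ Finset.Icc 1 (m + 1), priorMass i *
        (if i ∈ active g (m + 1) then (during α D g S (m + 1)).weight i *
          (during α D g S (m + 1)).roundGain α D g (m + 1) (S (m + 1)) i else 0) ≤ 0 := by
      have e : ∀ i, priorMass i *
        (if i ∈ active g (m + 1) then (during α D g S (m + 1)).weight i *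
          (during α D g S (m + 1)).roundGain α D g (m + 1) (S (m + 1)) i else 0) =
        if i ∈ active g (m + 1) then priorMass i * ((during α D g S (m + 1)).weight i *
          (during α D g S (m + 1)).roundGain α D g (m + 1) (S (m + 1)) i) else 0 := by
        intro i; split_ifs <;> simp
      simp only [e]
      rw [← Finset.sum_filter]
      have ef : (Finset.Icc 1 (m + 1)).filter (fun i => i ∈ active g (m + 1)) =
          active g (m + 1) := by
        ext i
        simp only [Finset.mem_filter, Finset.mem_Icc, mem_active]
        tauto
      rw [ef]
      apply State.sum_bet_nonpos hD hg (by omega)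
      intro hm i hi
      have : i = m + 1 := by have := (mem_active.1 hi).1; omega
      rw [this, (during_self (m + 1)).2.2.2.2]
    linarith

section Run

variable (hα : 0 < α) (hα1 : α < 1) (hD : 0 < D) (hg : 1 ≤ g)
  (hS : ∀ t, S t ∈ Set.Icc 0 D)

include hα hα1 hD hg hS

lemma one_add_bet_nonneg {j : ℕ} (hj : 1 ≤ j) {m : ℕ} (hm : j ≤ m) :
    0 ≤ 1 + (stateAfter α D g S m).bet j := by
  have key : ∀ m, j ≤ m → j ∈ active g m → 0 ≤ 1 + (stateAfter α D g S m).bet j := by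
    intro m hm ha
    obtain ⟨n, rfl⟩ : ∃ n, m = j + n := ⟨m - j, by omega⟩
    have h1 := expertWealth_pos hα hα1 hD hg hS hj (n + 1)
      (by have := (mem_active.1 ha).2; omega)
    unfold expertWealth at h1
    rw [← add_assoc, (during_succ_of_ne (by omega)).2.2.2.1] at h1
    exact h1.le
  induction m, hm using Nat.le_induction with
  | base => exact key j le_rfl (self_mem_active hg hj)
  | succ m hm ih =>
    by_cases ha : j ∈ active g (m + 1)
    · exact key (m + 1) (by omega) ha
    · rw [stateAfter_eq (by omega)]
      simp only [State.finish, if_neg ha]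
      rw [(during_succ_of_ne (by omega)).2.2.2.1]
      exact ih

/-- All wealths are nonnegative and their sum with prior masses is at most the total mass, so a
single term is as well. -/
lemma expertWealth_le {i n : ℕ} (hi : 1 ≤ i) :
    priorMass i * expertWealth α D g S i n ≤ 2 := by
  rcases n with _ | n
  · rw [wealth_zero, mul_one]
    refine le_trans (Finset.single_le_sum (f := priorMass) (fun j hj => ?_)
      (Finset.mem_Icc.2 ⟨hi, le_rfl⟩)) (sum_priorMass_le i)
    exact (priorMass_pos (Finset.mem_Icc.1 hj).1).le
  · unfold expertWealth
    rw [← add_assoc, (during_succ_of_ne (by omega)).2.2.2.1]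
    have h1 := sum_priorMass_mul_bet_nonpos (α := α) (D := D) (g := g) (S := S) hD hg (i + n)
    have h2 := sum_priorMass_le (i + n)
    have h3 := Finset.single_le_sum (s := Finset.Icc 1 (i + n))
      (f := fun j => priorMass j * (1 + (stateAfter α D g S (i + n)).bet j)) (fun j hj =>
        mul_nonneg (priorMass_pos (Finset.mem_Icc.1 hj).1).le
          (one_add_bet_nonneg hα hα1 hD hg hS (Finset.mem_Icc.1 hj).1 (Finset.mem_Icc.1 hj).2))
      (Finset.mem_Icc.2 ⟨hi, by omega⟩)
    simp only [mul_add, mul_one, Finset.sum_add_distrib] at h3 ⊢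
    linarith

lemma log_expertWealth_le {i n T : ℕ} (hi : 1 ≤ i) (hiT : i ≤ T) (hT : 2 ≤ T)
    (hn : n ≤ lifetime g i) :
    Real.log (expertWealth α D g S i n) ≤ 4 * Real.log T := by
  have h1 := expertWealth_le hα hα1 hD hg hS (n := n) hi
  have h0 := expertWealth_pos hα hα1 hD hg hS hi n hn
  set W := expertWealth α D g S i n
  have hi0 : (0 : ℝ) < i := by exact_mod_cast hi
  have hTi : (i : ℝ) ≤ T := by exact_mod_cast hiT
  have hT2 : (2 : ℝ) ≤ T := by exact_mod_cast hT
  have hl : 1 + (Nat.log 2 i : ℝ) ≤ i := by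
    have : Nat.log 2 i < i := Nat.log_lt_self 2 (by omega)
    have : Nat.log 2 i + 1 ≤ i := this
    have h : ((Nat.log 2 i + 1 : ℕ) : ℝ) ≤ i := by exact_mod_cast this
    push_cast at h; linarith
  have hl0 : 0 < 1 + (Nat.log 2 i : ℝ) := by positivity
  have h2 : W ≤ (T : ℝ) ^ 4 := by
    have h3 : W ≤ 2 * ((i : ℝ) ^ 2 * (1 + (Nat.log 2 i : ℝ))) := by
      unfold priorMass at h1
      rw [← mul_inv, inv_mul_le_iff₀ (by positivity)] at h1
      linarith
    calc W ≤ 2 * ((i : ℝ) ^ 2 * (1 + (Nat.log 2 i : ℝ))) := h3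
      _ ≤ T * ((T : ℝ) ^ 2 * T) := by
          have : 1 + (Nat.log 2 i : ℝ) ≤ T := hl.trans hTi
          gcongr
      _ = (T : ℝ) ^ 4 := by ring
  calc Real.log W ≤ Real.log ((T : ℝ) ^ 4) := Real.log_le_log h0 h2
    _ = 4 * Real.log T := by rw [Real.log_pow]; norm_num

/-- The regret of the algorithm over the first rounds of an expert. -/
lemma regret_of_le_lifetime {i n T : ℕ} (hi : 1 ≤ i) (hn : n ≤ lifetime g i) (hT : 2 ≤ T)
    (hiT : i + n ≤ T + 1) {u : ℝ} (hu : u ∈ Set.Icc 0 D) :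
    ∑ k ∈ Finset.range n, (quantileLoss α (S (i + k)) (radius α D g S (i + k)) -
      quantileLoss α (S (i + k)) u) ≤ 3e13 * (D * √(n * Real.log T)) := by
  rcases n with _ | n
  · simp
  have hrun := bettingRun_expert hα hα1 hD hg hS hi hn
  have hT2 : (2 : ℝ) ≤ T := by exact_mod_cast hT
  have hlogT : 0.69 ≤ Real.log T :=
    le_trans (by linarith [Real.log_two_gt_d9]) (Real.log_le_log (by norm_num) hT2)
  have hgain := hrun.gain_le_sqrt hα hα1 (Λ := 4 * Real.log T) (by linarith)
    (by
      have h1 : Real.log (((n + 1 : ℕ) : ℝ) + 1) ≤ Real.log ((T : ℝ) ^ 2) := by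
        apply Real.log_le_log (by positivity)
        have : ((n + 1 : ℕ) : ℝ) ≤ T := by exact_mod_cast (by omega : n + 1 ≤ T)
        nlinarith
      rw [Real.log_pow] at h1
      push_cast at h1 ⊢
      linarith)
    (fun k hk => by
      rw [sum_logFactor_eq hα hα1 hD hg hS hi (hk.trans hn)]
      exact log_expertWealth_le hα hα1 hD hg hS hi (by omega) hT (hk.trans hn))
  have hreg := hrun.toOGDPath.regret hα hα1 (u := u / D)
    ⟨div_nonneg hu.1 hD.le, (div_le_one hD).2 hu.2⟩
  -- Truncation only increases the gain, so the gain dominates the actual loss difference.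
  have hG : ∑ k ∈ Finset.range (n + 1), (quantileLoss α (S (i + k) / D)
      (radius α D g S (i + k) / D) - quantileLoss α (S (i + k) / D)
        (expertRadius α D g S i k)) ≤ expertGain α D g S i (n + 1) := by
    have e := Finset.sum_range_sub (expertGain α D g S i) (n + 1)
    rw [gain_zero, sub_zero] at e
    rw [← e]
    apply Finset.sum_le_sum
    intro k hk
    rw [hrun.gain_succ k (Finset.mem_range.1 hk), add_sub_cancel_left]
    unfold truncGain
    split_ifs
    · exact le_rfl
    · exact le_max_left _ _
  set X := √(((n + 1 : ℕ) : ℝ) * Real.log T) with hX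
  have h4 : √(((n + 1 : ℕ) : ℝ) * (4 * Real.log T)) = 2 * X := by
    rw [hX, show ((n + 1 : ℕ) : ℝ) * (4 * Real.log T) = 2 ^ 2 * (((n + 1 : ℕ) : ℝ) * Real.log T)
      by ring, Real.sqrt_mul (by norm_num), Real.sqrt_sq (by norm_num)]
  have h5 : √((n + 1 : ℕ) : ℝ) ≤ 2 * X := by
    rw [← h4]
    apply Real.sqrt_le_sqrt
    apply le_mul_of_one_le_right (by positivity) (by linarith)
  rw [h4] at hgain
  have hX0 : 0 ≤ X := Real.sqrt_nonneg _
  have hsum : ∑ k ∈ Finset.range (n + 1), (quantileLoss α (S (i + k)) (radius α D g S (i + k)) -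
      quantileLoss α (S (i + k)) u) = D * (∑ k ∈ Finset.range (n + 1),
        (quantileLoss α (S (i + k) / D) (radius α D g S (i + k) / D) -
          quantileLoss α (S (i + k) / D) (expertRadius α D g S i k)) +
        ∑ k ∈ Finset.range (n + 1), (quantileLoss α (S (i + k) / D) (expertRadius α D g S i k) -
          quantileLoss α (S (i + k) / D) (u / D))) := by
    rw [← Finset.sum_add_distrib, Finset.mul_sum]
    apply Finset.sum_congr rfl
    intro k _
    rw [quantileLoss_div hD, quantileLoss_div hD]
    field_simp
    ring
  rw [hsum]
  have e : 3e13 * (D * X) = D * (3e13 * X) := by ring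
  rw [e]
  apply mul_le_mul_of_nonneg_left _ hD.le
  have h6 : 3 * √((n + 1 : ℕ) : ℝ) ≤ 1e13 * X := by
    have h7 : 6 * X ≤ 1e13 * X := mul_le_mul_of_nonneg_right (by norm_num) hX0
    linarith
  refine (add_le_add (hG.trans hgain) (hreg.trans h6)).trans (le_of_eq ?_)
  ring

end Run

/-- Splitting an interval along powers of two. -/
lemma sum_Ico_le_of_dyadic {c : ℕ → ℝ} {T : ℕ} {A : ℝ} (hA : 0 ≤ A)
    (h : ∀ i n, 1 ≤ i → n ≤ 2 ^ padicValNat 2 i → i + n ≤ T + 1 →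
      ∑ t ∈ Finset.Ico i (i + n), c t ≤ A * √n) :
    ∀ k τ : ℕ, 1 ≤ τ → τ + k ≤ T + 1 → ∑ t ∈ Finset.Ico τ (τ + k), c t ≤
      A * (4.5 * √k - 2.5 * √(min (2 ^ padicValNat 2 τ) k : ℕ)) := by
  intro k
  induction k using Nat.strong_induction_on with
  | _ k ih =>
    intro τ hτ hτk
    set x := 2 ^ padicValNat 2 τ with hx
    have hx1 : 1 ≤ x := Nat.one_le_two_pow
    rcases Nat.lt_or_ge x k with hkx | hkx
    swap
    · refine (h τ k hτ hkx hτk).trans (mul_le_mul_of_nonneg_left ?_ hA)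
      rw [min_eq_right hkx]
      linarith [Real.sqrt_nonneg (k : ℝ)]
    · have h1 := h τ x hτ le_rfl (by omega)
      have h2 := ih (k - x) (by omega) (τ + x) (by omega) (by omega)
      -- The quotient of `τ` by `x` is odd, so `τ + x` is divisible by `2 * x`: the permitted block
      -- length at least doubles at each split.
      have hy : 2 * x ≤ 2 ^ padicValNat 2 (τ + x) := by
        have hd : 2 ^ (padicValNat 2 τ + 1) ∣ τ + x := by
          obtain ⟨q, hq⟩ : x ∣ τ := pow_padicValNat_dvd
          have hodd : ¬ 2 ∣ q := by
            rintro ⟨s, rfl⟩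
            apply pow_succ_padicValNat_not_dvd (p := 2) (n := τ) (by omega)
            rw [pow_succ, ← hx]
            exact ⟨s, by rw [hq]; ring⟩
          obtain ⟨s, hs⟩ : 2 ∣ q + 1 := by omega
          rw [pow_succ, ← hx]
          refine ⟨s, ?_⟩
          calc τ + x = x * (q + 1) := by rw [mul_add, mul_one, ← hq]
            _ = x * 2 * s := by rw [hs]; ring
        rw [padicValNat_dvd_iff_le (by omega)] at hd
        calc 2 * x = 2 ^ (padicValNat 2 τ + 1) := by rw [hx, pow_succ]; ring
          _ ≤ _ := Nat.pow_le_pow_right (by norm_num) hd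
      have e : ∑ t ∈ Finset.Ico τ (τ + k), c t = ∑ t ∈ Finset.Ico τ (τ + x), c t +
          ∑ t ∈ Finset.Ico (τ + x) (τ + x + (k - x)), c t := by
        rw [Finset.sum_Ico_consecutive _ (by omega) (by omega)]
        congr 2
        omega
      rw [e, min_eq_left hkx.le]
      refine (add_le_add h1 h2).trans ?_
      rw [← mul_add]
      apply mul_le_mul_of_nonneg_left _ hA
      have hcast : ((k - x : ℕ) : ℝ) = k - x := by rw [Nat.cast_sub hkx.le]
      have hxk : (x : ℝ) ≤ k := by exact_mod_cast hkx.le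
      have ha2 : √(x : ℝ) ^ 2 = x := Real.sq_sqrt (by positivity)
      have hb2 : √((k - x : ℕ) : ℝ) ^ 2 = k - x := by
        rw [Real.sq_sqrt (by positivity), hcast]
      have hc2 : √(k : ℝ) ^ 2 = k := Real.sq_sqrt (by positivity)
      have ha0 := Real.sqrt_nonneg (x : ℝ)
      have hb0 := Real.sqrt_nonneg ((k - x : ℕ) : ℝ)
      have hc0 := Real.sqrt_nonneg (k : ℝ)
      rcases le_total (2 ^ padicValNat 2 (τ + x)) (k - x) with hyk | hyk
      · rw [min_eq_left hyk]
        -- The subtracted term of the induction hypothesis pays for the present block: `2.5 * 1.4 =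
        -- 1 + 2.5`.
        have hd : 1.4 * √(x : ℝ) ≤ √((2 ^ padicValNat 2 (τ + x) : ℕ) : ℝ) := by
          apply Real.le_sqrt_of_sq_le
          rw [mul_pow, ha2]
          have : ((2 * x : ℕ) : ℝ) ≤ ((2 ^ padicValNat 2 (τ + x) : ℕ) : ℝ) := by exact_mod_cast hy
          push_cast at this ⊢
          have hx0 : (0 : ℝ) ≤ x := x.cast_nonneg
          linarith
        have hbc : √((k - x : ℕ) : ℝ) ≤ √(k : ℝ) := by
          apply Real.sqrt_le_sqrt
          rw [hcast]
          have hx0 : (0 : ℝ) ≤ x := x.cast_nonneg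
          linarith
        linarith
      · rw [min_eq_right hyk]
        have : 3.5 * √(x : ℝ) + 2 * √((k - x : ℕ) : ℝ) ≤ 4.5 * √(k : ℝ) := by
          apply le_of_sq_le_sq _ (by linarith)
          nlinarith [sq_nonneg (2 * √(x : ℝ) - 3.5 * √((k - x : ℕ) : ℝ))]
        linarith

lemma stateAfter_congr {S' : ℕ → ℝ} {m : ℕ} (h : ∀ t, 1 ≤ t → t ≤ m → S t = S' t) :
    stateAfter α D g S m = stateAfter α D g S' m := by
  induction m with
  | zero => rfl
  | succ m ih =>
    rw [stateAfter, stateAfter, ih (fun t h1 h2 => h t h1 (by omega)), h (m + 1) (by omega) le_rfl]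

lemma radius_congr {S' : ℕ → ℝ} {m : ℕ} (h : ∀ t, 1 ≤ t → t < m → S t = S' t) :
    radius α D g S m = radius α D g S' m := by
  unfold radius
  rw [stateAfter_congr fun t h1 h2 => h t h1 (by omega)]

/-- The predictions stay close to `[0, D]`. -/
theorem radius_mem (hα : 0 < α) (hα1 : α < 1) (hD : 0 < D) (hg : 1 ≤ g) {T : ℕ}
    (hS : ∀ t, 1 ≤ t → t ≤ T → S t ∈ Set.Icc 0 D) {t : ℕ} (ht : 1 ≤ t) (htT : t ≤ T) :
    radius α D g S t / D ∈ Set.Icc (-rate) (1 + rate) := by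
  have e := radius_congr (α := α) (D := D) (g := g) (S := S) (m := t)
    (S' := fun t => if 1 ≤ t ∧ t ≤ T then S t else 0)
    (fun s h1 h2 => (if_pos ⟨h1, by omega⟩).symm)
  rw [e]
  refine radius_div_mem hα hα1 hD hg (fun t => ?_) t ht
  split_ifs with h
  · exact hS t h.1 h.2
  · exact ⟨le_rfl, hD.le⟩

/-- The regret of the algorithm on intervals. -/
theorem interval_regret (hα : 0 < α) (hα1 : α < 1) (hD : 0 < D) (hg : 1 ≤ g) {T : ℕ} (hT : 2 ≤ T)
    (hS : ∀ t, 1 ≤ t → t ≤ T → S t ∈ Set.Icc 0 D) {τ k : ℕ} (hτ : 1 ≤ τ) (hτk : τ + k ≤ T + 1)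
    {u : ℝ} (hu : u ∈ Set.Icc 0 D) :
    ∑ t ∈ Finset.Ico τ (τ + k), (quantileLoss α (S t) (radius α D g S t) -
      quantileLoss α (S t) u) ≤ 1.35e14 * (D * √(k * Real.log T)) := by
  set S' : ℕ → ℝ := fun t => if 1 ≤ t ∧ t ≤ T then S t else 0 with hS'
  have hS'mem : ∀ t, S' t ∈ Set.Icc 0 D := by
    intro t
    simp only [hS']
    split_ifs with h
    · exact hS t h.1 h.2
    · exact ⟨le_rfl, hD.le⟩
  have heq : ∀ t, 1 ≤ t → t ≤ T → S t = S' t := fun t h1 h2 => (if_pos ⟨h1, h2⟩).symm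
  have e : ∑ t ∈ Finset.Ico τ (τ + k), (quantileLoss α (S t) (radius α D g S t) -
      quantileLoss α (S t) u) = ∑ t ∈ Finset.Ico τ (τ + k),
        (quantileLoss α (S' t) (radius α D g S' t) - quantileLoss α (S' t) u) := by
    apply Finset.sum_congr rfl
    intro t ht
    have := Finset.mem_Ico.1 ht
    rw [heq t (by omega) (by omega),
      radius_congr (S' := S') fun s h1 h2 => heq s h1 (by omega)]
  rw [e]
  have hlog : 0 ≤ Real.log T := Real.log_natCast_nonneg T
  have h := sum_Ico_le_of_dyadic (c := fun t => quantileLoss α (S' t) (radius α D g S' t) -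
    quantileLoss α (S' t) u) (T := T) (A := 3e13 * (D * √(Real.log T))) (by positivity)
    (fun i n hi hn hin => by
      have h1 := regret_of_le_lifetime hα hα1 hD hg hS'mem hi (n := n) (T := T)
        (hn.trans (Nat.le_mul_of_pos_left _ hg)) hT hin hu
      rw [Finset.sum_Ico_eq_sum_range, Nat.add_sub_cancel_left]
      refine h1.trans (le_of_eq ?_)
      rw [Real.sqrt_mul (by positivity)]
      ring) k τ hτ hτk
  refine h.trans ?_
  rw [Real.sqrt_mul (by positivity)]
  have h1 : 4.5 * √(k : ℝ) - 2.5 * √((min (2 ^ padicValNat 2 τ) k : ℕ) : ℝ) ≤ 4.5 * √(k : ℝ) := by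
    linarith [Real.sqrt_nonneg ((min (2 ^ padicValNat 2 τ) k : ℕ) : ℝ)]
  refine (mul_le_mul_of_nonneg_left h1 (by positivity)).trans (le_of_eq ?_)
  ring

end SAOCP


/-! ### Excess quantile risk of a single law -/

/-- The first term is linear in `z - s`, with a slope whose mean vanishes when `s` is the quantile
of an atomless law. The nonnegative remainder lives between `s` and `z` and carries all of the
excess risk. -/
lemma quantileLoss_sub_eq_of_le {α y s z : ℝ} (h : s ≤ z) :
    quantileLoss α y z - quantileLoss α y s =
      (z - s) * (α - (Set.Ioi s).indicator 1 y) + (Set.Ioc s z).indicator (fun y => z - y) y := by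
  have e : ∀ r, quantileLoss α y r = if y ≤ r then α * (r - y) else (1 - α) * (y - r) := by
    intro r
    unfold quantileLoss
    split_ifs with h
    · rw [max_eq_right]; nlinarith
    · rw [max_eq_left]; nlinarith
  rw [e, e]
  simp only [Set.indicator_apply, Set.mem_Ioi, Set.mem_Ioc, Pi.one_apply]
  by_cases h1 : y ≤ s
  · simp only [h1, h1.trans h, not_lt.2 h1, if_true, if_false, false_and]; ring
  · by_cases h2 : y ≤ z
    · simp only [h1, h2, not_le.1 h1, if_true, if_false, true_and]; ring
    · simp only [h1, h2, not_le.1 h1, if_true, if_false, and_false]; ring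

lemma quantileLoss_sub_eq_of_ge {α y s z : ℝ} (h : z ≤ s) :
    quantileLoss α y z - quantileLoss α y s =
      (z - s) * (α - (Set.Ioi s).indicator 1 y) + (Set.Ioc z s).indicator (fun y => y - z) y := by
  have h1 := quantileLoss_sub_eq_of_le (α := α) (y := y) h
  simp only [Set.indicator_apply, Set.mem_Ioi, Set.mem_Ioc, Pi.one_apply] at h1 ⊢
  rw [← neg_sub (quantileLoss α y s), h1]
  by_cases h2 : y ≤ s
  · by_cases h3 : z < y
    · simp only [h2, h3, not_lt.2 h2, and_self, if_true, if_false]; ring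
    · simp only [h3, not_lt.2 h2, if_false, false_and]; ring
  · simp only [h2, not_le.1 h2, h.trans_lt (not_le.1 h2), if_true, if_false, and_false]; ring

lemma abs_quantileLoss_sub_le {α : ℝ} (hα : 0 < α) (hα1 : α < 1) (y s z : ℝ) :
    |quantileLoss α y z - quantileLoss α y s| ≤ |z - s| := by
  unfold quantileLoss
  refine (abs_max_sub_max_le_max _ _ _ _).trans (max_le ?_ ?_)
  · rw [← mul_sub, abs_mul, sub_sub_sub_cancel_left, abs_sub_comm s z,
      abs_of_pos (sub_pos.2 hα1)]
    nlinarith [abs_nonneg (z - s)]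
  · rw [← mul_sub, abs_mul, sub_sub_sub_cancel_right, abs_of_pos hα]
    nlinarith [abs_nonneg (z - s)]

lemma measurable_quantileLoss {Ω : Type*} [MeasurableSpace Ω] {α : ℝ} {Y Z : Ω → ℝ}
    (hY : Measurable Y) (hZ : Measurable Z) : Measurable fun ω => quantileLoss α (Y ω) (Z ω) := by
  unfold quantileLoss
  fun_prop

/-- The quantile is a generalized inverse of the distribution function. -/
lemma lawQuantile_le_iff {p : ℝ} (hp : 0 < p) (hp1 : p < 1) (ν : Measure ℝ)
    [IsProbabilityMeasure ν] (c : ℝ) : lawQuantile p ν ≤ c ↔ p ≤ ν.real (Set.Iic c) := by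
  set U := {s : ℝ | p ≤ ν.real (Set.Iic s)} with hU
  have hne : U.Nonempty := by
    have h := (tendsto_cdf_atTop ν).eventually (lt_mem_nhds hp1)
    obtain ⟨s, hs⟩ := h.exists
    refine ⟨s, ?_⟩
    rw [cdf_eq_real] at hs
    exact hs.le
  have hup : ∀ s ∈ U, ∀ s', s ≤ s' → s' ∈ U := fun s hs s' h =>
    le_trans (α := ℝ) hs (measureReal_mono (Set.Iic_subset_Iic.2 h))
  have hbd : BddBelow U := by
    have h := (tendsto_cdf_atBot ν).eventually (gt_mem_nhds hp)
    obtain ⟨s, hs⟩ := h.exists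
    rw [cdf_eq_real] at hs
    refine ⟨s, fun x hx => ?_⟩
    by_contra hlt
    exact absurd (hup x hx s (not_le.1 hlt).le) (not_le.2 hs)
  constructor
  · intro h
    have hright := (cdf ν).right_continuous c
    have hev : ∀ᶠ x in nhdsWithin c (Set.Ioi c), p ≤ cdf ν x := by
      filter_upwards [self_mem_nhdsWithin] with x hx
      obtain ⟨u, hu, hux⟩ := exists_lt_of_csInf_lt hne (lt_of_le_of_lt h hx)
      rw [cdf_eq_real]
      exact hup u hu x hux.le
    have := ge_of_tendsto (hright.tendsto.mono_left (nhdsWithin_mono c Set.Ioi_subset_Ici_self)) hev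
    rwa [cdf_eq_real] at this
  · exact fun h => csInf_le hbd h

section Law

variable {α D L : ℝ} {ν : Measure ℝ} [IsProbabilityMeasure ν] {f : ℝ → ℝ}

omit [IsProbabilityMeasure ν] in
lemma IsDensityOn.measure_compl (h : IsDensityOn D ν f) : ν (Set.Icc 0 D)ᶜ = 0 := by
  rw [h.eq_withDensity, withDensity_apply _ measurableSet_Icc.compl,
    setLIntegral_eq_zero measurableSet_Icc.compl]
  intro s hs
  simp [h.eq_zero s hs]

omit [IsProbabilityMeasure ν] in
lemma IsDensityOn.noAtoms (h : IsDensityOn D ν f) : NullSingletonClass ν := by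
  rw [h.eq_withDensity]
  infer_instance

omit [IsProbabilityMeasure ν] in
lemma IsDensityOn.real_Ioc_le (hD : 0 < D) (hL : 0 < L) (h : IsDensityOn D ν f)
    (hf : ∀ s ∈ Set.Icc 0 D, f s ≤ L / D) {x y : ℝ} (hxy : x ≤ y) :
    ν.real (Set.Ioc x y) ≤ L / D * (y - x) := by
  have hf' : ∀ s, f s ≤ L / D := fun s => by
    by_cases hs : s ∈ Set.Icc 0 D
    · exact hf s hs
    · rw [h.eq_zero s hs]; positivity
  have h1 : ν (Set.Ioc x y) ≤ ENNReal.ofReal (L / D * (y - x)) := by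
    rw [h.eq_withDensity, withDensity_apply _ measurableSet_Ioc]
    calc ∫⁻ s in Set.Ioc x y, ENNReal.ofReal (f s)
        ≤ ∫⁻ _ in Set.Ioc x y, ENNReal.ofReal (L / D) :=
          lintegral_mono fun s => ENNReal.ofReal_le_ofReal (hf' s)
      _ = ENNReal.ofReal (L / D * (y - x)) := by
          rw [setLIntegral_const, Real.volume_Ioc, ENNReal.ofReal_mul (by positivity)]
  exact ENNReal.toReal_le_of_le_ofReal (mul_nonneg (by positivity) (by linarith)) h1

lemma IsDensityOn.le_real_Ioc (h : IsDensityOn D ν f) {c x y : ℝ} (hc : 0 ≤ c)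
    (hf : ∀ s ∈ Set.Ioc x y, c ≤ f s) : c * (y - x) ≤ ν.real (Set.Ioc x y) := by
  have h1 : ENNReal.ofReal (c * (y - x)) ≤ ν (Set.Ioc x y) := by
    conv_rhs => rw [h.eq_withDensity, withDensity_apply _ measurableSet_Ioc]
    calc ENNReal.ofReal (c * (y - x)) = ∫⁻ _ in Set.Ioc x y, ENNReal.ofReal c := by
          rw [setLIntegral_const, Real.volume_Ioc, ENNReal.ofReal_mul hc]
      _ ≤ ∫⁻ s in Set.Ioc x y, ENNReal.ofReal (f s) :=
          setLIntegral_mono' measurableSet_Ioc fun s hs => ENNReal.ofReal_le_ofReal (hf s hs)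
  exact (ENNReal.ofReal_le_iff_le_toReal (measure_ne_top _ _)).1 h1

lemma real_Iic_sub_real_Iic (ν : Measure ℝ) [IsProbabilityMeasure ν] {x y : ℝ} (hxy : x ≤ y) :
    ν.real (Set.Iic y) - ν.real (Set.Iic x) = ν.real (Set.Ioc x y) := by
  have e : Set.Iic y \ Set.Iic x = Set.Ioc x y := by
    ext z
    simp [and_comm]
  rw [← e, measureReal_sdiff (Set.Iic_subset_Iic.2 hxy) measurableSet_Iic]

lemma IsDensityOn.abs_real_Iic_sub_le (hD : 0 < D) (hL : 0 < L) (h : IsDensityOn D ν f)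
    (hf : ∀ s ∈ Set.Icc 0 D, f s ≤ L / D) (x y : ℝ) :
    |ν.real (Set.Iic x) - ν.real (Set.Iic y)| ≤ L / D * |x - y| := by
  rcases le_total x y with hxy | hxy
  · rw [abs_sub_comm, real_Iic_sub_real_Iic ν hxy, abs_of_nonneg measureReal_nonneg,
      abs_sub_comm, abs_of_nonneg (sub_nonneg.2 hxy)]
    exact h.real_Ioc_le hD hL hf hxy
  · rw [real_Iic_sub_real_Iic ν hxy, abs_of_nonneg measureReal_nonneg,
      abs_of_nonneg (sub_nonneg.2 hxy)]
    exact h.real_Ioc_le hD hL hf hxy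

lemma IsDensityOn.lawQuantile_mem (hα : 0 < α) (hα1 : α < 1)
    (h : IsDensityOn D ν f) : lawQuantile (1 - α) ν ∈ Set.Icc 0 D := by
  have := h.noAtoms
  constructor
  · by_contra hlt
    have h1 := (lawQuantile_le_iff (by linarith) (by linarith) ν _).1
      (le_refl (lawQuantile (1 - α) ν))
    have h2 : ν.real (Set.Iic (lawQuantile (1 - α) ν)) = 0 := by
      apply measureReal_mono_null _ ((measureReal_eq_zero_iff).2 h.measure_compl)
      intro x hx hx'
      exact hlt (hx'.1.trans hx)
    linarith
  · rw [lawQuantile_le_iff (by linarith) (by linarith) ν]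
    have h2 : ν.real (Set.Iic D)ᶜ = 0 := by
      apply measureReal_mono_null _ ((measureReal_eq_zero_iff).2 h.measure_compl)
      exact Set.compl_subset_compl.2 fun x hx => hx.2
    rw [probReal_compl_eq_one_sub measurableSet_Iic] at h2
    linarith

lemma IsDensityOn.real_Iic_lawQuantile (hα : 0 < α) (hα1 : α < 1) (hD : 0 < D) (hL : 0 < L)
    (h : IsDensityOn D ν f) (hf : ∀ s ∈ Set.Icc 0 D, f s ≤ L / D) :
    ν.real (Set.Iic (lawQuantile (1 - α) ν)) = 1 - α := by
  set s := lawQuantile (1 - α) ν with hs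
  have h1 := (lawQuantile_le_iff (by linarith) (by linarith) ν _).1
      (le_refl (lawQuantile (1 - α) ν))
  refine le_antisymm ?_ h1
  by_contra hlt
  push Not at hlt
  set ε := ν.real (Set.Iic s) - (1 - α) with hε
  have hε0 : 0 < ε := by linarith
  have h2 := h.abs_real_Iic_sub_le hD hL hf s (s - ε * D / L)
  have h3 : L / D * |s - (s - ε * D / L)| = ε := by
    rw [sub_sub_cancel, abs_of_pos (by positivity)]
    field_simp
  have h4 : lawQuantile (1 - α) ν ≤ s - ε * D / L := by
    rw [lawQuantile_le_iff (by linarith) (by linarith) ν]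
    have := (abs_le.1 h2).2
    linarith
  have : 0 < ε * D / L := by positivity
  linarith

lemma IsDensityOn.real_Ioi_lawQuantile (hα : 0 < α) (hα1 : α < 1) (hD : 0 < D) (hL : 0 < L)
    (h : IsDensityOn D ν f) (hf : ∀ s ∈ Set.Icc 0 D, f s ≤ L / D) :
    ν.real (Set.Ioi (lawQuantile (1 - α) ν)) = α := by
  rw [← Set.compl_Iic, probReal_compl_eq_one_sub measurableSet_Iic,
    h.real_Iic_lawQuantile hα hα1 hD hL hf]
  ring

lemma integrable_quantileLoss_sub (hα : 0 < α) (hα1 : α < 1) (ν : Measure ℝ)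
    [IsProbabilityMeasure ν] (s z : ℝ) :
    Integrable (fun y => quantileLoss α y z - quantileLoss α y s) ν :=
  Integrable.of_bound ((measurable_quantileLoss measurable_id measurable_const).sub
    (measurable_quantileLoss measurable_id measurable_const)).aestronglyMeasurable |z - s|
    (Filter.Eventually.of_forall fun y => abs_quantileLoss_sub_le hα hα1 y s z)

/-- Both bounds on the excess risk compare the remainder with a constant on a set `A`, from above
and from below. -/
lemma integral_slope_add {s c d : ℝ} {A : Set ℝ} (hA : MeasurableSet A) :
    Integrable (fun y => d * (α - (Set.Ioi s).indicator 1 y) + A.indicator (fun _ => c) y) ν ∧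
    ∫ y, (d * (α - (Set.Ioi s).indicator 1 y) + A.indicator (fun _ => c) y) ∂ν =
      d * (α - ν.real (Set.Ioi s)) + c * ν.real A := by
  have h1 : Integrable ((Set.Ioi s).indicator (1 : ℝ → ℝ)) ν :=
    (integrable_const (1 : ℝ)).indicator measurableSet_Ioi
  have h2 : Integrable (A.indicator (fun _ => c)) ν := (integrable_const c).indicator hA
  have h3 : Integrable (fun y => d * (α - (Set.Ioi s).indicator 1 y)) ν :=
    ((integrable_const α).sub h1).const_mul d
  refine ⟨h3.add h2, ?_⟩
  rw [integral_add h3 h2, integral_const_mul, integral_sub (integrable_const α) h1,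
    integral_indicator_one measurableSet_Ioi, integral_indicator_const c hA]
  simp [mul_comm]

/-- The excess quantile risk is at most quadratic. -/
lemma IsDensityOn.excess_le (hα : 0 < α) (hα1 : α < 1) (hD : 0 < D) (hL : 0 < L)
    (h : IsDensityOn D ν f) (hf : ∀ s ∈ Set.Icc 0 D, f s ≤ L / D) (z : ℝ) :
    ∫ y, (quantileLoss α y z - quantileLoss α y (lawQuantile (1 - α) ν)) ∂ν ≤
      L / D * (z - lawQuantile (1 - α) ν) ^ 2 := by
  have hα' := h.real_Ioi_lawQuantile hα hα1 hD hL hf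
  set s := lawQuantile (1 - α) ν with hs
  rcases le_total s z with hsz | hsz
  · obtain ⟨hi, he⟩ := integral_slope_add (ν := ν) (α := α) (s := s) (c := z - s) (d := z - s)
      (A := Set.Ioc s z) measurableSet_Ioc
    refine (integral_mono (integrable_quantileLoss_sub hα hα1 ν s z) hi fun y => ?_).trans ?_
    · show _ ≤ _
      rw [quantileLoss_sub_eq_of_le hsz]
      refine add_le_add_right ?_ _
      simp only [Set.indicator_apply, Set.mem_Ioc]
      split_ifs with hy
      · linarith [hy.1]
      · exact le_rfl
    · rw [he, hα']
      have := mul_le_mul_of_nonneg_left (h.real_Ioc_le hD hL hf hsz) (sub_nonneg.2 hsz)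
      linarith
  · obtain ⟨hi, he⟩ := integral_slope_add (ν := ν) (α := α) (s := s) (c := s - z) (d := z - s)
      (A := Set.Ioc z s) measurableSet_Ioc
    refine (integral_mono (integrable_quantileLoss_sub hα hα1 ν s z) hi fun y => ?_).trans ?_
    · show _ ≤ _
      rw [quantileLoss_sub_eq_of_ge hsz]
      refine add_le_add_right ?_ _
      simp only [Set.indicator_apply, Set.mem_Ioc]
      split_ifs with hy
      · linarith [hy.2]
      · exact le_rfl
    · rw [he, hα']
      have := mul_le_mul_of_nonneg_left (h.real_Ioc_le hD hL hf hsz) (sub_nonneg.2 hsz)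
      linarith

/-- The excess quantile risk of `z` is at least the mass of a set between the quantile and `z`,
times its distance to `z`. -/
lemma mul_real_le_excess (hα : 0 < α) (hα1 : α < 1) {s z c : ℝ} {A : Set ℝ}
    (hs : ν.real (Set.Ioi s) = α) (hA : MeasurableSet A)
    (hAs : ∀ y ∈ A, (s < y ∧ y ≤ z ∧ c ≤ z - y) ∨ (z < y ∧ y ≤ s ∧ c ≤ y - z)) :
    c * ν.real A ≤ ∫ y, (quantileLoss α y z - quantileLoss α y s) ∂ν := by
  obtain ⟨hi, he⟩ := integral_slope_add (ν := ν) (α := α) (s := s) (c := c) (d := z - s) hA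
  rw [hs, sub_self, mul_zero, zero_add] at he
  rw [← he]
  refine integral_mono hi (integrable_quantileLoss_sub hα hα1 ν s z) fun y => ?_
  show _ ≤ _
  rcases le_total s z with hsz | hsz
  · rw [quantileLoss_sub_eq_of_le hsz]
    refine add_le_add_right ?_ _
    by_cases h1 : y ∈ A
    · rw [Set.indicator_of_mem h1]
      rcases hAs y h1 with h3 | h3
      · rw [Set.indicator_of_mem (Set.mem_Ioc.2 ⟨h3.1, h3.2.1⟩)]
        exact h3.2.2
      · linarith [h3.1, h3.2.1]
    · rw [Set.indicator_of_notMem h1]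
      exact Set.indicator_nonneg (fun y hy => by linarith [hy.2]) y
  · rw [quantileLoss_sub_eq_of_ge hsz]
    refine add_le_add_right ?_ _
    by_cases h1 : y ∈ A
    · rw [Set.indicator_of_mem h1]
      rcases hAs y h1 with h3 | h3
      · linarith [h3.1, h3.2.1]
      · rw [Set.indicator_of_mem (Set.mem_Ioc.2 ⟨h3.1, h3.2.1⟩)]
        exact h3.2.2
    · rw [Set.indicator_of_notMem h1]
      exact Set.indicator_nonneg (fun y hy => by linarith [hy.1]) y

omit [IsProbabilityMeasure ν] in
/-- The margin of a density with a lower bound around a point is at most the length of its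
support. -/
lemma IsDensityOn.margin_le {b q Δ s : ℝ} (hD : 0 < D) (hb : 0 < b) (hΔ : 0 < Δ)
    (h : IsDensityOn D ν f) (hs : s ∈ Set.Icc 0 D)
    (hf : ∀ y ∈ Set.Icc (s - Δ) (s + Δ), 2 * b / D * |2 * (y - s) / D| ^ (q - 2) ≤ f y) :
    Δ ≤ D := by
  by_contra hlt
  have h1 := hf (s + Δ) ⟨by linarith, le_rfl⟩
  rw [h.eq_zero (s + Δ) (fun h => by linarith [h.2, hs.1])] at h1
  have : 0 < 2 * b / D * |2 * (s + Δ - s) / D| ^ (q - 2) := by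
    have : 0 < 2 * (s + Δ - s) / D := by
      rw [add_sub_cancel_left]; positivity
    positivity
  linarith

/-- Self-calibration: a point with small excess quantile risk is close to the quantile. -/
lemma IsDensityOn.le_excess {b q Δ z : ℝ} {f' : ℝ → ℝ} (hα : 0 < α) (hα1 : α < 1) (hD : 0 < D)
    (hL : 0 < L) (hb : 0 < b) (hq : 2 ≤ q) (hΔ : 0 < Δ)
    (h : IsDensityOn D ν f) (hf : ∀ s ∈ Set.Icc 0 D, f s ≤ L / D)
    (h' : IsDensityOn D ν f')
    (hf' : ∀ y ∈ Set.Icc (lawQuantile (1 - α) ν - Δ) (lawQuantile (1 - α) ν + Δ),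
      2 * b / D * |2 * (y - lawQuantile (1 - α) ν) / D| ^ (q - 2) ≤ f' y)
    (hz : |(z - lawQuantile (1 - α) ν) / D| ≤ 2) :
    b * (Δ / D * |(z - lawQuantile (1 - α) ν) / D| / 6) ^ q ≤
      (∫ y, (quantileLoss α y z - quantileLoss α y (lawQuantile (1 - α) ν)) ∂ν) / D := by
  have hα' := h.real_Ioi_lawQuantile hα hα1 hD hL hf
  have hΔD := h'.margin_le hD hb hΔ (h.lawQuantile_mem hα hα1) hf'
  set s := lawQuantile (1 - α) ν with hs
  set x := |(z - s) / D| with hx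
  set δ := Δ / D with hδ
  have hδ0 : 0 < δ := by positivity
  have hδ1 : δ ≤ 1 := (div_le_one hD).2 hΔD
  have hx0 : 0 ≤ x := abs_nonneg _
  rcases hx0.eq_or_lt with hx00 | hxpos
  · have hzs : z = s := by
      have := abs_eq_zero.1 hx00.symm
      rw [div_eq_zero_iff] at this
      rcases this with h | h <;> linarith
    rw [← hx00, hzs]
    simp only [sub_self, integral_zero, zero_div, mul_zero]
    rw [Real.zero_rpow (by linarith), mul_zero]
  set m := min x δ with hm
  have hmx : m ≤ x := min_le_left _ _
  have hmδ : m ≤ δ := min_le_right _ _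
  have hm0 : 0 < m := lt_min hxpos hδ0
  have hDm : D * m ≤ Δ := by
    calc D * m ≤ D * δ := by gcongr
      _ = Δ := by rw [hδ]; field_simp
  -- Points at distance between `w` and `2 * w` from `s` towards `z` lie within the margin, are far
  -- enough from `s` for the density bound, and have distance at least `D * x / 3` to `z`.
  set w := D * m / 3 with hw
  have hw0 : 0 < w := by positivity
  have hxD : |z - s| = x * D := by
    rw [hx, abs_div, abs_of_pos hD]; field_simp
  have hwx : 3 * w ≤ x * D := by rw [hw]; nlinarith
  have hq2 : 0 ≤ q - 2 := by linarith
  have hc0 : 0 ≤ 2 * b / D * (2 * w / D) ^ (q - 2) := by positivity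
  have key : D * x / 3 * (2 * b / D * (2 * w / D) ^ (q - 2) * w) ≤
      ∫ y, (quantileLoss α y z - quantileLoss α y s) ∂ν := by
    rcases le_total s z with hsz | hsz
    · rw [abs_of_nonneg (sub_nonneg.2 hsz)] at hxD
      refine le_trans (mul_le_mul_of_nonneg_left ?_ (by positivity))
        (mul_real_le_excess hα hα1 (A := Set.Ioc (s + w) (s + 2 * w)) hα' measurableSet_Ioc
          fun y hy => Or.inl ⟨by linarith [hy.1], by linarith [hy.2], by linarith [hy.2]⟩)
      have := h'.le_real_Ioc (x := s + w) (y := s + 2 * w) hc0 fun y hy =>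
        le_trans (by
          have h1 : 2 * w / D ≤ |2 * (y - s) / D| := by
            rw [abs_of_nonneg (div_nonneg (by linarith [hy.1]) hD.le)]
            gcongr
            linarith [hy.1]
          gcongr) (hf' y ⟨by linarith [hy.1], by linarith [hy.2]⟩)
      refine le_trans (le_of_eq ?_) this
      ring
    · rw [abs_of_nonpos (sub_nonpos.2 hsz)] at hxD
      refine le_trans (mul_le_mul_of_nonneg_left ?_ (by positivity))
        (mul_real_le_excess hα hα1 (A := Set.Ioc (s - 2 * w) (s - w)) hα' measurableSet_Ioc
          fun y hy => Or.inr ⟨by linarith [hy.1], by linarith [hy.2], by linarith [hy.1]⟩)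
      have := h'.le_real_Ioc (x := s - 2 * w) (y := s - w) hc0 fun y hy =>
        le_trans (by
          have h1 : 2 * w / D ≤ |2 * (y - s) / D| := by
            rw [abs_of_nonpos (div_nonpos_of_nonpos_of_nonneg (by linarith [hy.2]) hD.le),
              ← neg_div]
            gcongr
            linarith [hy.2]
          gcongr) (hf' y ⟨by linarith [hy.1], by linarith [hy.2]⟩)
      refine le_trans (le_of_eq ?_) this
      ring
  rw [le_div_iff₀ hD]
  refine le_trans ?_ key
  have hy0 : 0 ≤ δ * x / 6 := by positivity
  -- With `x ≤ 2` and `δ ≤ 1`, the product `δ * x / 2` lies below both arguments of the minimum.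
  have hym : δ * x / 6 ≤ m / 3 := by
    have : δ * x / 2 ≤ m := le_min (by nlinarith) (by nlinarith)
    linarith
  have hyx : δ * x / 6 ≤ x / 3 := by nlinarith
  have hwD : w / D = m / 3 := by rw [hw]; field_simp
  have h2w : δ * x / 6 ≤ 2 * w / D := by
    have e : 2 * w / D = 2 * (w / D) := mul_div_assoc _ _ _
    rw [e, hwD]; linarith
  have hpow : (δ * x / 6) ^ q = (δ * x / 6) ^ (q - 2) * (δ * x / 6) ^ 2 := by
    have hpos : 0 < δ * x / 6 := by positivity
    rw [← Real.rpow_natCast, ← Real.rpow_add hpos]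
    norm_num
  rw [hpow]
  have e : D * x / 3 * (2 * b / D * (2 * w / D) ^ (q - 2) * w) =
      2 * b * D * ((2 * w / D) ^ (q - 2) * ((x / 3) * (m / 3))) := by
    rw [← hwD]; field_simp
  rw [e]
  have h5 : (δ * x / 6) ^ (q - 2) * (δ * x / 6) ^ 2 ≤
      (2 * w / D) ^ (q - 2) * ((x / 3) * (m / 3)) := by
    rw [pow_two]
    gcongr
  have h6 : 0 ≤ (δ * x / 6) ^ (q - 2) * (δ * x / 6) ^ 2 := by positivity
  have h7 := mul_le_mul_of_nonneg_left h5 (by positivity : (0 : ℝ) ≤ 2 * b * D)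
  have h8 := mul_nonneg (mul_nonneg hb.le hD.le) h6
  linarith

end Law


/-! ### Measurability of the algorithm and of the past -/

section Measurability

variable {Ω : Type*} [m : MeasurableSpace Ω]

lemma measurable_quantileGrad {α : ℝ} {Y Z : Ω → ℝ} (hY : Measurable Y) (hZ : Measurable Z) :
    Measurable fun ω => quantileGrad α (Y ω) (Z ω) := by
  unfold quantileGrad
  exact measurable_const.sub
    (Measurable.ite (measurableSet_lt hZ hY) measurable_const measurable_const)

namespace SAOCP

/-- All components of a random memory are measurable. -/
structure MeasurableState (σ : Ω → State) : Prop where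
  radius : ∀ i, Measurable fun ω => (σ ω).radius i
  gradSq : ∀ i, Measurable fun ω => (σ ω).gradSq i
  gain : ∀ i, Measurable fun ω => (σ ω).gain i
  bet : ∀ i, Measurable fun ω => (σ ω).bet i
  weight : ∀ i, Measurable fun ω => (σ ω).weight i
  last : Measurable fun ω => (σ ω).last

variable {σ : Ω → State} {α D : ℝ} {g t : ℕ}

lemma MeasurableState.spawn (h : MeasurableState σ) (t : ℕ) :
    MeasurableState fun ω => (σ ω).spawn t := by
  have upd : ∀ {a : Ω → ℕ → ℝ} {c : Ω → ℝ}, (∀ i, Measurable fun ω => a ω i) → Measurable c →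
      ∀ i, Measurable fun ω => Function.update (a ω) t (c ω) i := by
    intro a c ha hc i
    by_cases hi : i = t
    · subst hi; simpa using hc
    · simpa [Function.update_of_ne hi] using ha i
  exact ⟨upd h.radius h.last, upd h.gradSq measurable_const, upd h.gain measurable_const,
    upd h.bet measurable_const, upd h.weight measurable_const, h.last⟩

lemma MeasurableState.predict (h : MeasurableState σ) (g t : ℕ) :
    Measurable fun ω => (σ ω).predict g t := by
  have hu : ∀ i, Measurable fun ω => (σ ω).unnormalized g t i := fun i =>
    ((h.weight i).max measurable_const).const_mul _
  have hs : Measurable fun ω => ∑ j ∈ active g t, (σ ω).unnormalized g t j :=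
    Finset.measurable_fun_sum _ fun i _ => hu i
  have hp : ∀ i, Measurable fun ω => (σ ω).prob g t i := fun i =>
    Measurable.ite (measurableSet_lt measurable_const hs) ((hu i).div hs) measurable_const
  unfold State.predict
  split_ifs
  · exact measurable_const
  · exact Finset.measurable_fun_sum _ fun i _ => (hp i).mul (h.radius i)

lemma MeasurableState.finish (h : MeasurableState σ) {S : Ω → ℝ} (hS : Measurable S) (α D : ℝ)
    (g t : ℕ) : MeasurableState fun ω => (σ ω).finish α D g t (S ω) := by
  have hl := fun i => (measurable_quantileLoss (α := α) hS (h.predict g t)).sub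
    (measurable_quantileLoss (α := α) hS (h.radius i))
  have hg : ∀ i, Measurable fun ω => (σ ω).roundGain α D g t (S ω) i := fun i =>
    Measurable.ite (measurableSet_lt measurable_const (h.weight i)) ((hl i).div_const D)
      (((hl i).max measurable_const).div_const D)
  have hd := fun i => measurable_quantileGrad (α := α) hS (h.radius i)
  have h2 := fun i => (h.gradSq i).add ((hd i).pow_const 2)
  have h3 := fun i => (h.gain i).add (hg i)
  have h4 := fun i => (h.bet i).add ((h.weight i).mul (hg i))
  refine ⟨fun i => ?_, fun i => ?_, fun i => ?_, fun i => ?_, fun i => ?_, h.predict g t⟩ <;>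
    simp only [State.finish] <;> split_ifs
  · exact (h.radius i).sub (((hd i).div (h2 i).sqrt).const_mul _)
  · exact h.radius i
  · exact h2 i
  · exact h.gradSq i
  · exact h3 i
  · exact h.gain i
  · exact h4 i
  · exact h.bet i
  · exact ((h3 i).div_const _).mul ((h4 i).const_add 1)
  · exact h.weight i

lemma measurableState_stateAfter (α D : ℝ) (g : ℕ) {S : ℕ → Ω → ℝ} (n : ℕ)
    (hS : ∀ i, 1 ≤ i → i ≤ n → Measurable (S i)) :
    MeasurableState fun ω => stateAfter α D g (fun i => S i ω) n := by
  induction n with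
  | zero =>
    exact ⟨fun _ => measurable_const, fun _ => measurable_const, fun _ => measurable_const,
      fun _ => measurable_const, fun _ => measurable_const, measurable_const⟩
  | succ n ih =>
    exact ((ih fun i h1 h2 => hS i h1 (h2.trans n.le_succ)).spawn (n + 1)).finish
      (hS (n + 1) (by omega) le_rfl) α D g (n + 1)

end SAOCP

lemma measurable_predictedRadius (α D : ℝ) (g : ℕ) {S : ℕ → Ω → ℝ} {t : ℕ}
    (hS : ∀ i, 1 ≤ i → i < t → Measurable (S i)) : Measurable (predictedRadius α D g S t) :=
  ((SAOCP.measurableState_stateAfter α D g (t - 1)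
    fun i h1 h2 => hS i h1 (by omega)).spawn t).predict g t

end Measurability

section Past

variable {Ω : Type*} [MeasurableSpace Ω] {𝒳 : Type*} [MeasurableSpace 𝒳] {α D : ℝ} {g : ℕ}
  {X : ℕ → Ω → 𝒳} {S : ℕ → Ω → ℝ}

lemma pastSigma_le (hX : ∀ t, Measurable (X t)) (hS : ∀ t, Measurable (S t)) (t : ℕ) :
    pastSigma α D g X S t ≤ ‹MeasurableSpace Ω› := by
  refine sup_le (iSup₂_le fun i _ => sup_le (sup_le ?_ ?_) ?_) ?_
  · exact (hX i).comap_le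
  · exact (measurable_predictedRadius α D g fun i _ _ => hS i).comap_le
  · exact (hS i).comap_le
  · exact (hX t).comap_le

-- The current input `X τ` in the smaller σ-algebra is among the past data of the larger one when `τ
-- < t`; this is where `1 ≤ τ` matters.
omit [MeasurableSpace Ω] in
lemma pastSigma_mono {τ t : ℕ} (hτ : 1 ≤ τ) (h : τ ≤ t) :
    pastSigma α D g X S τ ≤ pastSigma α D g X S t := by
  rcases h.eq_or_lt with rfl | hlt
  · exact le_rfl
  · refine sup_le (iSup₂_le fun i hi => ?_) ?_
    · exact le_sup_of_le_left (le_iSup₂_of_le (f := fun i _ =>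
        MeasurableSpace.comap (X i) inferInstance ⊔
        MeasurableSpace.comap (predictedRadius α D g S i) inferInstance ⊔
        MeasurableSpace.comap (S i) inferInstance) i ⟨hi.1, hi.2.trans hlt⟩ le_rfl)
    · exact le_sup_of_le_left (le_iSup₂_of_le (f := fun i _ =>
        MeasurableSpace.comap (X i) inferInstance ⊔
        MeasurableSpace.comap (predictedRadius α D g S i) inferInstance ⊔
        MeasurableSpace.comap (S i) inferInstance) τ ⟨hτ, hlt⟩
        (le_sup_of_le_left le_sup_left))

omit [MeasurableSpace Ω] in
lemma measurable_past_radius {i t : ℕ} (h1 : 1 ≤ i) (hi : i < t) :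
    Measurable[pastSigma α D g X S t] (S i) := by
  refine Measurable.of_comap_le (le_sup_of_le_left (le_iSup₂_of_le (f := fun i _ =>
        MeasurableSpace.comap (X i) inferInstance ⊔
        MeasurableSpace.comap (predictedRadius α D g S i) inferInstance ⊔
        MeasurableSpace.comap (S i) inferInstance) i ⟨h1, hi⟩ le_sup_right))

omit [MeasurableSpace Ω] in
lemma measurable_past_predictedRadius (t : ℕ) :
    Measurable[pastSigma α D g X S t] (predictedRadius α D g S t) :=
  measurable_predictedRadius (m := pastSigma α D g X S t) α D g
    fun _ h1 h2 => measurable_past_radius h1 h2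

end Past

/-! ### Integration with respect to conditional laws -/

section CondLaw

variable {Ω : Type*} {m mΩ : MeasurableSpace Ω} {μ : Measure Ω} [IsProbabilityMeasure μ]
  {Z : Ω → ℝ}

instance (ω : Ω) : IsProbabilityMeasure (condLaw μ m Z ω) := by
  unfold condLaw
  infer_instance

lemma measurable_condLaw (A : Set ℝ) (hA : MeasurableSet A) :
    Measurable[m] fun ω => condLaw μ m Z ω A :=
  Kernel.measurable_coe (@condDistrib Ω Ω ℝ _ _ _ _ m Z id μ _) hA

lemma measurable_condLaw_real (A : Set ℝ) (hA : MeasurableSet A) :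
    Measurable[m] fun ω => (condLaw μ m Z ω).real A :=
  (measurable_condLaw A hA).ennreal_toReal

/-- By `lawQuantile_le_iff` the sublevel sets are superlevel sets of the conditional distribution
function. -/
lemma measurable_lawQuantile_condLaw {p : ℝ} (hp : 0 < p) (hp1 : p < 1) :
    Measurable[m] fun ω => lawQuantile p (condLaw μ m Z ω) := by
  refine measurable_of_Iic (mδ := m) fun c => ?_
  have : (fun ω => lawQuantile p (condLaw μ m Z ω)) ⁻¹' Set.Iic c =
      {ω | p ≤ (condLaw μ m Z ω).real (Set.Iic c)} := by
    ext ω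
    exact lawQuantile_le_iff hp hp1 _ c
  rw [this]
  exact measurableSet_le (mδ := m) measurable_const
    (measurable_condLaw_real _ measurableSet_Iic)

/-- Integrals of functions of `Z` and of quantities known under `m`. -/
lemma integral_condLaw (hm : m ≤ mΩ) (hZ : Measurable Z) {φ : Ω × ℝ → ℝ}
    (hφ : @Measurable _ _ (m.prod inferInstance) _ φ) (hi : Integrable (fun ω => φ (ω, Z ω)) μ) :
    Integrable (fun ω => ∫ y, φ (ω, y) ∂condLaw μ m Z ω) μ ∧
    ∫ ω, φ (ω, Z ω) ∂μ = ∫ ω, ∫ y, φ (ω, y) ∂condLaw μ m Z ω ∂μ := by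
  have hid : @Measurable Ω Ω mΩ m id := measurable_id'' hm
  -- Conditioning on `m` means conditioning on the identity as a map into `Ω` with the coarser
  -- σ-algebra.
  have h := condExp_prod_ae_eq_integral_condDistrib (mβ := m) (X := id) (f := φ) hid
    hZ.aemeasurable hφ.stronglyMeasurable hi
  rw [MeasurableSpace.comap_id] at h
  refine ⟨(integrable_condExp (m := m)).congr h, ?_⟩
  rw [← integral_condExp hm]
  exact integral_congr_ae h

lemma measureReal_condLaw (hm : m ≤ mΩ) (hZ : Measurable Z) {V : Ω → ℝ}
    (hV : Measurable[m] V) :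
    Integrable (fun ω => (condLaw μ m Z ω).real (Set.Iic (V ω))) μ ∧
    μ.real {ω | Z ω ≤ V ω} = ∫ ω, (condLaw μ m Z ω).real (Set.Iic (V ω)) ∂μ := by
  have hmeas : MeasurableSet {ω | Z ω ≤ V ω} := measurableSet_le hZ (hV.mono hm le_rfl)
  have hA : @MeasurableSet _ (m.prod inferInstance) {x : Ω × ℝ | x.2 ≤ V x.1} :=
    measurableSet_le (mδ := m.prod inferInstance) (@measurable_snd _ _ m _)
      (hV.comp (@measurable_fst _ _ m _))
  have h := integral_condLaw (μ := μ) hm hZ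
    (φ := {x : Ω × ℝ | x.2 ≤ V x.1}.indicator 1)
    (Measurable.indicator (m := m.prod inferInstance) (measurable_const (a := (1 : ℝ))) hA)
    ((integrable_indicator_iff hmeas).2 (integrable_const (1 : ℝ)).integrableOn)
  have e : ∀ ω, ∫ y, {x : Ω × ℝ | x.2 ≤ V x.1}.indicator (1 : Ω × ℝ → ℝ) (ω, y)
      ∂condLaw μ m Z ω = (condLaw μ m Z ω).real (Set.Iic (V ω)) := fun ω =>
    integral_indicator_one (s := Set.Iic (V ω)) measurableSet_Iic
  simp only [e] at h
  refine ⟨h.1, ?_⟩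
  rw [← h.2]
  exact (integral_indicator_one hmeas).symm

lemma ae_mem_of_condLaw (hm : m ≤ mΩ) (hZ : Measurable Z) (A : Set (Ω × ℝ))
    (hA : @MeasurableSet _ (m.prod inferInstance) A)
    (h : ∀ᵐ ω ∂μ, condLaw μ m Z ω {y | (ω, y) ∈ A} = 0) : ∀ᵐ ω ∂μ, (ω, Z ω) ∉ A := by
  have hmeas : MeasurableSet {ω | (ω, Z ω) ∈ A} :=
    hA.preimage ((measurable_id'' hm).prodMk hZ)
  have hA' : ∀ ω, MeasurableSet {y : ℝ | (ω, y) ∈ A} := fun ω =>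
    hA.preimage (@measurable_prodMk_left _ _ m _ ω)
  have h1 := integral_condLaw (μ := μ) hm hZ (φ := A.indicator 1)
    (Measurable.indicator (m := m.prod inferInstance) (measurable_const (a := (1 : ℝ))) hA)
    ((integrable_indicator_iff hmeas).2 (integrable_const (1 : ℝ)).integrableOn)
  have e : ∀ ω, ∫ y, A.indicator (1 : Ω × ℝ → ℝ) (ω, y) ∂condLaw μ m Z ω =
      (condLaw μ m Z ω).real {y | (ω, y) ∈ A} := fun ω => integral_indicator_one (hA' ω)
  have e2 : ∫ ω, A.indicator (1 : Ω × ℝ → ℝ) (ω, Z ω) ∂μ = μ.real {ω | (ω, Z ω) ∈ A} :=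
    integral_indicator_one hmeas
  simp only [e] at h1
  rw [e2] at h1
  rw [ae_iff]
  simp only [not_not]
  rw [← measureReal_eq_zero_iff, h1.2]
  apply integral_eq_zero_of_ae
  filter_upwards [h] with ω hω
  simp [Measure.real, hω]

end CondLaw


/-! ### One round in expectation -/

section Step

variable {Ω : Type*} {m mΩ : MeasurableSpace Ω} {μ : Measure Ω} [IsProbabilityMeasure μ]
  {Z V : Ω → ℝ} {α D L : ℝ}

lemma measurable_excess (hα : 0 < α) (hα1 : α < 1) (hV : Measurable[m] V) :
    @Measurable _ _ (m.prod inferInstance) _ (fun x : Ω × ℝ =>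
      quantileLoss α x.2 (V x.1) - quantileLoss α x.2 (lawQuantile (1 - α) (condLaw μ m Z x.1))) := by
  have h1 : @Measurable (Ω × ℝ) Ω (m.prod inferInstance) m Prod.fst := @measurable_fst _ _ m _
  have h2 : @Measurable (Ω × ℝ) ℝ (m.prod inferInstance) _ Prod.snd := @measurable_snd _ _ m _
  have hQ : Measurable[m] fun ω => lawQuantile (1 - α) (condLaw μ m Z ω) :=
    measurable_lawQuantile_condLaw (by linarith) (by linarith)
  have h3 : @Measurable (Ω × ℝ) ℝ (m.prod inferInstance) _ fun x => V x.1 := hV.comp h1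
  have h4 : @Measurable (Ω × ℝ) ℝ (m.prod inferInstance) _
    fun x => lawQuantile (1 - α) (condLaw μ m Z x.1) := hQ.comp h1
  exact (@measurable_quantileLoss _ (m.prod inferInstance) α _ _ h2 h3).sub
    (@measurable_quantileLoss _ (m.prod inferInstance) α _ _ h2 h4)

lemma integrable_excess (hα : 0 < α) (hα1 : α < 1) (hm : m ≤ mΩ) (hZ : Measurable Z)
    (hV : Measurable[m] V) {B : ℝ}
    (hVQ : ∀ᵐ ω ∂μ, |V ω - lawQuantile (1 - α) (condLaw μ m Z ω)| ≤ B) :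
    Integrable (fun ω => quantileLoss α (Z ω) (V ω) -
      quantileLoss α (Z ω) (lawQuantile (1 - α) (condLaw μ m Z ω))) μ := by
  refine Integrable.of_bound ?_ B ?_
  · exact ((measurable_excess (μ := μ) (Z := Z) hα hα1 hV).comp
      ((measurable_id'' hm).prodMk hZ)).aestronglyMeasurable
  · filter_upwards [hVQ] with ω hω
    exact (abs_quantileLoss_sub_le hα hα1 _ _ _).trans hω

lemma integrable_dist_quantile (hα : 0 < α) (hα1 : α < 1) (hm : m ≤ mΩ)
    (hV : Measurable[m] V) {B : ℝ}
    (hVQ : ∀ᵐ ω ∂μ, |V ω - lawQuantile (1 - α) (condLaw μ m Z ω)| ≤ B) {φ : ℝ → ℝ}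
    (hφ : Continuous φ) :
    Integrable (fun ω => φ (V ω - lawQuantile (1 - α) (condLaw μ m Z ω))) μ := by
  have hQ : Measurable fun ω => lawQuantile (1 - α) (condLaw μ m Z ω) :=
    (measurable_lawQuantile_condLaw (by linarith) (by linarith)).mono hm le_rfl
  obtain ⟨C, hC⟩ := (isCompact_Icc (a := -B) (b := B)).exists_bound_of_continuousOn
    hφ.continuousOn
  refine Integrable.of_bound
    (hφ.measurable.comp ((hV.mono hm le_rfl).sub hQ)).aestronglyMeasurable C ?_
  filter_upwards [hVQ] with ω hω
  exact hC _ (abs_le.1 hω)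

/-- The expected excess quantile risk is at most quadratic. -/
lemma integral_excess_le (hα : 0 < α) (hα1 : α < 1) (hD : 0 < D) (hL : 0 < L) (hm : m ≤ mΩ)
    (hZ : Measurable Z) (hV : Measurable[m] V) {B : ℝ}
    (hVQ : ∀ᵐ ω ∂μ, |V ω - lawQuantile (1 - α) (condLaw μ m Z ω)| ≤ B)
    (hup : ∀ᵐ ω ∂μ, ∃ f : ℝ → ℝ, IsDensityOn D (condLaw μ m Z ω) f ∧
      ∀ s ∈ Set.Icc 0 D, f s ≤ L / D) :
    ∫ ω, (quantileLoss α (Z ω) (V ω) -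
      quantileLoss α (Z ω) (lawQuantile (1 - α) (condLaw μ m Z ω))) ∂μ ≤
      L / D * ∫ ω, (V ω - lawQuantile (1 - α) (condLaw μ m Z ω)) ^ 2 ∂μ := by
  obtain ⟨h1, h2⟩ := integral_condLaw hm hZ (measurable_excess (μ := μ) (Z := Z) hα hα1 hV)
    (integrable_excess hα hα1 hm hZ hV hVQ)
  rw [h2, ← integral_const_mul]
  refine integral_mono_ae h1 ((integrable_dist_quantile hα hα1 hm hV hVQ
    (φ := fun x => x ^ 2) (by fun_prop)).const_mul _) ?_
  filter_upwards [hup] with ω ⟨f, hf, hfL⟩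
  exact hf.excess_le hα hα1 hD hL hfL (V ω)

/-- Self-calibration in expectation. -/
lemma le_integral_excess {b q Δ δ : ℝ} (hα : 0 < α) (hα1 : α < 1) (hD : 0 < D) (hL : 0 < L)
    (hb : 0 < b) (hq : 2 ≤ q) (hΔ : 0 < Δ) (hδ : 0 ≤ δ) (hδΔ : δ ≤ Δ / D) (hm : m ≤ mΩ)
    (hZ : Measurable Z) (hV : Measurable[m] V)
    (hVQ : ∀ᵐ ω ∂μ, |V ω - lawQuantile (1 - α) (condLaw μ m Z ω)| ≤ 2 * D)
    (hup : ∀ᵐ ω ∂μ, ∃ f : ℝ → ℝ, IsDensityOn D (condLaw μ m Z ω) f ∧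
      ∀ s ∈ Set.Icc 0 D, f s ≤ L / D)
    (hlow : ∀ᵐ ω ∂μ, ∃ f : ℝ → ℝ, IsDensityOn D (condLaw μ m Z ω) f ∧
      ∀ s ∈ Set.Icc (lawQuantile (1 - α) (condLaw μ m Z ω) - Δ)
        (lawQuantile (1 - α) (condLaw μ m Z ω) + Δ),
        2 * b / D * |2 * (s - lawQuantile (1 - α) (condLaw μ m Z ω)) / D| ^ (q - 2) ≤ f s) :
    b * (δ * (∫ ω, |(V ω - lawQuantile (1 - α) (condLaw μ m Z ω)) / D| ∂μ) / 6) ^ q ≤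
      (∫ ω, (quantileLoss α (Z ω) (V ω) -
        quantileLoss α (Z ω) (lawQuantile (1 - α) (condLaw μ m Z ω))) ∂μ) / D := by
  obtain ⟨h1, h2⟩ := integral_condLaw hm hZ (measurable_excess (μ := μ) (Z := Z) hα hα1 hV)
    (integrable_excess hα hα1 hm hZ hV hVQ)
  have hq0 : 0 ≤ q := by linarith
  have hi := integrable_dist_quantile hα hα1 hm hV hVQ
    (φ := fun x => (δ * |x / D| / 6)) (by fun_prop)
  have hc : Continuous fun x : ℝ => (δ * |x / D| / 6) ^ q :=
    Continuous.rpow_const (by fun_prop) fun _ => Or.inr hq0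
  have hi2 := integrable_dist_quantile hα hα1 hm hV hVQ hc
  -- Jensen takes the `q`-th power out of the expectation, so that only the mean distance remains.
  have hjensen := (convexOn_rpow (p := q) (by linarith)).map_integral_le (μ := μ)
    (Real.continuous_rpow_const hq0).continuousOn isClosed_Ici
    (Filter.Eventually.of_forall fun ω => by
      show (0 : ℝ) ≤ δ * |(V ω - lawQuantile (1 - α) (condLaw μ m Z ω)) / D| / 6
      positivity) hi hi2
  rw [integral_div, integral_const_mul] at hjensen
  refine (mul_le_mul_of_nonneg_left hjensen hb.le).trans ?_
  rw [h2, ← integral_const_mul, ← integral_div]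
  refine integral_mono_ae (hi2.const_mul b) (h1.div_const D) ?_
  filter_upwards [hup, hlow, hVQ] with ω ⟨f, hf, hfL⟩ ⟨f', hf', hfl⟩ hω
  refine le_trans ?_ (hf.le_excess (z := V ω) hα hα1 hD hL hb hq hΔ hfL hf' hfl ?_)
  · gcongr
  · rwa [abs_div, abs_of_pos hD, div_le_iff₀ hD]

/-- The coverage error is at most the expected distance to the quantile. -/
lemma abs_measureReal_sub_le (hα : 0 < α) (hα1 : α < 1) (hD : 0 < D) (hL : 0 < L) (hm : m ≤ mΩ)
    (hZ : Measurable Z) (hV : Measurable[m] V) {B : ℝ}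
    (hVQ : ∀ᵐ ω ∂μ, |V ω - lawQuantile (1 - α) (condLaw μ m Z ω)| ≤ B)
    (hup : ∀ᵐ ω ∂μ, ∃ f : ℝ → ℝ, IsDensityOn D (condLaw μ m Z ω) f ∧
      ∀ s ∈ Set.Icc 0 D, f s ≤ L / D) :
    |μ.real {ω | Z ω ≤ V ω} - (1 - α)| ≤
      L * ∫ ω, |(V ω - lawQuantile (1 - α) (condLaw μ m Z ω)) / D| ∂μ := by
  obtain ⟨h1, h2⟩ := measureReal_condLaw (μ := μ) hm hZ hV
  have h3 : (1 - α) = ∫ _, (1 - α) ∂μ := by simp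
  rw [h2]
  nth_rewrite 1 [h3]
  rw [← integral_sub h1 (integrable_const _), ← integral_const_mul]
  refine (abs_integral_le_integral_abs).trans ?_
  have hi := integrable_dist_quantile hα hα1 hm hV hVQ (φ := fun x => L * |x / D|) (by fun_prop)
  refine integral_mono_ae (h1.sub (integrable_const _)).abs hi ?_
  filter_upwards [hup] with ω ⟨f, hf, hfL⟩
  have := hf.abs_real_Iic_sub_le hD hL hfL (V ω) (lawQuantile (1 - α) (condLaw μ m Z ω))
  rw [hf.real_Iic_lawQuantile hα hα1 hD hL hfL] at this
  refine this.trans (le_of_eq ?_)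
  rw [abs_div, abs_of_pos hD]
  ring

/-- A conditional density leaves no mass on a point known in advance. Ties matter because the
infimum that defines `S t` need not be attained. -/
lemma ae_ne_of_condLaw (hm : m ≤ mΩ) (hZ : Measurable Z) (hV : Measurable[m] V)
    (hup : ∀ᵐ ω ∂μ, ∃ f : ℝ → ℝ, IsDensityOn D (condLaw μ m Z ω) f) :
    ∀ᵐ ω ∂μ, Z ω ≠ V ω := by
  refine ae_mem_of_condLaw hm hZ {x : Ω × ℝ | x.2 = V x.1} ?_ ?_
  · exact measurableSet_eq_fun (m := m.prod inferInstance) (@measurable_snd _ _ m _)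
      (hV.comp (@measurable_fst _ _ m _))
  · filter_upwards [hup] with ω ⟨f, hf⟩
    have := hf.noAtoms
    exact measure_singleton (V ω)

lemma ae_mem_Icc_of_condLaw (hm : m ≤ mΩ) (hZ : Measurable Z)
    (hup : ∀ᵐ ω ∂μ, ∃ f : ℝ → ℝ, IsDensityOn D (condLaw μ m Z ω) f) :
    ∀ᵐ ω ∂μ, Z ω ∈ Set.Icc 0 D := by
  have := ae_mem_of_condLaw (μ := μ) hm hZ {x : Ω × ℝ | x.2 ∈ (Set.Icc 0 D)ᶜ}
    (measurableSet_Icc.compl.preimage (@measurable_snd _ _ m _)) (by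
      filter_upwards [hup] with ω ⟨f, hf⟩
      exact hf.measure_compl)
  filter_upwards [this] with ω hω
  by_contra h
  exact hω h

end Step

/-- From a bound on a sum of `q`-th powers to a bound on the mean. -/
lemma mean_le_of_sum_rpow_le {τ k : ℕ} (hk : 1 ≤ k) {A : ℕ → ℝ} (hA : ∀ t, 0 ≤ A t)
    {b q δ K L l v : ℝ} (hb : 0 < b) (hq : 2 ≤ q) (hδ : 0 < δ) (hK : 1 ≤ K) (hL : 0 < L)
    (hl : 0 ≤ l) (hv : 0 ≤ v)
    (h : ∑ t ∈ Finset.Icc τ (τ + k - 1), b * (δ * A t / 6) ^ q ≤ K * √(k * l) + L * v) :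
    1 / (k : ℝ) * ∑ t ∈ Finset.Icc τ (τ + k - 1), A t ≤
      6 * K * (1 / b ^ (1 / q) * (1 / δ) * (l / k) ^ (1 / (2 * q))) +
      6 * K * (L ^ (1 / q) / b ^ (1 / q) * (1 / δ) * (v / k) ^ (1 / q)) := by
  have hk0 : (0 : ℝ) < k := by exact_mod_cast hk
  have hq0 : 0 < q := by linarith
  set I := Finset.Icc τ (τ + k - 1) with hI
  have hcard : (I.card : ℝ) = k := by
    rw [hI, Nat.card_Icc]
    congr 1
    omega
  set M := 1 / (k : ℝ) * ∑ t ∈ I, A t with hM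
  have hM0 : 0 ≤ M := mul_nonneg (by positivity) (Finset.sum_nonneg fun t _ => hA t)
  -- A second use of convexity, now over the rounds of the interval.
  have hmean := Real.rpow_arith_mean_le_arith_mean_rpow I (fun _ => 1 / (k : ℝ))
    (fun t => δ * A t / 6) (fun _ _ => by positivity)
    (by rw [Finset.sum_const, nsmul_eq_mul, hcard]; field_simp)
    (fun t _ => by have := hA t; positivity) (by linarith : 1 ≤ q)
  have e1 : ∑ t ∈ I, 1 / (k : ℝ) * (δ * A t / 6) = δ * M / 6 := by
    rw [hM, Finset.mul_sum, Finset.mul_sum, Finset.sum_div]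
    exact Finset.sum_congr rfl fun t _ => by ring
  rw [e1, ← Finset.mul_sum] at hmean
  rw [← Finset.mul_sum] at h
  have h1 : (δ * M / 6) ^ q ≤ (K * √(l / k) + L * (v / k)) / b := by
    refine hmean.trans ?_
    rw [le_div_iff₀ hb]
    have e2 : √(l / k) = √(k * l) / k := by
      rw [show l / k = k * l / k ^ 2 by field_simp, Real.sqrt_div (by positivity),
        Real.sqrt_sq hk0.le]
    rw [e2]
    have := mul_le_mul_of_nonneg_left h (by positivity : 0 ≤ 1 / (k : ℝ))
    refine le_trans (le_of_eq ?_) (this.trans (le_of_eq ?_)) <;> ring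
  have h2 : δ * M / 6 ≤ ((K * √(l / k) + L * (v / k)) / b) ^ (1 / q) := by
    have hn : 0 ≤ δ * M / 6 := by positivity
    have := Real.rpow_le_rpow (by positivity) h1 (by positivity : 0 ≤ 1 / q)
    rwa [← Real.rpow_mul hn, mul_one_div_cancel hq0.ne', Real.rpow_one] at this
  have hq1 : 1 / q ≤ 1 := by rw [div_le_one hq0]; linarith
  have h3 : ((K * √(l / k) + L * (v / k)) / b) ^ (1 / q) ≤
      (K * (l / k) ^ (1 / (2 * q)) + K * (L ^ (1 / q) * (v / k) ^ (1 / q))) / b ^ (1 / q) := by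
    rw [Real.div_rpow (by positivity) hb.le]
    gcongr
    -- Subadditivity of the `1 / q`-th power separates the two terms; the square root of the regret
    -- halves its exponent to `1 / (2 * q)`.
    refine (Real.rpow_add_le_add_rpow (by positivity) (by positivity) (by positivity) hq1).trans ?_
    rw [Real.mul_rpow (by positivity) (by positivity), Real.mul_rpow hL.le (by positivity),
      Real.sqrt_eq_rpow, ← Real.rpow_mul (by positivity),
      show (1 / 2 : ℝ) * (1 / q) = 1 / (2 * q) by field_simp]
    have hK' : K ^ (1 / q) ≤ K := by
      calc K ^ (1 / q) ≤ K ^ (1 : ℝ) := Real.rpow_le_rpow_of_exponent_le hK hq1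
        _ = K := Real.rpow_one K
    have hX : 0 ≤ L ^ (1 / q) * (v / k) ^ (1 / q) := by positivity
    exact add_le_add (mul_le_mul_of_nonneg_right hK' (by positivity))
      (le_mul_of_one_le_left hX hK)
  have h4 := h2.trans h3
  have h5 : M ≤ 6 / δ * ((K * (l / k) ^ (1 / (2 * q)) +
      K * (L ^ (1 / q) * (v / k) ^ (1 / q))) / b ^ (1 / q)) := by
    calc M = 6 / δ * (δ * M / 6) := by field_simp
      _ ≤ _ := mul_le_mul_of_nonneg_left h4 (by positivity)
  refine h5.trans (le_of_eq ?_)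
  ring


/-! ### The algorithm on an interval: distance and coverage -/

section Setting

variable {Ω : Type*} [MeasurableSpace Ω] {μ : Measure Ω} [IsProbabilityMeasure μ]
  {𝒳 : Type*} [MeasurableSpace 𝒳] {X : ℕ → Ω → 𝒳} {S : ℕ → Ω → ℝ}
  {α D L b q : ℝ} {Δ : ℕ → ℝ} {g T : ℕ}

lemma measurable_trueQuantile (hα : 0 < α) (hα1 : α < 1) (t : ℕ) :
    Measurable[pastSigma α D g X S t] (trueQuantile μ α D g X S t) :=
  measurable_lawQuantile_condLaw (by linarith) (by linarith)

lemma DensityUpperBound.ae_radius_mem (hX : ∀ t, Measurable (X t)) (hS : ∀ t, Measurable (S t))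
    (h : DensityUpperBound μ α D g T X S L) :
    ∀ᵐ ω ∂μ, ∀ t, 1 ≤ t → t ≤ T → S t ω ∈ Set.Icc 0 D := by
  refine ae_all_iff.2 fun t => Filter.eventually_imp_distrib_left.2 fun h1 =>
    Filter.eventually_imp_distrib_left.2 fun h2 => ?_
  refine ae_mem_Icc_of_condLaw (pastSigma_le (α := α) (D := D) (g := g) hX hS t) (hS t) ?_
  filter_upwards [h t ⟨h1, h2⟩] with ω ⟨f, hf, _⟩
  exact ⟨f, hf⟩

lemma DensityUpperBound.ae_trueQuantile_mem (hα : 0 < α) (hα1 : α < 1)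
    (h : DensityUpperBound μ α D g T X S L) {t : ℕ} (h1 : 1 ≤ t) (h2 : t ≤ T) :
    ∀ᵐ ω ∂μ, trueQuantile μ α D g X S t ω ∈ Set.Icc 0 D := by
  filter_upwards [h t ⟨h1, h2⟩] with ω ⟨f, hf, _⟩
  exact IsDensityOn.lawQuantile_mem (ν := condLaw μ (pastSigma α D g X S t) (S t) ω) hα hα1 hf

lemma DensityUpperBound.ae_abs_sub_trueQuantile_le (hα : 0 < α) (hα1 : α < 1) (hD : 0 < D)
    (hg : 1 ≤ g) (hX : ∀ t, Measurable (X t)) (hS : ∀ t, Measurable (S t))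
    (h : DensityUpperBound μ α D g T X S L) {t : ℕ} (h1 : 1 ≤ t) (h2 : t ≤ T) :
    ∀ᵐ ω ∂μ, |predictedRadius α D g S t ω - trueQuantile μ α D g X S t ω| ≤ 2 * D := by
  filter_upwards [h.ae_radius_mem hX hS, h.ae_trueQuantile_mem hα hα1 h1 h2] with ω hω hQ
  obtain ⟨h3, h4⟩ := SAOCP.radius_mem hα hα1 hD hg hω h1 h2
  have h5 := SAOCP.rate_lt
  rw [le_div_iff₀ hD] at h3
  rw [div_le_iff₀ hD] at h4
  unfold predictedRadius
  rw [abs_le]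
  constructor <;> nlinarith [hQ.1, hQ.2]

/-- The mean over `I` of the expected quantiles given the past of the first round of `I`. -/
noncomputable def meanQuantile (μ : Measure Ω) [IsFiniteMeasure μ] (α D : ℝ) (g : ℕ)
    (X : ℕ → Ω → 𝒳) (S : ℕ → Ω → ℝ) (τ k : ℕ) (ω : Ω) : ℝ :=
  1 / (k : ℝ) * ∑ i ∈ Finset.Icc τ (τ + k - 1),
    (μ[trueQuantile μ α D g X S i | pastSigma α D g X S τ]) ω

lemma measurable_meanQuantile (τ k : ℕ) :
    Measurable[pastSigma α D g X S τ] (meanQuantile μ α D g X S τ k) :=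
  (Finset.measurable_fun_sum _ fun _ _ => stronglyMeasurable_condExp.measurable).const_mul _

/-- The regret bound needs a comparator in `[0, D]`; conditional expectation and averaging preserve
this range. -/
lemma DensityUpperBound.ae_meanQuantile_mem (hα : 0 < α) (hα1 : α < 1)
    (hX : ∀ t, Measurable (X t)) (hS : ∀ t, Measurable (S t))
    (h : DensityUpperBound μ α D g T X S L) {τ k : ℕ} (hτ : 1 ≤ τ) (hk : 1 ≤ k)
    (hτk : τ + k - 1 ≤ T) :
    ∀ᵐ ω ∂μ, meanQuantile μ α D g X S τ k ω ∈ Set.Icc 0 D := by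
  have hm := pastSigma_le (α := α) (D := D) (g := g) hX hS
  have hk0 : (0 : ℝ) < k := by exact_mod_cast hk
  have hmem : ∀ᵐ ω ∂μ, ∀ i ∈ Finset.Icc τ (τ + k - 1),
      (μ[trueQuantile μ α D g X S i | pastSigma α D g X S τ]) ω ∈ Set.Icc 0 D := by
    refine (ae_ball_iff (Finset.countable_toSet _)).2 fun i hi => ?_
    have hi' := Finset.mem_Icc.1 hi
    have hQ := h.ae_trueQuantile_mem hα hα1 (hτ.trans hi'.1) (hi'.2.trans hτk)
    have hint : Integrable (trueQuantile μ α D g X S i) μ := by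
      refine Integrable.of_bound
        ((measurable_trueQuantile hα hα1 i).mono (hm i) le_rfl).aestronglyMeasurable D ?_
      filter_upwards [hQ] with ω hω
      rw [Real.norm_eq_abs, abs_of_nonneg hω.1]
      exact hω.2
    have h1 := condExp_mono (m := pastSigma α D g X S τ) (integrable_const (0 : ℝ)) hint
      (hQ.mono fun ω hω => hω.1)
    have h2 := condExp_mono (m := pastSigma α D g X S τ) hint (integrable_const D)
      (hQ.mono fun ω hω => hω.2)
    rw [condExp_const (hm τ)] at h1 h2
    filter_upwards [h1, h2] with ω hω1 hω2
    exact ⟨hω1, hω2⟩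
  have hcard : ((Finset.Icc τ (τ + k - 1)).card : ℝ) = k := by
    rw [Nat.card_Icc]
    congr 1
    omega
  filter_upwards [hmem] with ω hω
  unfold meanQuantile
  constructor
  · exact mul_nonneg (by positivity) (Finset.sum_nonneg fun i hi => (hω i hi).1)
  · rw [one_div, inv_mul_le_iff₀ hk0, ← hcard, ← nsmul_eq_mul]
    exact Finset.sum_le_card_nsmul _ _ _ fun i hi => (hω i hi).2

lemma intervalVariation_eq (hD : 0 < D) (τ k : ℕ) :
    intervalVariation μ α D g X S τ k = ∑ t ∈ Finset.Icc τ (τ + k - 1),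
      (∫ ω, (meanQuantile μ α D g X S τ k ω - trueQuantile μ α D g X S t ω) ^ 2 ∂μ) / D ^ 2 := by
  unfold intervalVariation meanQuantile
  refine Finset.sum_congr rfl fun t _ => ?_
  rw [← integral_div]
  refine integral_congr_ae (Filter.Eventually.of_forall fun ω => ?_)
  show _ = _
  field_simp
  ring

lemma intervalVariation_nonneg (τ k : ℕ) : 0 ≤ intervalVariation μ α D g X S τ k :=
  Finset.sum_nonneg fun _ _ => integral_nonneg fun _ => sq_nonneg _

lemma intervalMargin_mem {τ k : ℕ} (hk : 1 ≤ k) (hΔ : ∀ t ∈ Set.Icc τ (τ + k - 1), 0 < Δ t) :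
    0 < intervalMargin Δ τ k ∧ ∀ t ∈ Set.Icc τ (τ + k - 1), intervalMargin Δ τ k ≤ Δ t := by
  have hfin : (Δ '' Set.Icc τ (τ + k - 1)).Finite := (Set.finite_Icc _ _).image _
  have hne : (Δ '' Set.Icc τ (τ + k - 1)).Nonempty :=
    (Set.nonempty_Icc.2 (by omega)).image _
  refine ⟨?_, fun t ht => csInf_le hfin.bddBelow ⟨t, ht, rfl⟩⟩
  obtain ⟨t, ht, hte⟩ := hne.csInf_mem hfin
  unfold intervalMargin
  rw [← hte]
  exact hΔ t ht

/-- The total excess quantile risk over an interval. -/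
lemma sum_integral_excess_le (hα : 0 < α) (hα1 : α < 1) (hD : 0 < D) (hL : 0 < L) (hg : 1 ≤ g)
    (hT : 2 ≤ T) (hX : ∀ t, Measurable (X t)) (hS : ∀ t, Measurable (S t))
    (h : DensityUpperBound μ α D g T X S L) {τ k : ℕ} (hτ : 1 ≤ τ) (hk : 1 ≤ k)
    (hτk : τ + k - 1 ≤ T) :
    ∑ t ∈ Finset.Icc τ (τ + k - 1), ∫ ω, (quantileLoss α (S t ω) (predictedRadius α D g S t ω) -
      quantileLoss α (S t ω) (trueQuantile μ α D g X S t ω)) ∂μ ≤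
    D * (1.35e14 * √(k * Real.log T) + L * intervalVariation μ α D g X S τ k) := by
  have hm := pastSigma_le (α := α) (D := D) (g := g) hX hS
  set u := meanQuantile μ α D g X S τ k with hu
  have humem := h.ae_meanQuantile_mem hα hα1 hX hS hτ hk hτk
  have hI : ∀ t ∈ Finset.Icc τ (τ + k - 1), 1 ≤ t ∧ t ≤ T ∧ τ ≤ t := fun t ht => by
    have := Finset.mem_Icc.1 ht
    omega
  have humeas : ∀ t, τ ≤ t → Measurable[pastSigma α D g X S t] u := fun t ht =>
    (measurable_meanQuantile τ k).mono (pastSigma_mono hτ ht) le_rfl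
  have huQ : ∀ t ∈ Finset.Icc τ (τ + k - 1),
      ∀ᵐ ω ∂μ, |u ω - trueQuantile μ α D g X S t ω| ≤ D := fun t ht => by
    filter_upwards [humem, h.ae_trueQuantile_mem hα hα1 (hI t ht).1 (hI t ht).2.1] with ω h1 h2
    rw [abs_le]
    constructor <;> linarith [h1.1, h1.2, h2.1, h2.2]
  have hi1 : ∀ t ∈ Finset.Icc τ (τ + k - 1), Integrable (fun ω =>
      quantileLoss α (S t ω) (predictedRadius α D g S t ω) -
        quantileLoss α (S t ω) (trueQuantile μ α D g X S t ω)) μ := fun t ht =>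
    integrable_excess hα hα1 (hm t) (hS t) (measurable_past_predictedRadius t)
      (h.ae_abs_sub_trueQuantile_le hα hα1 hD hg hX hS (hI t ht).1 (hI t ht).2.1)
  have hi2 : ∀ t ∈ Finset.Icc τ (τ + k - 1), Integrable (fun ω =>
      quantileLoss α (S t ω) (u ω) -
        quantileLoss α (S t ω) (trueQuantile μ α D g X S t ω)) μ := fun t ht =>
    integrable_excess hα hα1 (hm t) (hS t) (humeas t (hI t ht).2.2) (huQ t ht)
  -- The comparator `u` is random but known at time `τ`, so its excess risk can be computed
  -- conditionally in every round of the interval. The remaining difference is regret against `u`,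
  -- bounded for almost every `ω` separately.
  have hsplit : ∀ t ∈ Finset.Icc τ (τ + k - 1),
      ∫ ω, (quantileLoss α (S t ω) (predictedRadius α D g S t ω) -
        quantileLoss α (S t ω) (trueQuantile μ α D g X S t ω)) ∂μ ≤
      ∫ ω, (quantileLoss α (S t ω) (predictedRadius α D g S t ω) -
        quantileLoss α (S t ω) (u ω)) ∂μ +
      L / D * ∫ ω, (u ω - trueQuantile μ α D g X S t ω) ^ 2 ∂μ := fun t ht => by
    have h1 := integral_excess_le hα hα1 hD hL (hm t) (hS t) (humeas t (hI t ht).2.2) (huQ t ht)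
      (h t ⟨(hI t ht).1, (hI t ht).2.1⟩)
    have h2 := integral_sub (hi1 t ht) (hi2 t ht)
    simp only [sub_sub_sub_cancel_right] at h2
    have h3 : ∫ ω, (quantileLoss α (S t ω) (u ω) -
        quantileLoss α (S t ω) (trueQuantile μ α D g X S t ω)) ∂μ ≤
      L / D * ∫ ω, (u ω - trueQuantile μ α D g X S t ω) ^ 2 ∂μ := h1
    linarith
  refine (Finset.sum_le_sum hsplit).trans ?_
  rw [Finset.sum_add_distrib, intervalVariation_eq hD, mul_add]
  refine add_le_add ?_ (le_of_eq ?_)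
  · rw [← integral_finsetSum _ fun t ht => by
      have := (hi1 t ht).sub (hi2 t ht)
      refine this.congr (Filter.Eventually.of_forall fun ω => ?_)
      exact sub_sub_sub_cancel_right _ _ _]
    have hc : D * (1.35e14 * √(k * Real.log T)) =
        ∫ _, 1.35e14 * (D * √(k * Real.log T)) ∂μ := by
      rw [integral_const, probReal_univ, one_smul]; ring
    rw [hc]
    refine integral_mono_ae (integrable_finsetSum _ fun t ht => by
      have := (hi1 t ht).sub (hi2 t ht)
      refine this.congr (Filter.Eventually.of_forall fun ω => ?_)
      exact sub_sub_sub_cancel_right _ _ _) (integrable_const _) ?_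
    filter_upwards [h.ae_radius_mem hX hS, humem] with ω hω hωu
    have e : Finset.Icc τ (τ + k - 1) = Finset.Ico τ (τ + k) := by
      ext t
      simp only [Finset.mem_Icc, Finset.mem_Ico]
      omega
    rw [e]
    exact SAOCP.interval_regret hα hα1 hD hg hT hω hτ (by omega) hωu
  · rw [← hu, ← Finset.mul_sum, ← Finset.sum_div]
    field_simp

/-- The mean distance of the predicted radii to the true quantiles. -/
lemma mean_dist_le (hα : 0 < α) (hα1 : α < 1) (hD : 0 < D) (hL : 0 < L) (hb : 0 < b)
    (hq : 2 ≤ q) (hg : 1 ≤ g) (hT : 2 ≤ T) (hΔ : ∀ t ∈ Set.Icc 1 T, 0 < Δ t)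
    (hX : ∀ t, Measurable (X t)) (hS : ∀ t, Measurable (S t))
    (h : DensityUpperBound μ α D g T X S L) (h' : DensityLowerBound μ α D g T X S b q Δ)
    {τ k : ℕ} (hτ : 1 ≤ τ) (hk : 1 ≤ k) (hτk : τ + k - 1 ≤ T) :
    1 / (k : ℝ) * ∑ t ∈ Finset.Icc τ (τ + k - 1),
        ∫ ω, |(predictedRadius α D g S t ω - trueQuantile μ α D g X S t ω) / D| ∂μ ≤
      6 * 1.35e14 * (1 / b ^ (1 / q) * (D / intervalMargin Δ τ k) *
        (Real.log T / k) ^ (1 / (2 * q))) +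
      6 * 1.35e14 * (L ^ (1 / q) / b ^ (1 / q) * (D / intervalMargin Δ τ k) *
        (intervalVariation μ α D g X S τ k / k) ^ (1 / q)) := by
  have hm := pastSigma_le (α := α) (D := D) (g := g) hX hS
  obtain ⟨hM0, hM⟩ := intervalMargin_mem (Δ := Δ) (τ := τ) hk fun t ht =>
    hΔ t ⟨hτ.trans ht.1, ht.2.trans hτk⟩
  have hδ : 0 < intervalMargin Δ τ k / D := by positivity
  have key := mean_le_of_sum_rpow_le (τ := τ) hk (A := fun t =>
    ∫ ω, |(predictedRadius α D g S t ω - trueQuantile μ α D g X S t ω) / D| ∂μ)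
    (fun t => integral_nonneg fun _ => abs_nonneg _) hb hq hδ (K := 1.35e14) (by norm_num) hL
    (Real.log_natCast_nonneg T) (intervalVariation_nonneg (μ := μ) (α := α) (D := D) (g := g)
      (X := X) (S := S) τ k) ?_
  · rwa [one_div_div] at key
  · have hsum := sum_integral_excess_le hα hα1 hD hL hg hT hX hS h hτ hk hτk
    rw [← div_le_iff₀' hD] at hsum
    refine le_trans ?_ hsum
    rw [Finset.sum_div]
    refine Finset.sum_le_sum fun t ht => ?_
    have ht' := Finset.mem_Icc.1 ht
    have h1 : 1 ≤ t := hτ.trans ht'.1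
    have h2 : t ≤ T := ht'.2.trans hτk
    exact le_integral_excess hα hα1 hD hL hb hq (hΔ t ⟨h1, h2⟩) hδ.le
      (div_le_div_of_nonneg_right (hM t ht') hD.le) (hm t) (hS t)
      (measurable_past_predictedRadius t)
      (h.ae_abs_sub_trueQuantile_le hα hα1 hD hg hX hS h1 h2) (h t ⟨h1, h2⟩) (h' t ⟨h1, h2⟩)

/-- The coverage error of a round is at most the expected distance to the true quantile. -/
lemma IsConformalSetting.abs_coverage_sub_le {𝒴 : Type*} {Chat : ℕ → Ω → 𝒳 → ℝ → Set 𝒴}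
    {Y : ℕ → Ω → 𝒴} (hC : IsConformalSetting μ T Chat X Y S) (hα : 0 < α) (hα1 : α < 1)
    (hD : 0 < D) (hL : 0 < L) (hg : 1 ≤ g) (h : DensityUpperBound μ α D g T X S L) {t : ℕ}
    (h1 : 1 ≤ t) (h2 : t ≤ T) :
    |μ.real {ω | Y t ω ∈ Chat t ω (X t ω) (predictedRadius α D g S t ω)} - (1 - α)| ≤
      L * ∫ ω, |(predictedRadius α D g S t ω - trueQuantile μ α D g X S t ω) / D| ∂μ := by
  have hm := pastSigma_le (α := α) (D := D) (g := g) hC.measurable_input hC.measurable_radius t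
  have hne := ae_ne_of_condLaw (D := D) (μ := μ) hm (hC.measurable_radius t)
    (measurable_past_predictedRadius t) (by
      filter_upwards [h t ⟨h1, h2⟩] with ω ⟨f, hf, _⟩
      exact ⟨f, hf⟩)
  -- Coverage implies `S t ≤ ŝ_t`; conversely, if `S t < ŝ_t`, some covering radius lies below `ŝ_t`
  -- and the sets are nested. Equality has probability `0`.
  have e : {ω | Y t ω ∈ Chat t ω (X t ω) (predictedRadius α D g S t ω)} =ᵐ[μ]
      {ω | S t ω ≤ predictedRadius α D g S t ω} := by
    filter_upwards [hne, hC.isGLB_radius t ⟨h1, h2⟩] with ω hω hglb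
    refine propext ⟨fun hmem => hglb.1 hmem, fun hle => ?_⟩
    obtain ⟨s, hs, hslt⟩ := hglb.exists_between (lt_of_le_of_ne hle hω)
    exact hC.nested t ω (X t ω) hslt.2.le hs
  rw [measureReal_congr e]
  exact abs_measureReal_sub_le hα hα1 hD hL hm (hC.measurable_radius t)
    (measurable_past_predictedRadius t)
    (h.ae_abs_sub_trueQuantile_le hα hα1 hD hg hC.measurable_input hC.measurable_radius h1 h2)
    (h t ⟨h1, h2⟩)

end Setting

theorem mainTheorem4 :
    ∃ C : ℝ, 0 < C ∧
      ∀ (Ω : Type*) [MeasurableSpace Ω] (μ : Measure Ω) [IsProbabilityMeasure μ]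
        (𝒳 : Type*) [MeasurableSpace 𝒳] (𝒴 : Type*)
        (Chat : ℕ → Ω → 𝒳 → ℝ → Set 𝒴) (X : ℕ → Ω → 𝒳) (Y : ℕ → Ω → 𝒴) (S : ℕ → Ω → ℝ)
        (α D L b q : ℝ) (Δ : ℕ → ℝ) (g T : ℕ),
        0 < α → α < 1 → 0 < D → 0 < L → 0 < b → 2 ≤ q → 1 ≤ g → 2 ≤ T →
        (∀ t ∈ Set.Icc 1 T, 0 < Δ t) →
        IsConformalSetting μ T Chat X Y S →
        DensityUpperBound μ α D g T X S L →
        DensityLowerBound μ α D g T X S b q Δ →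
        ∀ τ k : ℕ, 1 ≤ τ → 1 ≤ k → τ + k - 1 ≤ T →
          (1 / (k : ℝ) * ∑ t ∈ Finset.Icc τ (τ + k - 1),
              ∫ ω, |(predictedRadius α D g S t ω - trueQuantile μ α D g X S t ω) / D| ∂μ
            ≤ C * (1 / b ^ (1 / q) * (D / intervalMargin Δ τ k) *
                  (Real.log T / k) ^ (1 / (2 * q)))
              + C * (L ^ (1 / q) / b ^ (1 / q) * (D / intervalMargin Δ τ k) *
                  (intervalVariation μ α D g X S τ k / k) ^ (1 / q))) ∧
          (1 / (k : ℝ) * ∑ t ∈ Finset.Icc τ (τ + k - 1),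
              |μ.real {ω | Y t ω ∈ Chat t ω (X t ω) (predictedRadius α D g S t ω)} - (1 - α)|
            ≤ C * (L / b ^ (1 / q) * (D / intervalMargin Δ τ k) *
                  (Real.log T / k) ^ (1 / (2 * q)))
              + C * (L ^ (1 + 1 / q) / b ^ (1 / q) * (D / intervalMargin Δ τ k) *
                  (intervalVariation μ α D g X S τ k / k) ^ (1 / q))) := by
  -- The `6` comes from self-calibration; `1.35e14` is `4.5`, from the dyadic splitting, times
  -- `3e13`, from the regret over the lifetime of an expert.
  refine ⟨6 * 1.35e14, by norm_num, ?_⟩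
  intro Ω _ μ _ 𝒳 _ 𝒴 Chat X Y S α D L b q Δ g T hα hα1 hD hL hb hq hg hT hΔ hC hup hlow τ k hτ
    hk hτk
  have hdist := mean_dist_le hα hα1 hD hL hb hq hg hT hΔ hC.measurable_input hC.measurable_radius
    hup hlow hτ hk hτk
  refine ⟨hdist, ?_⟩
  have hL1 : L ^ (1 + 1 / q) = L * L ^ (1 / q) := by rw [Real.rpow_add hL, Real.rpow_one]
  calc 1 / (k : ℝ) * ∑ t ∈ Finset.Icc τ (τ + k - 1),
        |μ.real {ω | Y t ω ∈ Chat t ω (X t ω) (predictedRadius α D g S t ω)} - (1 - α)|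
      ≤ 1 / (k : ℝ) * ∑ t ∈ Finset.Icc τ (τ + k - 1), L *
        ∫ ω, |(predictedRadius α D g S t ω - trueQuantile μ α D g X S t ω) / D| ∂μ := by
        refine mul_le_mul_of_nonneg_left (Finset.sum_le_sum fun t ht => ?_) (by positivity)
        have ht' := Finset.mem_Icc.1 ht
        exact hC.abs_coverage_sub_le hα hα1 hD hL hg hup (hτ.trans ht'.1) (ht'.2.trans hτk)
    _ = L * (1 / (k : ℝ) * ∑ t ∈ Finset.Icc τ (τ + k - 1),
        ∫ ω, |(predictedRadius α D g S t ω - trueQuantile μ α D g X S t ω) / D| ∂μ) := by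
        rw [← Finset.mul_sum]; ring
    _ ≤ _ := (mul_le_mul_of_nonneg_left hdist hL.le).trans (le_of_eq (by rw [hL1]; ring))
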